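/- Let $G=(V,E)$ be a finite simple graph with $n$ nodes and $m\ge 1$ edges, and let $\lambda\in[0,1]$. For $U\subseteq V$ let $E(U)$ be the set of edges with both endpoints in $U$. The wedge graph $Z(H)$ of a graph $H$ has as nodes the edges of $H$ that lie in some wedge, where a wedge is a triple $(x,y,z)$ of distinct vertices such that $xy$ and $yz$ are edges of $H$ and $xz$ is not; two nodes are adjacent in $Z(H)$ if the two edges form a wedge. A matching $M$ of $Z((U,E(U)))$ defines a labeling $L$ of $E(U)$: an edge is weak if it is an endpoint of an element of $M$, and strong otherwise. Write $\deg_s(v,U,L)$ and $\deg_w(v,U,L)$ for the number of strong and weak edges of $E(U)$ at $v$, $m_s(U,L)$ and $m_w(U,L)$ for the number of strong and weak edges in $E(U)$, and $q(U,L)=(m_s(U,L)+\lambda m_w(U,L))/|U|$ for $U\neq\emptyset$. The algorithm $\textsc{Greedy}(G,\lambda)$ is the following. Start with $U=V$ and a matching $M$ of $Z(G)$ obtained by adding edges of $Z(G)$ with both endpoints unmatched, until there are none. While $U\ne\emptyset$: choose $u\in U$ that minimizes $\deg_s(u,U,L)+\lambda\deg_w(u,U,L)$; let $N(u)$ be the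 set of edges of $E(U)$ at $u$; remove $u$ from $U$, replace the wedge graph by $Z((U,E(U)))$, and update $M$ as follows: for each $a\in N(u)$ in turn, if $(a,b)\in M$ for some $b$, delete $(a,b)$ from $M$, and if $b\notin N(u)$ and there is $t\notin N(u)$ that is not an endpoint of any element of $M$ and is adjacent to $b$ in the wedge graph, add $(b,t)$ to $M$ for one such $t$. Then update $L$ and the weighted degrees. Finally return a pair $(U,L)$ with the largest $q(U,L)$ among those with $U\neq\emptyset$ that occurred. Let $n'$ and $m'$ be the numbers of nodes and edges of $Z(G)$. Then, throughout the algorithm, $M$ is a maximal matching of $Z((U,E(U)))$, and $\textsc{Greedy}$, given $G$ as a list of edges, can be implemented on a real RAM (unit-cost arithmetic and comparisons on $O(\log n)$-bit words and on real numbers), with the wedge graph, the matching and the weighted degrees of the remaining nodes maintained in memory, so that its running time is in \[ O\bigl(mn+(n'+m')+m\log n+nm\bigr)\subseteq O(nm), \] with constants that do not depend on $G$ and $\lambda$. -/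

import Mathlib

/-! ## Graphs, wedge graphs, labelings and scores -/

namespace STC

/-- The graph `(U, E(U))`, kept on the vertex type `V`. -/
def restrict {V : Type*} (G : SimpleGraph V) (U : Finset V) : SimpleGraph V where
  Adj x y := G.Adj x y ∧ x ∈ U ∧ y ∈ U
  symm := ⟨fun _ _ h => ⟨h.1.symm, h.2.2, h.2.1⟩⟩
  loopless := ⟨fun _ h => G.irrefl h.1⟩

/-- `(x, y, z)` is a wedge: `xy` and `yz` are edges and `xz` is not. -/
def IsWedge {V : Type*} (G : SimpleGraph V) (x y z : V) : Prop :=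
  G.Adj x y ∧ G.Adj y z ∧ x ≠ z ∧ ¬ G.Adj x z

/-- Adjacency of the wedge graph `Z(G)`: two edges of `G` that form a wedge. It is a graph on the
type `Sym2 V`; the nodes of `Z(G)` proper are those in its support, see `wedgeNodes`. -/
def wedgeGraph {V : Type*} (G : SimpleGraph V) : SimpleGraph (Sym2 V) where
  Adj e f := ∃ x y z, IsWedge G x y z ∧ e = s(x, y) ∧ f = s(y, z)
  symm := ⟨by
    rintro e f ⟨x, y, z, ⟨h1, h2, h3, h4⟩, rfl, rfl⟩
    exact ⟨z, y, x, ⟨h2.symm, h1.symm, h3.symm, fun h => h4 h.symm⟩, Sym2.eq_swap, Sym2.eq_swap⟩⟩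
  loopless := ⟨by
    rintro e ⟨x, y, z, ⟨h1, h2, h3, h4⟩, he, hf⟩
    rw [he, Sym2.eq_iff] at hf
    rcases hf with ⟨h, _⟩ | ⟨h, _⟩
    · exact G.irrefl (h ▸ h1)
    · exact h3 h⟩

/-- The nodes of `Z(G)`: the edges of `G` that contribute to at least one wedge. -/
def wedgeNodes {V : Type*} (G : SimpleGraph V) : Set (Sym2 V) :=
  {e | ∃ f, (wedgeGraph G).Adj e f}

/-- `a` is an endpoint of an edge in `M`. -/
def Covered {α : Type*} (M : Set (Sym2 α)) (a : α) : Prop := ∃ p ∈ M, a ∈ p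

/-- `M` is a maximal matching of the graph `Z`. -/
def IsMaximalMatching {α : Type*} (Z : SimpleGraph α) (M : Set (Sym2 α)) : Prop :=
  M ⊆ Z.edgeSet ∧
  (∀ p ∈ M, ∀ q ∈ M, ∀ a, a ∈ p → a ∈ q → p = q) ∧
  (∀ a b, Z.Adj a b → Covered M a ∨ Covered M b)

/-- A labeling is given by its set `L` of weak edges; the other edges are strong. -/
noncomputable def mStrong {V : Type*} (G : SimpleGraph V) (U : Finset V)
    (L : Set (Sym2 V)) : ℕ := ((restrict G U).edgeSet \ L).ncard

noncomputable def mWeak {V : Type*} (G : SimpleGraph V) (U : Finset V)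
    (L : Set (Sym2 V)) : ℕ := ((restrict G U).edgeSet ∩ L).ncard

/-- `(m_s(U, L) + lam * m_w(U, L)) / |U|`. -/
noncomputable def score {V : Type*} (G : SimpleGraph V) (lam : ℝ) (U : Finset V)
    (L : Set (Sym2 V)) : ℝ :=
  ((mStrong G U L : ℝ) + lam * (mWeak G U L : ℝ)) / (U.card : ℝ)

/-- The weighted degree `deg_s(v, U, L) + lam * deg_w(v, U, L)`. -/
noncomputable def weightedDegree {V : Type*} (G : SimpleGraph V) (lam : ℝ) (U : Finset V)
    (L : Set (Sym2 V)) (v : V) : ℝ :=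
  (((restrict G U).incidenceSet v \ L).ncard : ℝ) +
    lam * (((restrict G U).incidenceSet v ∩ L).ncard : ℝ)

/-- The labeling given by a matching `M` of the wedge graph: the endpoints of the edges in `M`
(a vertex cover, if `M` is maximal) are weak, all other edges are strong. -/
def weakEdges {V : Type*} (M : Set (Sym2 (Sym2 V))) : Set (Sym2 V) := {e | Covered M e}

/-! ## The algorithm Greedy

The pseudocode leaves choices open (the edge picked for the matching, the order of `N(v)`, the node
`t`, ties in the minimum), so that each procedure is a relation. -/

/-- The sets `M` that the matching procedure can reach: starting from the empty set, pick an edge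
of `Z` none of whose endpoints is covered so far, and add it. -/
inductive AprReach {α : Type*} (Z : SimpleGraph α) : Set (Sym2 α) → Prop
  | empty : AprReach Z ∅
  | pick (M : Set (Sym2 α)) (a b : α) : AprReach Z M → Z.Adj a b → ¬ Covered M a →
      ¬ Covered M b → AprReach Z (insert s(a, b) M)

/-- A possible result of the matching procedure, which stops when no edge is left to pick. -/
def AprMatching {α : Type*} (Z : SimpleGraph α) (M : Set (Sym2 α)) : Prop :=
  AprReach Z M ∧ ¬ ∃ a b, Z.Adj a b ∧ ¬ Covered M a ∧ ¬ Covered M b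

/-- `(b, t)` can replace a deleted edge `(a, b)`; here `N` is the set of deleted nodes. -/
def IsReplacement {α : Type*} (Z : SimpleGraph α) (N : Set α) (M : Set (Sym2 α))
    (b t : α) : Prop :=
  b ∉ N ∧ t ∉ N ∧ ¬ Covered M t ∧ Z.Adj b t

/-- The pass of the loop of Dynamic-Vertex-Cover for the node `a`, turning `M` into `M'`. -/
inductive DynStep {α : Type*} (Z : SimpleGraph α) (N : Set α) (a : α) (M : Set (Sym2 α)) :
    Set (Sym2 α) → Prop
  | unmatched : (¬ ∃ b, s(a, b) ∈ M) → DynStep Z N a M M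
  | replace (b t : α) : s(a, b) ∈ M → IsReplacement Z N (M \ {s(a, b)}) b t →
      DynStep Z N a M (insert s(b, t) (M \ {s(a, b)}))
  | drop (b : α) : s(a, b) ∈ M → (¬ ∃ t, IsReplacement Z N (M \ {s(a, b)}) b t) →
      DynStep Z N a M (M \ {s(a, b)})

/-- The loop of Dynamic-Vertex-Cover over a list of nodes. -/
inductive DynLoop {α : Type*} (Z : SimpleGraph α) (N : Set α) :
    List α → Set (Sym2 α) → Set (Sym2 α) → Prop
  | nil (M : Set (Sym2 α)) : DynLoop Z N [] M M
  | cons (a : α) (l : List α) (M M' M'' : Set (Sym2 α)) : DynStep Z N a M M' →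
      DynLoop Z N l M' M'' → DynLoop Z N (a :: l) M M''

/-- Dynamic-Vertex-Cover: the nodes in `N` are deleted, `Z` is the graph after the deletion, and
`M'` is a possible result for the matching `M`. -/
def DynamicVertexCover {α : Type*} (Z : SimpleGraph α) (N : Set α) (M M' : Set (Sym2 α)) : Prop :=
  ∃ l : List α, l.Nodup ∧ (∀ a, a ∈ l ↔ a ∈ N) ∧ DynLoop Z N l M M'

/-- A run of Greedy: `U i` and `M i` are the vertex set and the matching of the wedge graph
after `i` iterations, and `u i` is the vertex deleted next. -/
structure GreedyRun {V : Type*} [Fintype V] [DecidableEq V] (G : SimpleGraph V) (lam : ℝ)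
    (U : ℕ → Finset V) (M : ℕ → Set (Sym2 (Sym2 V))) (u : ℕ → V) : Prop where
  start_vertices : U 0 = Finset.univ
  start_matching : AprMatching (wedgeGraph G) (M 0)
  mem : ∀ i < Fintype.card V, u i ∈ U i
  argmin : ∀ i < Fintype.card V, ∀ v ∈ U i,
    weightedDegree G lam (U i) (weakEdges (M i)) (u i) ≤
      weightedDegree G lam (U i) (weakEdges (M i)) v
  delete : ∀ i < Fintype.card V, U (i + 1) = (U i).erase (u i)
  relabel : ∀ i < Fintype.card V, DynamicVertexCover (wedgeGraph (restrict G (U (i + 1))))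
    ((restrict G (U i)).incidenceSet (u i)) (M i) (M (i + 1))

end STC

/-! ## The machine model: a real RAM

Programs have access to finitely many arrays of machine words and finitely many arrays of real
numbers (a scalar variable is a cell of an array). The words are natural numbers below a bound
`W`, which is taken polynomial in the size of the input, that is, words have `O(log n)` bits.
Arithmetic and comparisons on words and on reals take unit time; reals cannot be rounded or
converted to words. -/

namespace RAM

structure State where
  ints : ℕ → ℕ → ℕ
  reals : ℕ → ℕ → ℝ

/-- Word expressions; `get a i` is the cell `i` of the array `a`. -/
inductive IExp
  | const (k : ℕ)
  | get (a : ℕ) (i : IExp)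
  | add (e f : IExp)
  | sub (e f : IExp)
  | mul (e f : IExp)
  | div (e f : IExp)

/-- Real expressions. -/
inductive RExp
  | ofInt (e : IExp)
  | get (a : ℕ) (i : IExp)
  | add (e f : RExp)
  | sub (e f : RExp)
  | mul (e f : RExp)

/-- Tests. -/
inductive BExp
  | ilt (e f : IExp)
  | ieq (e f : IExp)
  | rlt (e f : RExp)
  | not (b : BExp)
  | and (b c : BExp)

inductive Cmd
  | skip
  | setI (a : ℕ) (i : IExp) (e : IExp)
  | setR (a : ℕ) (i : IExp) (e : RExp)
  | seq (p q : Cmd)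
  | ite (b : BExp) (p q : Cmd)
  | loop (b : BExp) (p : Cmd)

def IExp.eval (s : State) : IExp → ℕ
  | const k => k
  | get a i => s.ints a (i.eval s)
  | add e f => e.eval s + f.eval s
  | sub e f => e.eval s - f.eval s
  | mul e f => e.eval s * f.eval s
  | div e f => e.eval s / f.eval s

def RExp.eval (s : State) : RExp → ℝ
  | ofInt e => (e.eval s : ℝ)
  | get a i => s.reals a (i.eval s)
  | add e f => e.eval s + f.eval s
  | sub e f => e.eval s - f.eval s
  | mul e f => e.eval s * f.eval s

def BExp.Holds (s : State) : BExp → Prop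
  | ilt e f => e.eval s < f.eval s
  | ieq e f => e.eval s = f.eval s
  | rlt e f => e.eval s < f.eval s
  | not b => ¬ b.Holds s
  | and b c => b.Holds s ∧ c.Holds s

/-- The number of operations in an expression. -/
def IExp.cost : IExp → ℕ
  | const _ => 1
  | get _ i => i.cost + 1
  | add e f => e.cost + f.cost + 1
  | sub e f => e.cost + f.cost + 1
  | mul e f => e.cost + f.cost + 1
  | div e f => e.cost + f.cost + 1

def RExp.cost : RExp → ℕ
  | ofInt e => e.cost + 1
  | get _ i => i.cost + 1
  | add e f => e.cost + f.cost + 1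
  | sub e f => e.cost + f.cost + 1
  | mul e f => e.cost + f.cost + 1

def BExp.cost : BExp → ℕ
  | ilt e f => e.cost + f.cost + 1
  | ieq e f => e.cost + f.cost + 1
  | rlt e f => e.cost + f.cost + 1
  | not b => b.cost + 1
  | and b c => b.cost + c.cost + 1

def State.setI (s : State) (a i x : ℕ) : State :=
  { s with ints := Function.update s.ints a (Function.update (s.ints a) i x) }

noncomputable def State.setR (s : State) (a i : ℕ) (x : ℝ) : State :=
  { s with reals := Function.update s.reals a (Function.update (s.reals a) i x) }

/-- `Exec W p s s' t`: with word bound `W`, the program `p` started in the state `s` halts in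
the state `s'` after `t` steps. A program that tries to store a number `≥ W` in a word cell has no
execution. -/
inductive Exec (W : ℕ) : Cmd → State → State → ℕ → Prop
  | skip (s : State) : Exec W .skip s s 1
  | setI (s : State) (a : ℕ) (i e : IExp) : e.eval s < W →
      Exec W (.setI a i e) s (s.setI a (i.eval s) (e.eval s)) (i.cost + e.cost + 1)
  | setR (s : State) (a : ℕ) (i : IExp) (e : RExp) :
      Exec W (.setR a i e) s (s.setR a (i.eval s) (e.eval s)) (i.cost + e.cost + 1)
  | seq (p q : Cmd) (s s' s'' : State) (t t' : ℕ) : Exec W p s s' t → Exec W q s' s'' t' →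
      Exec W (.seq p q) s s'' (t + t')
  | iteTrue (b : BExp) (p q : Cmd) (s s' : State) (t : ℕ) : b.Holds s → Exec W p s s' t →
      Exec W (.ite b p q) s s' (b.cost + 1 + t)
  | iteFalse (b : BExp) (p q : Cmd) (s s' : State) (t : ℕ) : ¬ b.Holds s → Exec W q s s' t →
      Exec W (.ite b p q) s s' (b.cost + 1 + t)
  | loopTrue (b : BExp) (p : Cmd) (s s' s'' : State) (t t' : ℕ) : b.Holds s → Exec W p s s' t →
      Exec W (.loop b p) s' s'' t' → Exec W (.loop b p) s s'' (b.cost + 1 + t + t')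
  | loopFalse (b : BExp) (p : Cmd) (s : State) : ¬ b.Holds s →
      Exec W (.loop b p) s s (b.cost + 1)

end RAM

/-! ## Implementations of Greedy -/

namespace STC

/-- A list of the `m` edges of a graph on `0, …, n - 1`, each listed once, in any order and with
any orientation. -/
structure EdgeList {n : ℕ} (G : SimpleGraph (Fin n)) (m : ℕ) where
  src : Fin m → Fin n
  dst : Fin m → Fin n
  injective : Function.Injective fun e => s(src e, dst e)
  range_eq : Set.range (fun e => s(src e, dst e)) = G.edgeSet

def EdgeList.edge {n m : ℕ} {G : SimpleGraph (Fin n)} (E : EdgeList G m) (e : Fin m) :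
    Sym2 (Fin n) := s(E.src e, E.dst e)

/-- The input: word array 0 holds `n, m`, word arrays 1 and 2 hold the endpoints of the edges,
real array 0 holds `lam`; everything else is zero. -/
noncomputable def inputState {n m : ℕ} {G : SimpleGraph (Fin n)} (E : EdgeList G m) (lam : ℝ) :
    RAM.State where
  ints a i :=
    if a = 0 then (if i = 0 then n else if i = 1 then m else 0)
    else if a = 1 then (if h : i < m then (E.src ⟨i, h⟩ : ℕ) else 0)
    else if a = 2 then (if h : i < m then (E.dst ⟨i, h⟩ : ℕ) else 0)
    else 0
  reals a i := if a = 0 ∧ i = 0 then lam else 0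

/-- The memory holds the data that Greedy maintains, for the vertex set `U` and the matching `M`:
* word array 3, cell 0: the number of remaining vertices;
* word array 4: the indicator of `U`;
* word array 5: the indicator of `E(U)`;
* word array 6: the matching, as the partner of an edge plus one, or 0 if it has no partner;
* word arrays 7, 8, 9: the wedge graph of `(U, E(U))` by adjacency lists. Cell `e` of arrays 7 and 8
  holds the start and the length of the list of `e`, which is stored in array 9;
  a node of the wedge graph is deleted by clearing its entry in array 5;
* real array 1: the priorities of the remaining vertices. -/
structure Represents {n m : ℕ} {G : SimpleGraph (Fin n)} (E : EdgeList G m) (lam : ℝ)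
    (U : Finset (Fin n)) (M : Set (Sym2 (Sym2 (Fin n)))) (s : RAM.State) : Prop where
  count : s.ints 3 0 = U.card
  vertices : ∀ v : Fin n, s.ints 4 v = if v ∈ U then 1 else 0
  edges : ∀ e : Fin m, s.ints 5 e = if E.src e ∈ U ∧ E.dst e ∈ U then 1 else 0
  matching : ∀ e : Fin m,
    (∀ f : Fin m, s(E.edge e, E.edge f) ∈ M ↔ s.ints 6 e = (f : ℕ) + 1) ∧
    ((∀ f : Fin m, s(E.edge e, E.edge f) ∉ M) → s.ints 6 e = 0)
  wedges : ∀ e f : Fin m, (wedgeGraph (restrict G U)).Adj (E.edge e) (E.edge f) ↔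
    s.ints 5 e = 1 ∧ s.ints 5 f = 1 ∧ ∃ j < s.ints 8 e, s.ints 9 (s.ints 7 e + j) = (f : ℕ)
  priorities : ∀ v ∈ U, s.reals 1 (v : ℕ) = weightedDegree G lam U (weakEdges M) v

/-- The memory holds the output `(U, L)`: word array 10 is the indicator of `U`, and word array 11
is 1 at the weak edges and 0 at the strong edges of `E(U)`. -/
def IsOutput {n m : ℕ} {G : SimpleGraph (Fin n)} (E : EdgeList G m)
    (U : Finset (Fin n)) (L : Set (Sym2 (Fin n))) (s : RAM.State) : Prop :=
  (∀ v : Fin n, s.ints 10 v = if v ∈ U then 1 else 0) ∧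
  (∀ e : Fin m, E.src e ∈ U → E.dst e ∈ U →
    (E.edge e ∈ L → s.ints 11 e = 1) ∧ (E.edge e ∉ L → s.ints 11 e = 0))

/-- `init; while there are nodes do body; fin`. -/
def greedyProgram (init body fin : RAM.Cmd) : RAM.Cmd :=
  .seq init (.seq (.loop (.ilt (.const 0) (.get 3 (.const 0))) body) fin)

/-- On this input, the program carries out Greedy and halts after exactly `T` steps: the states
after the initialization and after each pass of the main loop represent the states of one run of
Greedy, and the output is a pair `(U, L)` with the largest score among the pairs that were tested
(the empty vertex set has no score and is not tested). -/
def CarriesOutGreedy {n m : ℕ} {G : SimpleGraph (Fin n)} (W : ℕ) (init body fin : RAM.Cmd)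
    (E : EdgeList G m) (lam : ℝ) (T : ℕ) : Prop :=
  ∃ (U : ℕ → Finset (Fin n)) (M : ℕ → Set (Sym2 (Sym2 (Fin n)))) (u : ℕ → Fin n)
    (σ : ℕ → RAM.State) (out : RAM.State),
    GreedyRun G lam U M u ∧
    (∃ t, RAM.Exec W init (inputState E lam) (σ 0) t) ∧
    (∀ i < n, ∃ t, RAM.Exec W body (σ i) (σ (i + 1)) t) ∧
    (∀ i ≤ n, Represents E lam (U i) (M i) (σ i)) ∧
    RAM.Exec W (greedyProgram init body fin) (inputState E lam) out T ∧
    ∃ i < n, (∀ j < n, score G lam (U j) (weakEdges (M j)) ≤ score G lam (U i) (weakEdges (M i))) ∧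
      IsOutput E (U i) (weakEdges (M i)) out

/-- The bound `mn + (n' + m') + m log n + nm`, where `n'` and `m'` are the numbers of nodes and
edges of the wedge graph. -/
noncomputable def greedyBound {n : ℕ} (G : SimpleGraph (Fin n)) (m : ℕ) : ℝ :=
  (m : ℝ) * n + (((wedgeNodes G).ncard : ℝ) + ((wedgeGraph G).edgeSet.ncard : ℝ))
    + m * Real.log n + n * m

end STC

/-! ## Maximal matchings under deletion of nodes -/

namespace STC

/-! Maximality. The wedge graph of an induced subgraph is an induced subgraph of the wedge graph
(`wedgeGraph_restrict_adj`), because the two ends of the missing edge of a wedge are among the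
vertices kept. So deleting `u` only removes the nodes `N(u)` and leaves all other adjacencies alone
(`wedgeGraph_erase_adj`). When a pair `(a, b)` with `a` in `N(u)` is dropped, only wedge graph edges
at `b` can become uncovered; either `b` is matched again, or its surviving neighbours are all
covered already. This is `DynStep.invariant`; it yields `DynamicVertexCover.isMaximalMatching` and,
by induction on the passes, `GreedyRun.isMaximalMatching` for every run.

Running time. As `mn` is itself a summand of the bound, a program with `O(mn)` steps suffices, and
no priority queue is needed: each of the `n` passes may spend `O(m)` on recomputing all priorities
and rescanning all edges. The wedge graph is built by testing every edge against every vertex in an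
adjacency matrix. Within a pass, only matched edges at the deleted vertex cost `O(n)` each, for the
search of a replacement. Each vertex is deleted once, so the degrees sum to at most `2m` over all
passes (`passes_sum_degree`).

The delicate point is that `m` may be much smaller than `n`, so that a pass cannot afford `O(n)`
steps. Hence vertices on no input edge wait on a stack and are deleted first, having weighted degree
0, which is least because `lam` is nonnegative; the other vertices are reached by scanning the
endpoints of edges; priorities are cleared at endpoints only; and the best vertex set is stored as
its size, to be decoded once at the end from the deletion times (`passes_deletionTime`).

The invariant `Maintains` is established by `exec_init` and preserved by `exec_body`;
`exists_carriesOutGreedy` strings the passes together and adds up the costs. The inclusion in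
`O(nm)` follows from `n' ≤ m`, `m' ≤ 2mn` and `log n ≤ n` (`greedyBound_le`). -/

theorem AprReach.isMatching {α : Type*} {Z : SimpleGraph α} {M : Set (Sym2 α)}
    (h : AprReach Z M) :
    M ⊆ Z.edgeSet ∧ ∀ p ∈ M, ∀ q ∈ M, ∀ a, a ∈ p → a ∈ q → p = q := by
  induction h with
  | empty => simp
  | pick M a b _ hab ha hb ih =>
    have key : ∀ q ∈ M, ∀ c, c ∈ s(a, b) → c ∉ q := by
      intro q hq c hc hcq
      rcases Sym2.mem_iff.1 hc with rfl | rfl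
      · exact ha ⟨q, hq, hcq⟩
      · exact hb ⟨q, hq, hcq⟩
    refine ⟨Set.insert_subset hab ih.1, ?_⟩
    rintro p (rfl | hp) q (rfl | hq) c hcp hcq
    · rfl
    · exact absurd hcq (key q hq c hcp)
    · exact absurd hcp (key p hp c hcq)
    · exact ih.2 p hp q hq c hcp hcq

theorem AprMatching.isMaximalMatching {α : Type*} {Z : SimpleGraph α} {M : Set (Sym2 α)}
    (h : AprMatching Z M) : IsMaximalMatching Z M := by
  refine ⟨h.1.isMatching.1, h.1.isMatching.2, fun a b hab => ?_⟩
  by_contra hc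
  exact h.2 ⟨a, b, hab, fun h => hc (Or.inl h), fun h => hc (Or.inr h)⟩

/-- What the loop of Dynamic-Vertex-Cover maintains while the nodes in `l` are still to be
processed. -/
structure DynInvariant {α : Type*} (Z Z' : SimpleGraph α) (N : Set α) (l : List α)
    (M : Set (Sym2 α)) : Prop where
  subset : M ⊆ Z.edgeSet
  matching : ∀ p ∈ M, ∀ q ∈ M, ∀ a, a ∈ p → a ∈ q → p = q
  covers : ∀ a b, Z'.Adj a b → Covered M a ∨ Covered M b
  pending : ∀ p ∈ M, ∀ a ∈ p, a ∈ N → ∃ c ∈ p, c ∈ l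

theorem Covered.mono {α : Type*} {M M' : Set (Sym2 α)} (h : M ⊆ M') {a : α} (ha : Covered M a) :
    Covered M' a := ha.imp fun _ hp => ⟨h hp.1, hp.2⟩

theorem Covered.diff {α : Type*} {M : Set (Sym2 α)} {a b c : α} (h : Covered M c) (ha : c ≠ a)
    (hb : c ≠ b) : Covered (M \ {s(a, b)}) c := by
  obtain ⟨p, hp, hc⟩ := h
  refine ⟨p, ⟨hp, ?_⟩, hc⟩
  rintro rfl
  rcases Sym2.mem_iff.1 hc with h | h
  exacts [ha h, hb h]

/-- Dropping the pair `s(a, b)` uncovers at most `a` and `b`, and `a` is isolated in `Z'`, so `b` is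
the only place where maximality can fail. -/
theorem DynInvariant.covers_diff {α : Type*} {Z Z' : SimpleGraph α} {N : Set α} {a : α}
    {l : List α} {M : Set (Sym2 α)} (h : DynInvariant Z Z' N l M) (ha : ∀ c, ¬ Z'.Adj a c)
    {b : α} (x y : α) (hxy : Z'.Adj x y) :
    Covered (M \ {s(a, b)}) x ∨ Covered (M \ {s(a, b)}) y ∨ x = b ∨ y = b := by
  by_cases hxb : x = b
  · simp [hxb]
  by_cases hyb : y = b
  · simp [hyb]
  have hxa : x ≠ a := by rintro rfl; exact ha y hxy
  have hya : y ≠ a := by rintro rfl; exact ha x hxy.symm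
  rcases h.covers x y hxy with hc | hc
  · exact Or.inl (hc.diff hxa hxb)
  · exact Or.inr (Or.inl (hc.diff hya hyb))

/-- In the middle of the loop `M` is a matching of the old graph `Z`, since pairs meeting `N` may
still be waiting, but it already covers every edge of the new graph `Z'`. A replacement restores
coverage at `b`; if there is none, then every `Z'`-neighbour of `b` is covered, vacuously so when
`b` is itself in `N`. -/
theorem DynStep.invariant {α : Type*} {Z Z' : SimpleGraph α} {N : Set α}
    (hZ : ∀ a b, Z'.Adj a b ↔ Z.Adj a b ∧ a ∉ N ∧ b ∉ N) {a : α} (haN : a ∈ N) {l : List α}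
    {M M' : Set (Sym2 α)} (hs : DynStep Z' N a M M') (h : DynInvariant Z Z' N (a :: l) M) :
    DynInvariant Z Z' N l M' := by
  have hna : ∀ c, ¬ Z'.Adj a c := fun c hc => ((hZ a c).1 hc).2.1 haN
  have rest : ∀ b, s(a, b) ∈ M → ∀ p ∈ M \ {s(a, b)}, a ∉ p ∧ b ∉ p := by
    intro b hb p hp
    refine ⟨fun hap => hp.2 (h.matching p hp.1 _ hb a hap (by simp)),
      fun hbp => hp.2 (h.matching p hp.1 _ hb b hbp (by simp))⟩
  have pend : ∀ b, s(a, b) ∈ M → ∀ p ∈ M \ {s(a, b)}, ∀ x ∈ p, x ∈ N → ∃ c ∈ p, c ∈ l := by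
    intro b hb p hp x hx hxN
    obtain ⟨c, hcp, hcl⟩ := h.pending p hp.1 x hx hxN
    rcases List.mem_cons.1 hcl with rfl | hcl
    · exact absurd hcp (rest b hb p hp).1
    · exact ⟨c, hcp, hcl⟩
  cases hs with
  | unmatched hnone =>
    refine ⟨h.subset, h.matching, h.covers, fun p hp x hx hxN => ?_⟩
    obtain ⟨c, hcp, hcl⟩ := h.pending p hp x hx hxN
    rcases List.mem_cons.1 hcl with rfl | hcl
    · obtain ⟨b, rfl⟩ := Sym2.mem_iff_exists.1 hcp
      exact absurd ⟨b, hp⟩ hnone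
    · exact ⟨c, hcp, hcl⟩
  | replace b t hab hr =>
    obtain ⟨hbN, htN, htc, hbt⟩ := hr
    have key : ∀ q ∈ M \ {s(a, b)}, ∀ c, c ∈ s(b, t) → c ∉ q := by
      intro q hq c hc hcq
      rcases Sym2.mem_iff.1 hc with rfl | rfl
      · exact (rest _ hab q hq).2 hcq
      · exact htc ⟨q, hq, hcq⟩
    refine ⟨Set.insert_subset ((hZ _ _).1 hbt).1 (Set.sdiff_subset.trans h.subset), ?_, ?_, ?_⟩
    · rintro p (rfl | hp) q (rfl | hq) c hcp hcq
      · rfl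
      · exact absurd hcq (key q hq c hcp)
      · exact absurd hcp (key p hp c hcq)
      · exact h.matching p hp.1 q hq.1 c hcp hcq
    · intro x y hxy
      have hcb : Covered (insert s(b, t) (M \ {s(a, b)})) b :=
        ⟨_, Set.mem_insert _ _, by simp⟩
      rcases h.covers_diff hna (b := b) x y hxy with hc | hc | rfl | rfl
      · exact Or.inl (hc.mono (Set.subset_insert _ _))
      · exact Or.inr (hc.mono (Set.subset_insert _ _))
      · exact Or.inl hcb
      · exact Or.inr hcb
    · rintro p (rfl | hp) x hx hxN
      · rcases Sym2.mem_iff.1 hx with rfl | rfl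
        exacts [absurd hxN hbN, absurd hxN htN]
      · exact pend b hab p hp x hx hxN
  | drop b hab hno =>
    refine ⟨Set.sdiff_subset.trans h.subset, fun p hp q hq => h.matching p hp.1 q hq.1, ?_,
      pend b hab⟩
    have hcov : ∀ t, Z'.Adj b t → Covered (M \ {s(a, b)}) t := by
      intro t hbt
      by_contra hc
      exact hno ⟨t, ((hZ _ _).1 hbt).2.1, ((hZ _ _).1 hbt).2.2, hc, hbt⟩
    intro x y hxy
    rcases h.covers_diff hna (b := b) x y hxy with hc | hc | rfl | rfl
    · exact Or.inl hc
    · exact Or.inr hc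
    · exact Or.inr (hcov y hxy)
    · exact Or.inl (hcov x hxy.symm)

theorem DynLoop.invariant {α : Type*} {Z Z' : SimpleGraph α} {N : Set α}
    (hZ : ∀ a b, Z'.Adj a b ↔ Z.Adj a b ∧ a ∉ N ∧ b ∉ N) {l : List α} (hl : ∀ a ∈ l, a ∈ N)
    {M M' : Set (Sym2 α)} (hs : DynLoop Z' N l M M') (h : DynInvariant Z Z' N l M) :
    DynInvariant Z Z' N [] M' := by
  induction hs with
  | nil => exact h
  | cons a l M M' M'' hstep _ ih =>
    exact ih (fun c hc => hl c (List.mem_cons_of_mem _ hc))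
      (hstep.invariant hZ (hl a List.mem_cons_self) h)

/-- Dynamic-Vertex-Cover turns a maximal matching of `Z` into one of `Z` without `N`. -/
theorem DynamicVertexCover.isMaximalMatching {α : Type*} {Z Z' : SimpleGraph α} {N : Set α}
    (hZ : ∀ a b, Z'.Adj a b ↔ Z.Adj a b ∧ a ∉ N ∧ b ∉ N)
    {M M' : Set (Sym2 α)} (hs : DynamicVertexCover Z' N M M') (h : IsMaximalMatching Z M) :
    IsMaximalMatching Z' M' := by
  obtain ⟨l, -, hl, hloop⟩ := hs
  have hI := hloop.invariant hZ (fun a ha => (hl a).1 ha)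
    ⟨h.1, h.2.1, fun a b hab => h.2.2 a b ((hZ a b).1 hab).1,
      fun p _ a ha haN => ⟨a, ha, (hl a).2 haN⟩⟩
  refine ⟨fun p hp => ?_, hI.matching, hI.covers⟩
  -- With the list exhausted no pair that meets `N` can be pending, so the matching lies in `Z'`.
  have hN : ∀ a ∈ p, a ∉ N := fun a ha haN => by simpa using hI.pending p hp a ha haN
  have hpZ := hI.subset hp
  induction p with
  | _ x y => exact (hZ x y).2 ⟨hpZ, hN x (by simp), hN y (by simp)⟩

/-- The non-edge `xz` of a wedge has both ends in `U` as soon as the two edges do, so restriction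
neither creates nor destroys wedges among the edges that remain. -/
theorem wedgeGraph_restrict_adj {V : Type*} (G : SimpleGraph V) (U : Finset V) (e f : Sym2 V) :
    (wedgeGraph (restrict G U)).Adj e f ↔
      (wedgeGraph G).Adj e f ∧ (∀ v ∈ e, v ∈ U) ∧ ∀ v ∈ f, v ∈ U := by
  constructor
  · rintro ⟨x, y, z, ⟨h1, h2, h3, h4⟩, rfl, rfl⟩
    refine ⟨⟨x, y, z, ⟨h1.1, h2.1, h3, fun h => h4 ⟨h, h1.2.1, h2.2.2⟩⟩, rfl, rfl⟩, ?_, ?_⟩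
    · simp [h1.2.1, h1.2.2]
    · simp [h2.2.1, h2.2.2]
  · rintro ⟨⟨x, y, z, ⟨h1, h2, h3, h4⟩, rfl, rfl⟩, he, hf⟩
    simp only [Sym2.mem_iff, forall_eq_or_imp, forall_eq] at he hf
    exact ⟨x, y, z, ⟨⟨h1, he⟩, ⟨h2, hf⟩, h3, fun h => h4 h.1⟩, rfl, rfl⟩

theorem mem_restrict_edgeSet {V : Type*} (G : SimpleGraph V) (U : Finset V) (e : Sym2 V) :
    e ∈ (restrict G U).edgeSet ↔ e ∈ G.edgeSet ∧ ∀ v ∈ e, v ∈ U := by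
  induction e with
  | _ x y => simp [restrict]

theorem edgeSet_of_wedgeGraph_adj {V : Type*} {G : SimpleGraph V} {e f : Sym2 V}
    (h : (wedgeGraph G).Adj e f) : e ∈ G.edgeSet := by
  obtain ⟨x, y, z, h, rfl, rfl⟩ := h
  exact h.1

theorem wedgeGraph_erase_adj {V : Type*} [DecidableEq V] (G : SimpleGraph V) (U : Finset V)
    (u : V) (e f : Sym2 V) :
    (wedgeGraph (restrict G (U.erase u))).Adj e f ↔ (wedgeGraph (restrict G U)).Adj e f ∧
      e ∉ (restrict G U).incidenceSet u ∧ f ∉ (restrict G U).incidenceSet u := by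
  have key : ∀ g : Sym2 V, g ∈ G.edgeSet → ((∀ v ∈ g, v ∈ U.erase u) ↔
      (∀ v ∈ g, v ∈ U) ∧ g ∉ (restrict G U).incidenceSet u) := by
    intro g hg
    simp only [SimpleGraph.incidenceSet, Set.mem_ofPred_eq, mem_restrict_edgeSet, Finset.mem_erase]
    constructor
    · exact fun h => ⟨fun v hv => (h v hv).2, fun hu => (h u hu.2).1 rfl⟩
    · rintro ⟨h1, h2⟩ v hv
      refine ⟨?_, h1 v hv⟩
      rintro rfl
      exact h2 ⟨⟨hg, h1⟩, hv⟩
  simp only [wedgeGraph_restrict_adj]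
  constructor
  · rintro ⟨h, he, hf⟩
    rw [key e (edgeSet_of_wedgeGraph_adj h)] at he
    rw [key f (edgeSet_of_wedgeGraph_adj h.symm)] at hf
    exact ⟨⟨h, he.1, hf.1⟩, he.2, hf.2⟩
  · rintro ⟨⟨h, he, hf⟩, he', hf'⟩
    exact ⟨h, (key e (edgeSet_of_wedgeGraph_adj h)).2 ⟨he, he'⟩,
      (key f (edgeSet_of_wedgeGraph_adj h.symm)).2 ⟨hf, hf'⟩⟩

theorem restrict_univ {V : Type*} [Fintype V] (G : SimpleGraph V) :
    restrict G Finset.univ = G := by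
  ext x y; simp [restrict]

/-- Every run of Greedy maintains a maximal matching of the wedge graph. -/
theorem GreedyRun.isMaximalMatching {V : Type*} [Fintype V] [DecidableEq V] {G : SimpleGraph V}
    {lam : ℝ} {U : ℕ → Finset V} {M : ℕ → Set (Sym2 (Sym2 V))} {u : ℕ → V}
    (h : GreedyRun G lam U M u) :
    ∀ i ≤ Fintype.card V, IsMaximalMatching (wedgeGraph (restrict G (U i))) (M i) := by
  intro i
  induction i with
  | zero =>
    intro _
    rw [h.start_vertices, restrict_univ]
    exact h.start_matching.isMaximalMatching
  | succ i ih =>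
    intro hi
    refine (h.relabel i hi).isMaximalMatching (Z := wedgeGraph (restrict G (U i))) ?_
      (ih (by omega))
    rw [h.delete i hi]
    exact wedgeGraph_erase_adj G (U i) (u i)

/-! ## The size of the wedge graph -/

theorem wedgeNodes_ncard_le {n : ℕ} (G : SimpleGraph (Fin n)) :
    (wedgeNodes G).ncard ≤ G.edgeSet.ncard :=
  Set.ncard_le_ncard (fun _ ⟨_, h⟩ => edgeSet_of_wedgeGraph_adj h) (Set.toFinite _)

/-- A wedge `(x, y, z)` is determined by the dart `(x, y)` and the vertex `z`, and there are twice
as many darts as edges. -/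
theorem wedgeGraph_edgeSet_ncard_le {n : ℕ} (G : SimpleGraph (Fin n)) :
    (wedgeGraph G).edgeSet.ncard ≤ 2 * G.edgeSet.ncard * n := by
  classical
  let F : G.Dart × Fin n → Sym2 (Sym2 (Fin n)) := fun p =>
    s(s(p.1.fst, p.1.snd), s(p.1.snd, p.2))
  have hsub : (wedgeGraph G).edgeSet ⊆ F '' Set.univ := by
    intro p hp
    induction p with
    | _ e f =>
      obtain ⟨x, y, z, h, rfl, rfl⟩ := hp
      exact ⟨(⟨(x, y), h.1⟩, z), trivial, rfl⟩
  have hcard : G.edgeSet.ncard = G.edgeFinset.card := by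
    rw [← SimpleGraph.coe_edgeFinset, Set.ncard_coe_finset]
  calc (wedgeGraph G).edgeSet.ncard ≤ (F '' Set.univ).ncard := Set.ncard_le_ncard hsub
    _ ≤ (Set.univ : Set (G.Dart × Fin n)).ncard := Set.ncard_image_le
    _ = 2 * G.edgeSet.ncard * n := by
      rw [Set.ncard_univ, Nat.card_eq_fintype_card, Fintype.card_prod, Fintype.card_fin,
        SimpleGraph.dart_card_eq_twice_card_edges, hcard]

theorem greedyBound_le {n m : ℕ} (G : SimpleGraph (Fin n)) (hm : G.edgeSet.ncard = m) :
    greedyBound G m ≤ 6 * ((n : ℝ) * m) := by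
  rcases Nat.eq_zero_or_pos n with rfl | hn
  · have h1 := wedgeNodes_ncard_le G
    have h2 := wedgeGraph_edgeSet_ncard_le G
    have h3 : G.edgeSet.ncard = 0 := by simp [Set.eq_empty_of_isEmpty]
    have h4 : (wedgeNodes G).ncard = 0 := by omega
    have h5 : (wedgeGraph G).edgeSet.ncard = 0 := by simpa using h2
    simp [greedyBound, h4, h5]
  · have h1 : ((wedgeNodes G).ncard : ℝ) ≤ m := by exact_mod_cast hm ▸ wedgeNodes_ncard_le G
    have h2 : ((wedgeGraph G).edgeSet.ncard : ℝ) ≤ 2 * m * n := by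
      exact_mod_cast hm ▸ wedgeGraph_edgeSet_ncard_le G
    have h3 : Real.log n ≤ n := Real.log_le_self (Nat.cast_nonneg n)
    have h4 : (m : ℝ) * Real.log n ≤ m * n := mul_le_mul_of_nonneg_left h3 (Nat.cast_nonneg m)
    have h5 : (m : ℝ) ≤ m * n := le_mul_of_one_le_right (Nat.cast_nonneg m) (by exact_mod_cast hn)
    -- The five summands contribute 1, 1, 2, 1 and 1 times `mn`; this is the constant 6.
    unfold greedyBound
    linarith

theorem mul_le_greedyBound {n : ℕ} (G : SimpleGraph (Fin n)) (m : ℕ) :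
    (m : ℝ) * n ≤ greedyBound G m := by
  have h1 : 0 ≤ (m : ℝ) * Real.log n := mul_nonneg (Nat.cast_nonneg m) (Real.log_natCast_nonneg n)
  have h2 : 0 ≤ (n : ℝ) * m := by positivity
  have h3 : (0 : ℝ) ≤ (wedgeNodes G).ncard := Nat.cast_nonneg _
  have h4 : (0 : ℝ) ≤ (wedgeGraph G).edgeSet.ncard := Nat.cast_nonneg _
  unfold greedyBound
  linarith

end STC

/-! ## Reasoning about programs -/

namespace RAM

@[simp] theorem State.setI_ints_self (s : State) (a i x : ℕ) :
    (s.setI a i x).ints a = Function.update (s.ints a) i x := by simp [State.setI]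

theorem State.setI_ints_of_ne (s : State) {a b : ℕ} (i x : ℕ) (h : b ≠ a) :
    (s.setI a i x).ints b = s.ints b := by simp [State.setI, h]

@[simp] theorem State.setI_reals (s : State) (a i x : ℕ) : (s.setI a i x).reals = s.reals := rfl

@[simp] theorem State.setR_reals_self (s : State) (a i : ℕ) (x : ℝ) :
    (s.setR a i x).reals a = Function.update (s.reals a) i x := by simp [State.setR]

theorem State.setR_reals_of_ne (s : State) {a b : ℕ} (i : ℕ) (x : ℝ) (h : b ≠ a) :
    (s.setR a i x).reals b = s.reals b := by simp [State.setR, h]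

@[simp] theorem State.setR_ints (s : State) (a i : ℕ) (x : ℝ) : (s.setR a i x).ints = s.ints := rfl

/-- `p` may write to the word array `a`. -/
def Cmd.writesI : Cmd → ℕ → Bool
  | skip, _ => false
  | setI b _ _, a => b == a
  | setR _ _ _, _ => false
  | seq p q, a => p.writesI a || q.writesI a
  | ite _ p q, a => p.writesI a || q.writesI a
  | loop _ p, a => p.writesI a

/-- `p` may write to the real array `a`. -/
def Cmd.writesR : Cmd → ℕ → Bool
  | skip, _ => false
  | setI _ _ _, _ => false
  | setR b _ _, a => b == a
  | seq p q, a => p.writesR a || q.writesR a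
  | ite _ p q, a => p.writesR a || q.writesR a
  | loop _ p, a => p.writesR a

/-- The frame rule. Since `Cmd.writesI` is a Boolean function, its hypothesis reduces to `rfl` for a
concrete program and array. -/
theorem Exec.ints_eq {W : ℕ} {p : Cmd} {s s' : State} {t : ℕ} (h : Exec W p s s' t) {a : ℕ}
    (ha : p.writesI a = false) : s'.ints a = s.ints a := by
  induction h with
  | skip | setR | loopFalse => rfl
  | setI s b i e _ =>
    simp only [Cmd.writesI, beq_eq_false_iff_ne] at ha
    exact State.setI_ints_of_ne _ _ _ (Ne.symm ha)
  | seq p q s s' s'' t t' _ _ ih1 ih2 =>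
    simp only [Cmd.writesI, Bool.or_eq_false_iff] at ha
    rw [ih2 ha.2, ih1 ha.1]
  | iteTrue b p q s s' t _ _ ih =>
    simp only [Cmd.writesI, Bool.or_eq_false_iff] at ha
    exact ih ha.1
  | iteFalse b p q s s' t _ _ ih =>
    simp only [Cmd.writesI, Bool.or_eq_false_iff] at ha
    exact ih ha.2
  | loopTrue b p s s' s'' t t' _ _ _ ih1 ih2 => rw [ih2 ha, ih1 ha]

theorem Exec.reals_eq {W : ℕ} {p : Cmd} {s s' : State} {t : ℕ} (h : Exec W p s s' t) {a : ℕ}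
    (ha : p.writesR a = false) : s'.reals a = s.reals a := by
  induction h with
  | skip | setI | loopFalse => rfl
  | setR s b i e =>
    simp only [Cmd.writesR, beq_eq_false_iff_ne] at ha
    exact State.setR_reals_of_ne _ _ _ (Ne.symm ha)
  | seq p q s s' s'' t t' _ _ ih1 ih2 =>
    simp only [Cmd.writesR, Bool.or_eq_false_iff] at ha
    rw [ih2 ha.2, ih1 ha.1]
  | iteTrue b p q s s' t _ _ ih =>
    simp only [Cmd.writesR, Bool.or_eq_false_iff] at ha
    exact ih ha.1
  | iteFalse b p q s s' t _ _ ih =>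
    simp only [Cmd.writesR, Bool.or_eq_false_iff] at ha
    exact ih ha.2
  | loopTrue b p s s' s'' t t' _ _ _ ih1 ih2 => rw [ih2 ha, ih1 ha]

/-- `s'` differs from `s` only in arrays that `p` writes to. -/
structure Frame (p : Cmd) (s s' : State) : Prop where
  ints : ∀ {a}, p.writesI a = false → s'.ints a = s.ints a
  reals : ∀ {a}, p.writesR a = false → s'.reals a = s.reals a

/-- Started in `s`, the program `p` halts within `T` steps in a state that satisfies `Q`. -/
def Runs (W : ℕ) (p : Cmd) (s : State) (T : ℕ) (Q : State → Prop) : Prop :=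
  ∃ s' t, Exec W p s s' t ∧ t ≤ T ∧ Q s'

theorem Runs.mono {W : ℕ} {p : Cmd} {s : State} {T T' : ℕ} {Q Q' : State → Prop}
    (h : Runs W p s T Q) (hT : T ≤ T') (hQ : ∀ s', Q s' → Frame p s s' → Q' s') :
    Runs W p s T' Q' := by
  obtain ⟨s', t, he, ht, hq⟩ := h
  exact ⟨s', t, he, ht.trans hT, hQ s' hq ⟨he.ints_eq, he.reals_eq⟩⟩

theorem Runs.seq {W : ℕ} {p q : Cmd} {s : State} {T T' : ℕ} {Q Q' : State → Prop}
    (h : Runs W p s T Q) (h' : ∀ s', Q s' → Frame p s s' → Runs W q s' T' Q') :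
    Runs W (.seq p q) s (T + T') Q' := by
  obtain ⟨s', t, he, ht, hq⟩ := h
  obtain ⟨s'', t', he', ht', hq'⟩ := h' s' hq ⟨he.ints_eq, he.reals_eq⟩
  exact ⟨s'', t + t', .seq _ _ _ _ _ _ _ he he', Nat.add_le_add ht ht', hq'⟩

theorem Runs.ite {W : ℕ} {b : BExp} {p q : Cmd} {s : State} {T : ℕ} {Q : State → Prop}
    (h : b.Holds s → Runs W p s T Q) (h' : ¬ b.Holds s → Runs W q s T Q) :
    Runs W (.ite b p q) s (b.cost + 1 + T) Q := by
  by_cases hb : b.Holds s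
  · obtain ⟨s', t, he, ht, hq⟩ := h hb
    exact ⟨s', _, .iteTrue _ _ _ _ _ _ hb he, by omega, hq⟩
  · obtain ⟨s', t, he, ht, hq⟩ := h' hb
    exact ⟨s', _, .iteFalse _ _ _ _ _ _ hb he, by omega, hq⟩

/-- Weakest precondition of a program without loops. -/
def Cmd.wp (W : ℕ) : Cmd → (State → Prop) → State → Prop
  | skip, Q, s => Q s
  | setI a i e, Q, s => e.eval s < W ∧ Q (s.setI a (i.eval s) (e.eval s))
  | setR a i e, Q, s => Q (s.setR a (i.eval s) (e.eval s))
  | seq p q, Q, s => p.wp W (q.wp W Q) s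
  | ite b p q, Q, s => (b.Holds s → p.wp W Q s) ∧ (¬ b.Holds s → q.wp W Q s)
  | loop _ _, _, _ => False

/-- A bound on the running time of a program without loops. -/
def Cmd.flatCost : Cmd → ℕ
  | skip => 1
  | setI _ i e => i.cost + e.cost + 1
  | setR _ i e => i.cost + e.cost + 1
  | seq p q => p.flatCost + q.flatCost
  | ite b p q => b.cost + 1 + (p.flatCost + q.flatCost)
  | loop _ _ => 0

theorem Runs.of_wp {W : ℕ} {p : Cmd} {s : State} {Q : State → Prop} (h : p.wp W Q s) :
    Runs W p s p.flatCost Q := by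
  induction p generalizing s Q with
  | skip => exact ⟨s, _, .skip s, le_rfl, h⟩
  | setI a i e => exact ⟨_, _, .setI s a i e h.1, le_rfl, h.2⟩
  | setR a i e => exact ⟨_, _, .setR s a i e, le_rfl, h⟩
  | seq p q ihp ihq => exact (ihp h).seq fun s' hs' _ => ihq hs'
  | ite b p q ihp ihq =>
    -- The sum of the costs of the branches serves as a bound that is valid for either of them.
    exact .ite (fun hb => (ihp (h.1 hb)).mono (by omega) fun _ h _ => h)
      (fun hb => (ihq (h.2 hb)).mono (by omega) fun _ h _ => h)
  -- The precondition of a loop is `False`, so the value 0 of `flatCost` at a loop never enters.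
  | loop => exact h.elim

/-- The scalar variable `a`, stored in the first cell of the word array `a`. -/
abbrev var (a : ℕ) : IExp := .get a (.const 0)

abbrev assign (a : ℕ) (e : IExp) : Cmd := .setI a (.const 0) e

/-- `for a = 0, …, k - 1 do p`. -/
def forLoop (a : ℕ) (k : IExp) (p : Cmd) : Cmd :=
  .seq (assign a (.const 0))
    (.loop (.ilt (var a) k) (.seq p (assign a (.add (var a) (.const 1)))))

/-- Induction on the number `d` of iterations left. A test costs `k.cost + 4` and an increment 6.
The invariant is required after the increment, so it has to hold for the state in which the counter
has its new value. -/
theorem Runs.loop_aux {W a N : ℕ} {k : IExp} {p : Cmd} (I : ℕ → State → Prop)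
    (T : ℕ → ℕ) (hN : N < W) (hk : ∀ i s, I i s → k.eval s = N)
    (hstep : ∀ i s, i < N → I i s → s.ints a 0 = i →
      Runs W p s (T i) fun s' => s'.ints a 0 = i ∧ I (i + 1) (s'.setI a 0 (i + 1)))
    (d : ℕ) : ∀ i s, i + d = N → I i s → s.ints a 0 = i →
      Runs W (.loop (.ilt (var a) k) (.seq p (assign a (.add (var a) (.const 1))))) s
        (∑ j ∈ Finset.Ico i N, (T j + (k.cost + 10)) + (k.cost + 4)) (I N) := by
  induction d with
  | zero =>
    intro i s hi hI ha
    obtain rfl : i = N := by omega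
    refine ⟨s, _, .loopFalse _ _ _ ?_, ?_, hI⟩
    · simp [BExp.Holds, IExp.eval, ha, hk _ _ hI]
    · simp [BExp.cost, IExp.cost]; omega
  | succ d ih =>
    intro i s hi hI ha
    have hiN : i < N := by omega
    obtain ⟨s', t, he, ht, ha', hI'⟩ := hstep i s hiN hI ha
    obtain ⟨s'', t', he', ht', hq⟩ := ih (i + 1) (s'.setI a 0 (i + 1)) (by omega) hI' (by simp)
    have hinc : Exec W (assign a (.add (var a) (.const 1))) s' (s'.setI a 0 (i + 1)) 6 := by
      have := Exec.setI (W := W) s' a (.const 0) (.add (var a) (.const 1))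
        (by simp [IExp.eval, ha']; omega)
      simpa [IExp.eval, IExp.cost, ha'] using this
    refine ⟨s'', _, .loopTrue _ _ _ _ _ _ _ ?_ (.seq _ _ _ _ _ _ _ he hinc) he', ?_, hq⟩
    · simp [BExp.Holds, IExp.eval, ha, hk _ _ hI, hiN]
    · rw [Finset.sum_eq_sum_Ico_succ_bot hiN]
      simp [BExp.cost, IExp.cost]; omega

theorem Frame.forLoop_start (a : ℕ) (k : IExp) (p : Cmd) (s : State) (x : ℕ) :
    Frame (forLoop a k p) s (s.setI a 0 x) where
  ints {b} h := by
    simp only [forLoop, Cmd.writesI, Bool.or_eq_false_iff, beq_eq_false_iff_ne] at h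
    exact State.setI_ints_of_ne _ _ _ (Ne.symm h.1)
  reals _ := rfl

theorem Frame.forLoop_step {a : ℕ} {k : IExp} {p : Cmd} {s s' s'' : State}
    (h : Frame (forLoop a k p) s s') (h' : Frame p s' s'') (x : ℕ) :
    Frame (forLoop a k p) s (s''.setI a 0 x) where
  ints {b} hb := by
    have hb' := hb
    simp only [forLoop, Cmd.writesI, Bool.or_eq_false_iff, beq_eq_false_iff_ne] at hb'
    rw [State.setI_ints_of_ne _ _ _ (Ne.symm hb'.1), h'.ints hb'.2.1, h.ints hb]
  reals {b} hb := by
    have hb' := hb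
    simp only [forLoop, Cmd.writesR, Bool.false_or, Bool.or_false] at hb'
    rw [State.setI_reals, h'.reals hb', h.reals hb]

/-- The rule for loops with a counter and a cost that depends on the counter. -/
theorem Runs.forLoop {W a N : ℕ} {k : IExp} {p : Cmd} {s : State} (I : ℕ → State → Prop)
    (T : ℕ → ℕ) (hN : N < W) (hp : p.writesI a = false)
    (hk : ∀ s', Frame (forLoop a k p) s s' → k.eval s' = N) (h0 : I 0 (s.setI a 0 0))
    (hstep : ∀ i s', i < N → Frame (RAM.forLoop a k p) s s' → I i s' → s'.ints a 0 = i →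
      Runs W p s' (T i) fun s'' => I (i + 1) (s''.setI a 0 (i + 1))) :
    Runs W (forLoop a k p) s
      (∑ j ∈ Finset.range N, T j + N * (k.cost + 10) + (k.cost + 7)) (I N) := by
  have hW : 0 < W := by omega
  obtain ⟨s', t, he, ht, hq⟩ := Runs.loop_aux
    -- Carrying the frame condition in the invariant lets every iteration refer to untouched arrays
    -- in the state before the loop.
    (fun i s' => Frame (RAM.forLoop a k p) s s' ∧ I i s') T hN (fun i s' h => hk s' h.1)
    (fun i s' hi h ha => (hstep i s' hi h.1 h.2 ha).mono le_rfl fun s'' h'' hF =>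
      ⟨by rw [hF.ints hp, ha], h.1.forLoop_step hF _, h''⟩)
    N 0 (s.setI a 0 0) (by omega) ⟨Frame.forLoop_start _ _ _ _ _, h0⟩ (by simp)
  refine ⟨s', _, .seq _ _ _ _ _ _ _ (.setI s a (.const 0) (.const 0) (by simpa [IExp.eval])) he,
    ?_, hq.2⟩
  have : ∑ j ∈ Finset.Ico 0 N, (T j + (k.cost + 10)) =
      ∑ j ∈ Finset.range N, T j + N * (k.cost + 10) := by
    rw [Finset.sum_add_distrib, Finset.range_eq_Ico]; simp
  simp only [IExp.cost]
  omega

/-- The rule for loops with a counter and a uniform bound on the cost. -/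
theorem Runs.forLoop_const {W a N : ℕ} {k : IExp} {p : Cmd} {s : State} (I : ℕ → State → Prop)
    (T : ℕ) (hN : N < W) (hp : p.writesI a = false)
    (hk : ∀ s', Frame (RAM.forLoop a k p) s s' → k.eval s' = N) (h0 : I 0 (s.setI a 0 0))
    (hstep : ∀ i s', i < N → Frame (RAM.forLoop a k p) s s' → I i s' → s'.ints a 0 = i →
      Runs W p s' T fun s'' => I (i + 1) (s''.setI a 0 (i + 1))) :
    Runs W (RAM.forLoop a k p) s (N * (T + k.cost + 10) + (k.cost + 7)) (I N) := by
  refine (Runs.forLoop I (fun _ => T) hN hp hk h0 hstep).mono ?_ fun _ h _ => h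
  simp only [Finset.sum_const, Finset.card_range, smul_eq_mul]
  rw [← Nat.mul_add, Nat.add_assoc T]

/-- The rule for loops with a counter and a body without loops. -/
theorem Runs.forLoop_wp {W a N : ℕ} {k : IExp} {p : Cmd} {s : State} (I : ℕ → State → Prop)
    (hN : N < W) (hp : p.writesI a = false)
    (hk : ∀ s', Frame (RAM.forLoop a k p) s s' → k.eval s' = N) (h0 : I 0 (s.setI a 0 0))
    (hstep : ∀ i s', i < N → Frame (RAM.forLoop a k p) s s' → I i s' → s'.ints a 0 = i →
      p.wp W (fun s'' => I (i + 1) (s''.setI a 0 (i + 1))) s') :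
    Runs W (RAM.forLoop a k p) s (N * (p.flatCost + k.cost + 10) + (k.cost + 7)) (I N) :=
  Runs.forLoop_const I _ hN hp hk h0 fun i s' hi hF hI ha => .of_wp (hstep i s' hi hF hI ha)

end RAM

/-! ## The program: priorities and matching -/

namespace STC.Program

open RAM

abbrev nVar : IExp := .get 0 (.const 0)

abbrev mVar : IExp := .get 0 (.const 1)

/-- The vertex `v` is an endpoint of the edge `e`. -/
abbrev isEnd (e v : IExp) : BExp :=
  .not (.and (.not (.ieq (.get 1 e) v)) (.not (.ieq (.get 2 e) v)))

def clearPriorities : Cmd :=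
  forLoop 17 mVar (.seq (.setR 1 (.get 1 (var 17)) (.ofInt (.const 0)))
    (.setR 1 (.get 2 (var 17)) (.ofInt (.const 0))))

/-- Adds the weight of each remaining edge to the priorities of its endpoints and to the total. -/
def sumWeights : Cmd :=
  forLoop 17 mVar (.ite (.ieq (.get 5 (var 17)) (.const 1))
    (.seq (.ite (.ieq (.get 6 (var 17)) (.const 0)) (.setR 4 (.const 0) (.ofInt (.const 1)))
        (.setR 4 (.const 0) (.get 0 (.const 0))))
      (.seq (.setR 1 (.get 1 (var 17)) (.add (.get 1 (.get 1 (var 17))) (.get 4 (.const 0))))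
      (.seq (.setR 1 (.get 2 (var 17)) (.add (.get 1 (.get 2 (var 17))) (.get 4 (.const 0))))
        (.setR 2 (.const 0) (.add (.get 2 (.const 0)) (.get 4 (.const 0))))))) .skip)

def computePriorities : Cmd :=
  .seq clearPriorities (.seq (.setR 2 (.const 0) (.ofInt (.const 0))) sumWeights)

/-- The weight of the edge with index `e` in the state `s`; deleted edges have weight zero. -/
noncomputable def weightAt (s : State) (e : ℕ) : ℝ :=
  if s.ints 5 e = 1 then if s.ints 6 e = 0 then 1 else s.reals 0 0 else 0

/-- The vertex `v` is an endpoint of the edge with index `e`. -/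
def EndAt (s : State) (e v : ℕ) : Prop := s.ints 1 e = v ∨ s.ints 2 e = v

instance (s : State) (e v : ℕ) : Decidable (EndAt s e v) := instDecidableOr

/-- Nonzero priorities sit only at endpoints of input edges, so a sweep over the edges clears the
array in `O(m)` rather than `O(n)` steps. -/
theorem runs_clearPriorities {W m : ℕ} {s : State} (hW : m < W) (hm : s.ints 0 1 = m)
    (h : ∀ v, s.reals 1 v ≠ 0 → ∃ e < m, EndAt s e v) :
    Runs W clearPriorities s (m * 30 + 9) fun s' => ∀ v, s'.reals 1 v = 0 := by
  refine (Runs.forLoop_wp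
    (fun i s' => ∀ v, s'.reals 1 v ≠ 0 → ∃ e, i ≤ e ∧ e < m ∧ EndAt s e v) hW rfl
    (fun s' hF => ?_) ?_ ?_).mono (Nat.add_le_add (Nat.mul_le_mul_left _ (by decide)) (by decide)) ?_
  · simp [IExp.eval, hF.ints (a := 0) rfl, hm]
  · simpa using h
  · intro i s' hi hF hI ha
    simp only [Cmd.wp, IExp.eval, RExp.eval, ha, State.setR_ints, State.setI_reals,
      State.setR_reals_self, Nat.cast_zero, hF.ints (a := 1) rfl, hF.ints (a := 2) rfl]
    intro v hv
    by_cases h2 : v = s.ints 2 i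
    · simp [h2] at hv
    by_cases h1 : v = s.ints 1 i
    · simp [h1, Function.update_apply] at hv
    · rw [Function.update_of_ne h2, Function.update_of_ne h1] at hv
      obtain ⟨e, he, hem, hev⟩ := hI v hv
      refine ⟨e, ?_, hem, hev⟩
      rcases Nat.eq_or_lt_of_le he with rfl | h
      · rcases hev with h | h <;> [exact absurd h.symm h1; exact absurd h.symm h2]
      · exact h
  · intro s' h _ v
    by_contra hv
    obtain ⟨e, h1, h2, -⟩ := h v hv
    omega

theorem runs_sumWeights {W m : ℕ} {s : State} (hW : m < W) (hm : s.ints 0 1 = m)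
    (hne : ∀ e < m, s.ints 1 e ≠ s.ints 2 e) (h : ∀ v, s.reals 1 v = 0) (h' : s.reals 2 0 = 0) :
    Runs W sumWeights s (m * 100 + 9) fun s' =>
      (∀ v, s'.reals 1 v = ∑ e ∈ Finset.range m, if EndAt s e v then weightAt s e else 0) ∧
      s'.reals 2 0 = ∑ e ∈ Finset.range m, weightAt s e := by
  refine (Runs.forLoop_wp (fun i s' =>
    (∀ v, s'.reals 1 v = ∑ e ∈ Finset.range i, if EndAt s e v then weightAt s e else 0) ∧
      s'.reals 2 0 = ∑ e ∈ Finset.range i, weightAt s e) hW rfl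
    (fun s' hF => ?_) ?_ ?_).mono (Nat.add_le_add (Nat.mul_le_mul_left _ (by decide)) (by decide)) fun _ h _ => h
  · simp [IExp.eval, hF.ints (a := 0) rfl, hm]
  · simpa using ⟨h, h'⟩
  · intro i s' hi hF hI ha
    -- Both possible weights are treated at once. The two additions hit different cells because the
    -- endpoints of an edge differ.
    have key : ∀ x : ℝ, weightAt s i = x →
        (∀ v, Function.update (Function.update (s'.reals 1) (s.ints 1 i)
            (s'.reals 1 (s.ints 1 i) + x)) (s.ints 2 i)
          (Function.update (s'.reals 1) (s.ints 1 i) (s'.reals 1 (s.ints 1 i) + x) (s.ints 2 i)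
            + x) v = ∑ e ∈ Finset.range (i + 1), if EndAt s e v then weightAt s e else 0) ∧
        s'.reals 2 0 + x = ∑ e ∈ Finset.range (i + 1), weightAt s e := by
      intro x hx
      refine ⟨fun v => ?_, by rw [Finset.sum_range_succ, hx, hI.2]⟩
      rw [Finset.sum_range_succ, ← hI.1 v, hx]
      have := hne i hi
      by_cases h1 : v = s.ints 1 i
      · subst h1
        simp [Function.update_of_ne this, EndAt]
      · by_cases h2 : v = s.ints 2 i
        · subst h2
          simp [Function.update_of_ne this.symm, EndAt]
        · simp [Function.update_of_ne h1, Function.update_of_ne h2, EndAt, Ne.symm h1, Ne.symm h2]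
    simp only [Cmd.wp, IExp.eval, RExp.eval, BExp.Holds, ha, State.setR_ints, State.setI_reals,
      State.setR_reals_self, hF.ints (a := 1) rfl, hF.ints (a := 2) rfl, hF.ints (a := 5) rfl,
      hF.ints (a := 6) rfl, hF.reals (a := 0) rfl, Function.update_self, Nat.cast_one,
      State.setR_reals_of_ne _ _ _ (show (1 : ℕ) ≠ 2 by decide),
      State.setR_reals_of_ne _ _ _ (show (1 : ℕ) ≠ 4 by decide),
      State.setR_reals_of_ne _ _ _ (show (4 : ℕ) ≠ 1 by decide),
      State.setR_reals_of_ne _ _ _ (show (2 : ℕ) ≠ 1 by decide),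
      State.setR_reals_of_ne _ _ _ (show (2 : ℕ) ≠ 4 by decide)]
    refine ⟨fun h5 => ⟨fun h6 => key 1 (by simp [weightAt, h5, h6]),
      fun h6 => key _ (by simp [weightAt, h5, h6])⟩, fun h5 => ?_⟩
    have hx : weightAt s i = 0 := by simp [weightAt, h5]
    refine ⟨fun v => ?_, by rw [Finset.sum_range_succ, hx, hI.2, add_zero]⟩
    rw [Finset.sum_range_succ, ← hI.1 v, hx]
    simp

theorem runs_computePriorities {W m : ℕ} {s : State} (hW : m < W) (hm : s.ints 0 1 = m)
    (hne : ∀ e < m, s.ints 1 e ≠ s.ints 2 e)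
    (h : ∀ v, s.reals 1 v ≠ 0 → ∃ e < m, EndAt s e v) :
    Runs W computePriorities s (m * 130 + 22) fun s' =>
      (∀ v, s'.reals 1 v = ∑ e ∈ Finset.range m, if EndAt s e v then weightAt s e else 0) ∧
      s'.reals 2 0 = ∑ e ∈ Finset.range m, weightAt s e := by
  refine (Runs.seq (T' := 4 + (m * 100 + 9)) (runs_clearPriorities hW hm h)
    fun s₁ h₁ F₁ => ?_).mono (by omega) fun _ h _ => h
  refine Runs.seq (T := 4) (.of_wp (Q := fun s' => s' = s₁.setR 2 0 0) (by simp [Cmd.wp, IExp.eval, RExp.eval]))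
    fun s₂ h₂ F₂ => ?_
  have e0 : s₂.ints 0 = s.ints 0 := by rw [F₂.ints rfl, F₁.ints rfl]
  have e1 : s₂.ints 1 = s.ints 1 := by rw [F₂.ints rfl, F₁.ints rfl]
  have e2 : s₂.ints 2 = s.ints 2 := by rw [F₂.ints rfl, F₁.ints rfl]
  have e5 : s₂.ints 5 = s.ints 5 := by rw [F₂.ints rfl, F₁.ints rfl]
  have e6 : s₂.ints 6 = s.ints 6 := by rw [F₂.ints rfl, F₁.ints rfl]
  have r0 : s₂.reals 0 = s.reals 0 := by rw [F₂.reals rfl, F₁.reals rfl]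
  have hw : weightAt s₂ = weightAt s := by funext e; simp [weightAt, e5, e6, r0]
  have := runs_sumWeights (s := s₂) hW (by rw [e0, hm]) (by rw [e1, e2]; exact hne)
    (by rw [F₂.reals rfl]; exact h₁) (by simp [h₂])
  simpa only [EndAt, hw, e1, e2] using this

end STC.Program

/-! ### How matchings, wedge lists and the input are stored in memory. -/

namespace STC

theorem EdgeList.edge_injective {n m : ℕ} {G : SimpleGraph (Fin n)} (E : EdgeList G m) :
    Function.Injective E.edge := E.injective

theorem EdgeList.edge_mem {n m : ℕ} {G : SimpleGraph (Fin n)} (E : EdgeList G m) (e : Fin m) :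
    E.edge e ∈ G.edgeSet := E.range_eq ▸ Set.mem_range_self e

theorem EdgeList.exists_edge {n m : ℕ} {G : SimpleGraph (Fin n)} (E : EdgeList G m)
    {e : Sym2 (Fin n)} (h : e ∈ G.edgeSet) : ∃ i, E.edge i = e := by
  rw [← E.range_eq] at h
  exact h

theorem EdgeList.adj {n m : ℕ} {G : SimpleGraph (Fin n)} (E : EdgeList G m) (e : Fin m) :
    G.Adj (E.src e) (E.dst e) := E.edge_mem e

/-- The array `p` stores the matching `M`. -/
structure StoresMatching {n m : ℕ} {G : SimpleGraph (Fin n)} (E : EdgeList G m)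
    (M : Set (Sym2 (Sym2 (Fin n)))) (p : ℕ → ℕ) : Prop where
  subset : M ⊆ (wedgeGraph G).edgeSet
  partner : ∀ e : Fin m, (∀ f : Fin m, s(E.edge e, E.edge f) ∈ M ↔ p e = (f : ℕ) + 1) ∧
    ((∀ f : Fin m, s(E.edge e, E.edge f) ∉ M) → p e = 0)

namespace StoresMatching

variable {n m : ℕ} {G : SimpleGraph (Fin n)} {E : EdgeList G m} {M : Set (Sym2 (Sym2 (Fin n)))}
  {p : ℕ → ℕ}

theorem exists_partner (h : StoresMatching E M p) {e : Fin m} (he : p e ≠ 0) :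
    ∃ f : Fin m, p e = f + 1 := by
  by_contra hc
  push Not at hc
  exact he ((h.partner e).2 fun f hf => hc f (((h.partner e).1 f).1 hf))

theorem covered_iff (h : StoresMatching E M p) (e : Fin m) :
    Covered M (E.edge e) ↔ p e ≠ 0 := by
  constructor
  · rintro ⟨q, hq, hmem⟩
    obtain ⟨f', rfl⟩ := Sym2.mem_iff_exists.1 hmem
    obtain ⟨f, rfl⟩ := E.exists_edge (edgeSet_of_wedgeGraph_adj (h.subset hq).symm)
    simp [((h.partner e).1 f).1 hq]
  · intro he
    obtain ⟨f, hf⟩ := h.exists_partner he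
    exact ⟨_, ((h.partner e).1 f).2 hf, by simp⟩

theorem symm (h : StoresMatching E M p) {e f : Fin m} (hef : p e = f + 1) : p f = e + 1 := by
  rw [← (h.partner f).1 e, Sym2.eq_swap, (h.partner e).1 f, hef]

/-- If every nonzero cell encodes some edge, then an edge without partner must have a zero cell. -/
theorem of_iff (h : M ⊆ (wedgeGraph G).edgeSet)
    (h' : ∀ e f : Fin m, s(E.edge e, E.edge f) ∈ M ↔ p e = (f : ℕ) + 1)
    (h'' : ∀ e : Fin m, p e ≠ 0 → ∃ f : Fin m, p e = f + 1) : StoresMatching E M p := by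
  refine ⟨h, fun e => ⟨h' e, fun hf => ?_⟩⟩
  by_contra hc
  obtain ⟨f, hf'⟩ := h'' e hc
  exact hf f ((h' e f).2 hf')

theorem insert (h : StoresMatching E M p) {b t : Fin m} (hb : p b = 0) (ht : p t = 0)
    (hbt : (wedgeGraph G).Adj (E.edge b) (E.edge t)) :
    StoresMatching E (insert s(E.edge b, E.edge t) M)
      (Function.update (Function.update p b (t + 1)) t (b + 1)) := by
  have hne : (b : ℕ) ≠ t := fun hc => hbt.ne (by rw [Fin.ext hc])
  -- By symmetry of the partner array, a cell that points to `b` or `t` would contradict that these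
  -- are unmatched.
  have nob : ∀ e, p e = b + 1 → ∀ e' : Fin m, (e' : ℕ) = e → False := by
    rintro e he e' rfl
    have := h.symm he; omega
  have not : ∀ e, p e = t + 1 → ∀ e' : Fin m, (e' : ℕ) = e → False := by
    rintro e he e' rfl
    have := h.symm he; omega
  refine of_iff (Set.insert_subset hbt h.subset) (fun e f => ?_) fun e he => ?_
  · rw [Set.mem_insert_iff, (h.partner e).1 f, Sym2.eq_iff]
    simp only [E.edge_injective.eq_iff, Function.update_apply, Fin.ext_iff]
    have h1 := nob e
    have h2 := not e
    by_cases het : (e : ℕ) = t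
    · have : (e : ℕ) ≠ b := by omega
      simp [het, ht, hne.symm]; omega
    · by_cases heb : (e : ℕ) = b
      · simp [heb, hb, hne]; omega
      · simp [het, heb]
  · simp only [Function.update_apply] at he ⊢
    split_ifs at he ⊢
    · exact ⟨b, rfl⟩
    · exact ⟨t, rfl⟩
    · exact h.exists_partner he

theorem erase (h : StoresMatching E M p) {a b : Fin m} (hab : p a = b + 1) :
    StoresMatching E (M \ {s(E.edge a, E.edge b)})
      (Function.update (Function.update p a 0) b 0) := by
  have hba := h.symm hab
  refine of_iff (Set.sdiff_subset.trans h.subset) (fun e f => ?_) fun e he => ?_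
  · rw [Set.mem_sdiff, Set.mem_singleton_iff, (h.partner e).1 f, Sym2.eq_iff]
    simp only [E.edge_injective.eq_iff, Function.update_apply, Fin.ext_iff]
    by_cases heb : (e : ℕ) = b
    · simp [heb, hba]; omega
    · by_cases hea : (e : ℕ) = a
      · simp [hea, hab]; omega
      · simp [heb, hea]
  · simp only [Function.update_apply] at he ⊢
    split_ifs at he ⊢
    · exact absurd rfl he
    · exact absurd rfl he
    · exact h.exists_partner he

theorem empty (hp : ∀ e : Fin m, p e = 0) : StoresMatching E ∅ p :=
  of_iff (Set.empty_subset _) (fun e f => by simp [hp e]) fun e he => absurd (hp e) he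

end StoresMatching

/-- The word arrays 7, 8, 9 hold the adjacency lists of the wedge graph. -/
structure WedgeLists {n m : ℕ} {G : SimpleGraph (Fin n)} (E : EdgeList G m) (s : RAM.State) :
    Prop where
  length : ∀ e : Fin m, s.ints 8 e ≤ n
  entry : ∀ e : Fin m, ∀ j < s.ints 8 e, s.ints 9 (s.ints 7 e + j) < m
  adj : ∀ e f : Fin m, (wedgeGraph G).Adj (E.edge e) (E.edge f) ↔
    ∃ j < s.ints 8 e, s.ints 9 (s.ints 7 e + j) = f

theorem WedgeLists.of_eq {n m : ℕ} {G : SimpleGraph (Fin n)} {E : EdgeList G m} {s s' : RAM.State}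
    (h : WedgeLists E s) (h7 : s'.ints 7 = s.ints 7) (h8 : s'.ints 8 = s.ints 8)
    (h9 : s'.ints 9 = s.ints 9) : WedgeLists E s' := by
  constructor
  · rw [h8]; exact h.length
  · rw [h7, h8, h9]; exact h.entry
  · rw [h7, h8, h9]; exact h.adj

/-- The word array 5 is the indicator of `E(U)`. -/
def StoresEdges {n m : ℕ} {G : SimpleGraph (Fin n)} (E : EdgeList G m) (U : Finset (Fin n))
    (s : RAM.State) : Prop :=
  ∀ e : Fin m, s.ints 5 e = if E.src e ∈ U ∧ E.dst e ∈ U then 1 else 0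

theorem StoresEdges.eq_one {n m : ℕ} {G : SimpleGraph (Fin n)} {E : EdgeList G m}
    {U : Finset (Fin n)} {s : RAM.State} (h : StoresEdges E U s) (e : Fin m) :
    s.ints 5 e = 1 ↔ ∀ v ∈ E.edge e, v ∈ U := by
  rw [h e]; simp [EdgeList.edge]

/-- The lists are computed once, for the whole graph; masking them by array 5 is enough because
restriction induces a subgraph of the wedge graph. -/
theorem WedgeLists.restrict_adj {n m : ℕ} {G : SimpleGraph (Fin n)} {E : EdgeList G m}
    {U : Finset (Fin n)} {s : RAM.State} (h : WedgeLists E s) (hU : StoresEdges E U s)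
    (e f : Fin m) : (wedgeGraph (restrict G U)).Adj (E.edge e) (E.edge f) ↔
    s.ints 5 e = 1 ∧ s.ints 5 f = 1 ∧ ∃ j < s.ints 8 e, s.ints 9 (s.ints 7 e + j) = (f : ℕ) := by
  rw [wedgeGraph_restrict_adj, h.adj, hU.eq_one, hU.eq_one]
  tauto

/-- Word arrays 0, 1, 2 and real array 0 hold the input. -/
structure HasInput {n m : ℕ} {G : SimpleGraph (Fin n)} (E : EdgeList G m) (lam : ℝ)
    (s : RAM.State) : Prop where
  n_eq : s.ints 0 0 = n
  m_eq : s.ints 0 1 = m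
  src : ∀ e : Fin m, s.ints 1 e = E.src e
  dst : ∀ e : Fin m, s.ints 2 e = E.dst e
  lam_eq : s.reals 0 0 = lam

theorem HasInput.of_eq {n m : ℕ} {G : SimpleGraph (Fin n)} {E : EdgeList G m} {lam : ℝ}
    {s s' : RAM.State} (h : HasInput E lam s) (h0 : s'.ints 0 = s.ints 0)
    (h1 : s'.ints 1 = s.ints 1) (h2 : s'.ints 2 = s.ints 2) (hr : s'.reals 0 = s.reals 0) :
    HasInput E lam s' := by
  constructor
  · rw [h0]; exact h.n_eq
  · rw [h0]; exact h.m_eq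
  · rw [h1]; exact h.src
  · rw [h2]; exact h.dst
  · rw [hr]; exact h.lam_eq

namespace Program

open RAM

/-- Looks for a remaining unmatched neighbour of the edge in variable 20; variable 21 is its
index plus one, or zero if there is none. -/
def search : Cmd :=
  .seq (assign 21 (.const 0)) (forLoop 18 (.get 8 (var 20))
    (.ite (.and (.ieq (.get 5 (.get 9 (.add (.get 7 (var 20)) (var 18)))) (.const 1))
        (.ieq (.get 6 (.get 9 (.add (.get 7 (var 20)) (var 18)))) (.const 0)))
      (assign 21 (.add (.get 9 (.add (.get 7 (var 20)) (var 18))) (.const 1))) .skip))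

/-- Matches the edge in variable 20 to a remaining unmatched neighbour, if there is one. -/
def tryMatch : Cmd :=
  .seq search (.ite (.ieq (var 21) (.const 0)) .skip
    (.seq (.setI 6 (var 20) (var 21))
      (.setI 6 (.sub (var 21) (.const 1)) (.add (var 20) (.const 1)))))

/-- The scan does not stop at a hit: the last suitable entry wins, and the length of the list, at
most `n`, bounds the cost. -/
theorem runs_search {n m : ℕ} {G : SimpleGraph (Fin n)} {E : EdgeList G m} {W : ℕ} {s : State}
    (hmW : m < W) (hnW : n < W) (hL : WedgeLists E s) {b : Fin m} (hb : s.ints 20 0 = b) :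
    Runs W search s (n * 60 + 20) fun s' =>
      (s'.ints 21 0 = 0 ∧ ∀ j < s.ints 8 b, s.ints 5 (s.ints 9 (s.ints 7 b + j)) = 1 →
        s.ints 6 (s.ints 9 (s.ints 7 b + j)) ≠ 0) ∨
      ∃ j < s.ints 8 b, s.ints 5 (s.ints 9 (s.ints 7 b + j)) = 1 ∧
        s.ints 6 (s.ints 9 (s.ints 7 b + j)) = 0 ∧
        s'.ints 21 0 = s.ints 9 (s.ints 7 b + j) + 1 := by
  have hlen := hL.length b
  refine (Runs.seq (T := 3) (T' := n * 60 + 12)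
    (.of_wp (Q := fun s' => s' = s.setI 21 0 0)
      (by simp only [Cmd.wp, IExp.eval, and_true]; omega)) ?_).mono
    (by omega) fun _ h _ => h
  rintro _ rfl F₁
  refine (Runs.forLoop_wp (N := s.ints 8 b) (fun i s' =>
      (s'.ints 21 0 = 0 ∧ ∀ j < i, s.ints 5 (s.ints 9 (s.ints 7 b + j)) = 1 →
        s.ints 6 (s.ints 9 (s.ints 7 b + j)) ≠ 0) ∨
      ∃ j < i, s.ints 5 (s.ints 9 (s.ints 7 b + j)) = 1 ∧
        s.ints 6 (s.ints 9 (s.ints 7 b + j)) = 0 ∧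
        s'.ints 21 0 = s.ints 9 (s.ints 7 b + j) + 1) (by omega) rfl
    (fun s' hF => ?_) ?_ ?_).mono
      (Nat.add_le_add (Nat.mul_le_mul hlen (by decide)) (by decide)) fun _ h _ => h
  · simp [IExp.eval, hF.ints (a := 8) rfl, hF.ints (a := 20) rfl, State.setI_ints_of_ne, hb]
  · left; simp [State.setI_ints_of_ne]
  · intro i s' hi hF hI ha
    have hent := hL.entry b i hi
    simp only [Cmd.wp, IExp.eval, BExp.Holds, ha, hF.ints (a := 5) rfl, hF.ints (a := 6) rfl,
      hF.ints (a := 7) rfl, hF.ints (a := 9) rfl, hF.ints (a := 20) rfl, F₁.ints (a := 5) rfl,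
      F₁.ints (a := 6) rfl, F₁.ints (a := 7) rfl, F₁.ints (a := 9) rfl, F₁.ints (a := 20) rfl, hb]
    refine ⟨fun h => ⟨by omega, Or.inr ⟨i, by omega, h.1, h.2, ?_⟩⟩, fun h => ?_⟩
    · simp [State.setI_ints_of_ne]
    · simp only [State.setI_ints_of_ne _ _ _ (show (21 : ℕ) ≠ 18 by decide)]
      rcases hI with ⟨h0, hI⟩ | ⟨j, hj, hI⟩
      · refine Or.inl ⟨h0, fun j hj h5 h6 => ?_⟩
        rcases Nat.lt_succ_iff_lt_or_eq.1 hj with hj | rfl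
        · exact hI j hj h5 h6
        · exact h ⟨h5, h6⟩
      · exact Or.inr ⟨j, by omega, hI⟩

/-- This dichotomy serves both matching procedures: it decides between picking and passing on in the
initial matching, and between `replace` and `drop` in Dynamic-Vertex-Cover. -/
theorem runs_tryMatch {n m : ℕ} {G : SimpleGraph (Fin n)} {E : EdgeList G m} {W : ℕ} {s : State}
    (hmW : m < W) (hnW : n < W) (hL : WedgeLists E s) {U : Finset (Fin n)}
    (hU : StoresEdges E U s) {M : Set (Sym2 (Sym2 (Fin n)))} (hM : StoresMatching E M (s.ints 6))
    {b : Fin m} (hb : s.ints 20 0 = b) (h5 : s.ints 5 b = 1) (h6 : s.ints 6 b = 0) :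
    Runs W tryMatch s (n * 60 + 50) fun s' => ∃ M', StoresMatching E M' (s'.ints 6) ∧
      ((∃ t : Fin m, (wedgeGraph (restrict G U)).Adj (E.edge b) (E.edge t) ∧
        ¬ Covered M (E.edge t) ∧ M' = insert s(E.edge b, E.edge t) M) ∨
      (M' = M ∧ ∀ t, (wedgeGraph (restrict G U)).Adj (E.edge b) t → Covered M t)) := by
  refine (Runs.seq (T := n * 60 + 20) (T' := 30) (runs_search hmW hnW hL hb)
    fun s₁ h₁ F₁ => (Runs.of_wp ?_).mono (by decide) fun _ h _ => h).mono (by omega)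
    fun _ h _ => h
  simp only [Cmd.wp, IExp.eval, BExp.Holds, F₁.ints (a := 6) rfl, F₁.ints (a := 20) rfl, hb,
    State.setI_ints_self, State.setI_ints_of_ne _ _ _ (show (21 : ℕ) ≠ 6 by decide),
    State.setI_ints_of_ne _ _ _ (show (20 : ℕ) ≠ 6 by decide)]
  have hbm := b.2
  rcases h₁ with ⟨h0, h₁⟩ | ⟨j, hj, hj5, hj6, h₁⟩
  · refine ⟨fun _ => ⟨M, hM, Or.inr ⟨rfl, fun t ht => ?_⟩⟩, fun h => absurd h0 h⟩
    obtain ⟨f, rfl⟩ := E.exists_edge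
      (edgeSet_of_wedgeGraph_adj ((wedgeGraph_restrict_adj _ _ _ _).1 ht).1.symm)
    obtain ⟨-, hf, j, hj, hjf⟩ := (hL.restrict_adj hU b f).1 ht
    rw [hM.covered_iff, ← hjf]
    exact h₁ j hj (hjf ▸ hf)
  · have hent := hL.entry b j hj
    obtain ⟨t, ht⟩ : ∃ t : Fin m, s.ints 9 (s.ints 7 b + j) = t := ⟨⟨_, hent⟩, rfl⟩
    rw [ht] at hj5 hj6 h₁
    have hadj := (hL.restrict_adj hU b t).2 ⟨h5, hj5, j, hj, ht⟩
    rw [h₁]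
    refine ⟨fun h => absurd h (by omega), fun _ => ⟨by omega, by omega, _, ?_,
      Or.inl ⟨t, hadj, ?_, rfl⟩⟩⟩
    · rw [Nat.add_sub_cancel]
      exact hM.insert h6 hj6 ((wedgeGraph_restrict_adj _ _ _ _).1 hadj).1
    · rw [hM.covered_iff]; simpa using hj6

end Program


/-! ### Dynamic-Vertex-Cover with the deleted edges taken in index order. -/

theorem DynLoop.snoc {α : Type*} {Z : SimpleGraph α} {N : Set α} {l : List α} {a : α}
    {M M' M'' : Set (Sym2 α)} (h : DynLoop Z N l M M') (h' : DynStep Z N a M' M'') :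
    DynLoop Z N (l ++ [a]) M M'' := by
  induction h with
  | nil => exact .cons _ _ _ _ _ h' (.nil _)
  | cons c l M₁ M₂ M₃ hs _ ih => exact .cons _ _ _ _ _ hs (ih h')

/-- Dynamic-Vertex-Cover has turned `M` into `M'` when the edges with index below `k` have been
processed. -/
def DynPrefix {n m : ℕ} {G : SimpleGraph (Fin n)} (E : EdgeList G m)
    (Z : SimpleGraph (Sym2 (Fin n))) (N : Set (Sym2 (Fin n))) (k : ℕ)
    (M M' : Set (Sym2 (Sym2 (Fin n)))) : Prop :=
  ∃ l : List (Sym2 (Fin n)), l.Nodup ∧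
    (∀ a, a ∈ l ↔ ∃ e : Fin m, (e : ℕ) < k ∧ E.edge e = a ∧ a ∈ N) ∧ DynLoop Z N l M M'

namespace DynPrefix

variable {n m : ℕ} {G : SimpleGraph (Fin n)} {E : EdgeList G m}
  {Z : SimpleGraph (Sym2 (Fin n))} {N : Set (Sym2 (Fin n))} {M M' M'' : Set (Sym2 (Sym2 (Fin n)))}

theorem zero : DynPrefix E Z N 0 M M := ⟨[], by simp, by simp, .nil M⟩

theorem skip {e : Fin m} (h : DynPrefix E Z N e M M') (he : E.edge e ∉ N) :
    DynPrefix E Z N (e + 1) M M' := by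
  obtain ⟨l, h1, h2, h3⟩ := h
  refine ⟨l, h1, fun a => (h2 a).trans ⟨?_, ?_⟩, h3⟩
  · rintro ⟨f, hf, h⟩
    exact ⟨f, by omega, h⟩
  · rintro ⟨f, hf, rfl, hN⟩
    have : f ≠ e := by rintro rfl; exact he hN
    exact ⟨f, by have := Fin.val_ne_of_ne this; omega, rfl, hN⟩

theorem step {e : Fin m} (h : DynPrefix E Z N e M M') (he : E.edge e ∈ N)
    (hs : DynStep Z N (E.edge e) M' M'') : DynPrefix E Z N (e + 1) M M'' := by
  obtain ⟨l, h1, h2, h3⟩ := h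
  refine ⟨l ++ [E.edge e], ?_, fun a => ?_, h3.snoc hs⟩
  · rw [List.nodup_append]
    refine ⟨h1, by simp, ?_⟩
    rintro a ha b hb rfl
    obtain ⟨f, hf, hfe, -⟩ := (h2 a).1 ha
    rw [List.mem_singleton.1 hb] at hfe
    have := E.edge_injective hfe
    omega
  · rw [List.mem_append, List.mem_singleton, h2]
    constructor
    · rintro (⟨f, hf, h⟩ | rfl)
      · exact ⟨f, by omega, h⟩
      · exact ⟨e, by omega, rfl, he⟩
    · rintro ⟨f, hf, rfl, hN⟩
      by_cases hfe : f = e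
      · exact Or.inr (by rw [hfe])
      · exact Or.inl ⟨f, by have := Fin.val_ne_of_ne hfe; omega, rfl, hN⟩

theorem dynamicVertexCover (hN : N ⊆ G.edgeSet) (h : DynPrefix E Z N m M M') :
    DynamicVertexCover Z N M M' := by
  obtain ⟨l, h1, h2, h3⟩ := h
  refine ⟨l, h1, fun a => (h2 a).trans ⟨fun ⟨e, _, _, h⟩ => h, fun ha => ?_⟩, h3⟩
  obtain ⟨e, rfl⟩ := E.exists_edge (hN ha)
  exact ⟨e, e.2, rfl, ha⟩

end DynPrefix

theorem edge_mem_incidenceSet {n m : ℕ} {G : SimpleGraph (Fin n)} (E : EdgeList G m)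
    (U : Finset (Fin n)) (u : Fin n) (e : Fin m) :
    E.edge e ∈ (restrict G U).incidenceSet u ↔ (∀ v ∈ E.edge e, v ∈ U) ∧ u ∈ E.edge e := by
  simp only [SimpleGraph.incidenceSet, Set.mem_ofPred_eq, mem_restrict_edgeSet]
  simp [E.edge_mem]

theorem HasInput.endAt_iff {n m : ℕ} {G : SimpleGraph (Fin n)} {E : EdgeList G m} {lam : ℝ}
    {s : RAM.State} (h : HasInput E lam s) (e : Fin m) (v : Fin n) :
    Program.EndAt s e v ↔ v ∈ E.edge e := by
  simp only [Program.EndAt, h.src, h.dst, EdgeList.edge, Sym2.mem_iff, Fin.val_inj]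
  simp only [eq_comm]

/-! ### Programs for the two matching procedures. -/

namespace Program

open RAM

/-- Computes a maximal matching of the wedge graph. -/
def initMatching : Cmd :=
  forLoop 17 mVar (.ite (.ieq (.get 6 (var 17)) (.const 0)) (.seq (assign 20 (var 17)) tryMatch)
    .skip)

/-- Updates the matching after the edges at the vertex in variable 19 have been deleted. -/
def updateMatching : Cmd :=
  forLoop 17 mVar
    (.ite (.and (isEnd (var 17) (var 19)) (.not (.ieq (.get 6 (var 17)) (.const 0))))
      (.seq (.seq (assign 20 (.sub (.get 6 (var 17)) (.const 1)))
        (.seq (.setI 6 (var 17) (.const 0)) (.setI 6 (var 20) (.const 0))))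
        (.ite (.ieq (.get 5 (var 20)) (.const 1)) tryMatch .skip)) .skip)

/-- One sweep suffices: coverage is never lost while pairs are only added, so an edge left unmatched
because all its neighbours were covered needs no second look. -/
theorem runs_initMatching {n m : ℕ} {G : SimpleGraph (Fin n)} {E : EdgeList G m} {lam : ℝ} {W : ℕ}
    {s : State} (hmW : m < W) (hnW : n < W) (hin : HasInput E lam s) (hL : WedgeLists E s)
    (hU : StoresEdges E Finset.univ s) (hp : ∀ e : Fin m, s.ints 6 e = 0) :
    Runs W initMatching s (m * (n * 60 + 100) + 20) fun s' =>
      ∃ M, AprMatching (wedgeGraph G) M ∧ StoresMatching E M (s'.ints 6) := by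
  refine (Runs.forLoop_const (N := m) (fun i s' => ∃ M, AprReach (wedgeGraph G) M ∧
      StoresMatching E M (s'.ints 6) ∧ ∀ e : Fin m, (e : ℕ) < i → ∀ f,
        (wedgeGraph G).Adj (E.edge e) f → Covered M (E.edge e) ∨ Covered M f)
      (n * 60 + 70) hmW rfl (fun s' hF => ?_) ?_ ?_).mono
      (Nat.add_le_add (Nat.mul_le_mul_left _ (by simp only [IExp.cost]; omega)) (by decide)) ?_
  · simp [IExp.eval, hF.ints (a := 0) rfl, hin.m_eq]
  · refine ⟨∅, .empty, ?_, by simp⟩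
    rw [State.setI_ints_of_ne _ _ _ (by decide)]
    exact .empty hp
  · rintro i s' hi hF ⟨M, hR, hM, hc⟩ ha
    obtain ⟨e, rfl⟩ : ∃ e : Fin m, (e : ℕ) = i := ⟨⟨i, hi⟩, rfl⟩
    simp only [State.setI_ints_of_ne _ _ _ (show (6 : ℕ) ≠ 17 by decide)]
    refine (Runs.ite (T := n * 60 + 54) (fun h => ?_) fun h => ?_).mono
      (by simp only [BExp.cost, IExp.cost]; omega) fun _ h _ => h
    · simp only [BExp.Holds, IExp.eval, ha] at h
      refine (Runs.seq (T := 4) (T' := n * 60 + 50) (.of_wp (Q := fun s'' => s'' = s'.setI 20 0 e)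
        ?_) ?_).mono (by omega) fun _ h _ => h
      · simp only [Cmd.wp, IExp.eval, ha, and_true]; omega
      rintro _ rfl F₁
      have e5 : (s'.setI 20 0 e).ints 5 = s.ints 5 := by rw [F₁.ints rfl, hF.ints rfl]
      have e6 : (s'.setI 20 0 e).ints 6 = s'.ints 6 := F₁.ints rfl
      refine (runs_tryMatch (U := Finset.univ) hmW hnW (b := e) ?_ ?_ (e6.symm ▸ hM) (by simp) ?_
        (by rw [e6, h])).mono le_rfl ?_
      · exact hL.of_eq (by rw [F₁.ints rfl, hF.ints rfl]) (by rw [F₁.ints rfl, hF.ints rfl])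
          (by rw [F₁.ints rfl, hF.ints rfl])
      · unfold StoresEdges; rw [e5]; exact hU
      · rw [e5, hU]; simp
      · rw [restrict_univ]
        rintro s'' ⟨M', hM', hcase⟩ -
        rcases hcase with ⟨t, hadj, htc, rfl⟩ | ⟨rfl, hcov⟩
        · refine ⟨_, .pick _ _ _ hR hadj ?_ htc, hM', fun f hf g hfg => ?_⟩
          · rw [hM.covered_iff]; simpa using h
          · rcases Nat.lt_succ_iff_lt_or_eq.1 hf with hf | hf
            · exact (hc f hf g hfg).imp (·.mono (Set.subset_insert _ _))
                (·.mono (Set.subset_insert _ _))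
            · rw [Fin.ext hf]
              exact Or.inl ⟨_, Set.mem_insert _ _, by simp⟩
        · refine ⟨_, hR, hM', fun f hf g hfg => ?_⟩
          rcases Nat.lt_succ_iff_lt_or_eq.1 hf with hf | hf
          · exact hc f hf g hfg
          · obtain rfl := Fin.ext hf
            exact Or.inr (hcov g hfg)
    · simp only [BExp.Holds, IExp.eval, ha] at h
      refine (Runs.of_wp (p := .skip) ?_).mono (by simp [Cmd.flatCost]) fun _ h _ => h
      refine ⟨M, hR, hM, fun f hf g hfg => ?_⟩
      rcases Nat.lt_succ_iff_lt_or_eq.1 hf with hf | hf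
      · exact hc f hf g hfg
      · obtain rfl := Fin.ext hf
        exact Or.inl ((hM.covered_iff f).2 h)
  · rintro s' ⟨M, hR, hM, hc⟩ -
    refine ⟨M, ⟨hR, ?_⟩, hM⟩
    rintro ⟨a, b, hab, ha, hb⟩
    obtain ⟨e, rfl⟩ := E.exists_edge (edgeSet_of_wedgeGraph_adj hab)
    exact (hc e e.2 b hab).elim ha hb

/-- The sweep itself is `O(m)`, and only edges at `u` can trigger a search. They are counted in the
input graph, which makes the later sum over all passes immediate. The intermediate matchings are
kept inside the wedge graph before the deletion. -/
theorem runs_updateMatching {n m : ℕ} {G : SimpleGraph (Fin n)} {E : EdgeList G m} {lam : ℝ}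
    {W : ℕ} {s : State} (hmW : m < W) (hnW : n < W) (hin : HasInput E lam s)
    (hL : WedgeLists E s) {U : Finset (Fin n)} {u : Fin n}
    (hU : StoresEdges E (U.erase u) s) (hu : s.ints 19 0 = u)
    {M : Set (Sym2 (Sym2 (Fin n)))} (hM : StoresMatching E M (s.ints 6))
    (hMU : M ⊆ (wedgeGraph (restrict G U)).edgeSet) :
    Runs W updateMatching s
      (m * 60 + (Finset.univ.filter fun e => u ∈ E.edge e).card * (n * 60 + 100) + 20) fun s' =>
      ∃ M', DynamicVertexCover (wedgeGraph (restrict G (U.erase u)))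
        ((restrict G U).incidenceSet u) M M' ∧ StoresMatching E M' (s'.ints 6) := by
  have hZ := wedgeGraph_erase_adj G U u
  set N := (restrict G U).incidenceSet u with hN
  set Z := wedgeGraph (restrict G U) with hZdef
  set Z' := wedgeGraph (restrict G (U.erase u)) with hZdef'
  refine (Runs.forLoop (N := m) (fun i s' => ∃ M', DynPrefix E Z' N i M M' ∧ M' ⊆ Z.edgeSet ∧
      StoresMatching E M' (s'.ints 6))
      (fun i => 40 + if EndAt s i u then n * 60 + 100 else 0) hmW rfl
      (fun s' hF => ?_) ?_ ?_).mono ?_ ?_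
  · simp [IExp.eval, hF.ints (a := 0) rfl, hin.m_eq]
  · refine ⟨M, .zero, hMU, ?_⟩
    rw [State.setI_ints_of_ne _ _ _ (by decide)]
    exact hM
  · rintro i s' hi hF ⟨M₁, hP, hM₁U, hM₁⟩ ha
    obtain ⟨e, rfl⟩ : ∃ e : Fin m, (e : ℕ) = i := ⟨⟨i, hi⟩, rfl⟩
    have hcond : (BExp.and (isEnd (var 17) (var 19))
        (.not (.ieq (.get 6 (var 17)) (.const 0)))).Holds s' ↔ u ∈ E.edge e ∧ s'.ints 6 e ≠ 0 := by
      rw [← hin.endAt_iff]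
      simp only [BExp.Holds, IExp.eval, ha, EndAt, hF.ints (a := 1) rfl, hF.ints (a := 2) rfl,
        hF.ints (a := 19) rfl, hu]
      tauto
    simp only [State.setI_ints_of_ne _ _ _ (show (6 : ℕ) ≠ 17 by decide), hin.endAt_iff]
    by_cases hc : u ∈ E.edge e ∧ s'.ints 6 e ≠ 0
    · refine (Runs.ite (T := n * 60 + 90) (fun _ => ?_) fun h => absurd (hcond.2 hc) h).mono
        (by simp only [BExp.cost, IExp.cost, hc.1, if_true]; omega) fun _ h _ => h
      obtain ⟨b, hb⟩ := hM₁.exists_partner hc.2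
      have hab := ((hM₁.partner e).1 b).2 hb
      -- The test only asks whether `e` is at `u`. That `e` was still present before this deletion
      -- follows from its being matched.
      have heN : E.edge e ∈ N :=
        (edge_mem_incidenceSet E U u e).2
          ⟨((wedgeGraph_restrict_adj _ _ _ _).1 (hM₁U hab)).2.1, hc.1⟩
      refine (Runs.seq (T := 30) (T' := n * 60 + 60) ((Runs.of_wp (Q := fun s'' =>
        s''.ints 20 0 = b ∧
        s''.ints 6 = Function.update (Function.update (s'.ints 6) e 0) b 0) ?_).mono
        (by decide) fun _ h _ => h) ?_).mono (by omega) fun _ h _ => h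
      · have := b.2
        simp only [Cmd.wp, IExp.eval, ha, hb, Nat.add_sub_cancel, State.setI_ints_self,
          Function.update_self, State.setI_ints_of_ne _ _ _ (show (17 : ℕ) ≠ 20 by decide),
          State.setI_ints_of_ne _ _ _ (show (20 : ℕ) ≠ 6 by decide),
          State.setI_ints_of_ne _ _ _ (show (6 : ℕ) ≠ 20 by decide), and_self, and_true]
        omega
      rintro s₁ ⟨h20, h6⟩ F₁
      have e5 : s₁.ints 5 = s.ints 5 := by rw [F₁.ints rfl, hF.ints rfl]
      have hM₂ : StoresMatching E (M₁ \ {s(E.edge e, E.edge b)}) (s₁.ints 6) :=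
        h6 ▸ hM₁.erase hb
      have hU₁ : StoresEdges E (U.erase u) s₁ := by unfold StoresEdges; rw [e5]; exact hU
      have hsub : M₁ \ {s(E.edge e, E.edge b)} ⊆ Z.edgeSet := Set.sdiff_subset.trans hM₁U
      refine (Runs.ite (T := n * 60 + 50) (fun h => ?_) fun h => ?_).mono
        (by simp only [BExp.cost, IExp.cost]; omega) fun _ h _ => h
      · simp only [BExp.Holds, IExp.eval, h20] at h
        refine (runs_tryMatch hmW hnW (b := b) ?_ hU₁ hM₂ h20 h ?_).mono le_rfl ?_
        · exact hL.of_eq (by rw [F₁.ints rfl, hF.ints rfl]) (by rw [F₁.ints rfl, hF.ints rfl])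
            (by rw [F₁.ints rfl, hF.ints rfl])
        · rw [h6]; simp
        · rintro s₂ ⟨M₃, hM₃, hcase⟩ -
          rcases hcase with ⟨t, hadj, htc, rfl⟩ | ⟨rfl, hcov⟩
          · have hadj' := (hZ _ _).1 hadj
            exact ⟨_, hP.step heN (.replace _ _ hab ⟨hadj'.2.1, hadj'.2.2, htc, hadj⟩),
              Set.insert_subset hadj'.1 hsub, hM₃⟩
          · exact ⟨_, hP.step heN (.drop _ hab fun ⟨t, ht⟩ => ht.2.2.1 (hcov t ht.2.2.2)),
              hsub, hM₃⟩
      · simp only [BExp.Holds, IExp.eval, h20] at h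
        refine (Runs.of_wp (p := .skip) ?_).mono (by simp [Cmd.flatCost]) fun _ h _ => h
        -- The partner `b` is deleted as well, hence has no neighbour in the new wedge graph and no
        -- replacement.
        refine ⟨_, hP.step heN (.drop _ hab ?_), hsub, hM₂⟩
        rintro ⟨t, ht⟩
        exact h ((hU₁.eq_one b).2 ((wedgeGraph_restrict_adj _ _ _ _).1 ht.2.2.2).2.1)
    · refine (Runs.ite (T := 1) (fun h => absurd (hcond.1 h) hc) fun _ =>
        Runs.of_wp (p := .skip) ?_).mono (by simp only [BExp.cost, IExp.cost]; omega) fun _ h _ => h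
      -- An unmatched member of `N` is an `unmatched` step; an edge outside `N` is not part of the
      -- list at all.
      by_cases heN : E.edge e ∈ N
      · refine ⟨M₁, hP.step heN (.unmatched ?_), hM₁U, hM₁⟩
        rintro ⟨b, hb⟩
        exact hc ⟨((edge_mem_incidenceSet E U u e).1 heN).2,
          (hM₁.covered_iff e).1 ⟨_, hb, by simp⟩⟩
      · exact ⟨M₁, hP.skip heN, hM₁U, hM₁⟩
  · have hsum : ∑ j ∈ Finset.range m, (40 + if EndAt s j u then n * 60 + 100 else 0) =
        m * 40 + (Finset.univ.filter fun e => u ∈ E.edge e).card * (n * 60 + 100) := by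
      rw [Finset.sum_add_distrib, Finset.sum_range (fun j => if EndAt s j u then n * 60 + 100 else 0)]
      simp only [hin.endAt_iff, ← Finset.sum_filter]
      simp
    rw [hsum]
    simp only [IExp.cost]
    omega
  · rintro s' ⟨M', hP, -, hM'⟩ -
    refine ⟨M', hP.dynamicVertexCover fun a ha => ?_, hM'⟩
    exact ((mem_restrict_edgeSet G U a).1 ha.1).1

end Program


/-! ### Weighted degrees and scores as sums over edge indices. -/

section Weights

variable {n m : ℕ} {G : SimpleGraph (Fin n)}

open Classical in
theorem EdgeList.ncard_eq (E : EdgeList G m) {S : Set (Sym2 (Fin n))} (hS : S ⊆ G.edgeSet) :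
    S.ncard = (Finset.univ.filter fun e => E.edge e ∈ S).card := by
  have : S = ↑((Finset.univ.filter fun e => E.edge e ∈ S).image E.edge) := by
    ext a
    simp only [Finset.coe_image, Finset.coe_filter, Finset.mem_univ, true_and, Set.mem_image,
      Set.mem_ofPred_eq]
    constructor
    · intro ha
      obtain ⟨e, rfl⟩ := E.exists_edge (hS ha)
      exact ⟨e, ha, rfl⟩
    · rintro ⟨e, he, rfl⟩
      exact he
  conv_lhs => rw [this]
  rw [Set.ncard_coe_finset, Finset.card_image_of_injective _ E.edge_injective]

open Classical in
theorem EdgeList.sum_weight (E : EdgeList G m) {S : Set (Sym2 (Fin n))} (hS : S ⊆ G.edgeSet)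
    (L : Set (Sym2 (Fin n))) (lam : ℝ) :
    ((S \ L).ncard : ℝ) + lam * ((S ∩ L).ncard : ℝ) =
      ∑ e, if E.edge e ∈ S then if E.edge e ∈ L then lam else 1 else 0 := by
  rw [E.ncard_eq (Set.sdiff_subset.trans hS), E.ncard_eq (Set.inter_subset_left.trans hS),
    ← Finset.sum_boole, ← Finset.sum_boole, Finset.mul_sum, ← Finset.sum_add_distrib]
  refine Finset.sum_congr rfl fun e _ => ?_
  by_cases h1 : E.edge e ∈ S <;> by_cases h2 : E.edge e ∈ L <;> simp [h1, h2]

open Program in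
open Classical in
theorem weightAt_eq {E : EdgeList G m} {lam : ℝ} {U : Finset (Fin n)}
    {M : Set (Sym2 (Sym2 (Fin n)))} {s : RAM.State} (hin : HasInput E lam s)
    (hU : StoresEdges E U s) (hM : StoresMatching E M (s.ints 6)) (e : Fin m) :
    weightAt s e = if E.edge e ∈ (restrict G U).edgeSet then
      if E.edge e ∈ weakEdges M then lam else 1 else 0 := by
  have h1 : E.edge e ∈ (restrict G U).edgeSet ↔ s.ints 5 e = 1 := by
    rw [mem_restrict_edgeSet, hU.eq_one]; simp [E.edge_mem]
  have h2 : E.edge e ∈ weakEdges M ↔ ¬ s.ints 6 e = 0 := hM.covered_iff e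
  rw [weightAt, hin.lam_eq]
  simp only [h1, h2]
  split_ifs <;> simp_all

open Program in
theorem weightedDegree_eq {E : EdgeList G m} {lam : ℝ} {U : Finset (Fin n)}
    {M : Set (Sym2 (Sym2 (Fin n)))} {s : RAM.State} (hin : HasInput E lam s)
    (hU : StoresEdges E U s) (hM : StoresMatching E M (s.ints 6)) (v : Fin n) :
    weightedDegree G lam U (weakEdges M) v =
      ∑ e ∈ Finset.range m, if EndAt s e v then weightAt s e else 0 := by
  classical
  rw [weightedDegree, E.sum_weight (fun a ha => ((mem_restrict_edgeSet G U a).1 ha.1).1),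
    Finset.sum_range (fun e => if EndAt s e v then weightAt s e else 0)]
  refine Finset.sum_congr rfl fun e _ => ?_
  rw [weightAt_eq hin hU hM, edge_mem_incidenceSet]
  simp only [hin.endAt_iff, mem_restrict_edgeSet, E.edge_mem, true_and]
  split_ifs <;> simp_all

open Program in
theorem total_weight_eq {E : EdgeList G m} {lam : ℝ} {U : Finset (Fin n)}
    {M : Set (Sym2 (Sym2 (Fin n)))} {s : RAM.State} (hin : HasInput E lam s)
    (hU : StoresEdges E U s) (hM : StoresMatching E M (s.ints 6)) :
    (mStrong G U (weakEdges M) : ℝ) + lam * (mWeak G U (weakEdges M) : ℝ) =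
      ∑ e ∈ Finset.range m, weightAt s e := by
  classical
  rw [mStrong, mWeak, E.sum_weight (fun a ha => ((mem_restrict_edgeSet G U a).1 ha).1),
    Finset.sum_range (weightAt s)]
  exact Finset.sum_congr rfl fun e _ => (weightAt_eq hin hU hM e).symm

end Weights

/-- The first `k` cells of the array `f` list the vertices in `U` that are on no edge of the input
graph. -/
structure IsolatedStack {n m : ℕ} {G : SimpleGraph (Fin n)} (E : EdgeList G m)
    (U : Finset (Fin n)) (k : ℕ) (f : ℕ → ℕ) : Prop where
  mem : ∀ j < k, ∃ v ∈ U, f j = (v : ℕ) ∧ ∀ e, v ∉ E.edge e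
  inj : ∀ i < k, ∀ j < k, f i = f j → i = j
  complete : ∀ v ∈ U, (∀ e, v ∉ E.edge e) → ∃ j < k, f j = (v : ℕ)

/-- The data that the program maintains. -/
structure Maintains {n m : ℕ} {G : SimpleGraph (Fin n)} (E : EdgeList G m) (lam : ℝ)
    (U : Finset (Fin n)) (M : Set (Sym2 (Sym2 (Fin n)))) (s : RAM.State) : Prop where
  input : HasInput E lam s
  lists : WedgeLists E s
  count : s.ints 3 0 = U.card
  vertices : ∀ v : Fin n, s.ints 4 v = if v ∈ U then 1 else 0
  edges : StoresEdges E U s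
  matching : StoresMatching E M (s.ints 6)
  priority : ∀ v, s.reals 1 v =
    ∑ e ∈ Finset.range m, if Program.EndAt s e v then Program.weightAt s e else 0
  total : s.reals 2 0 = ∑ e ∈ Finset.range m, Program.weightAt s e
  isolated : IsolatedStack E U (s.ints 14 0) (s.ints 13)

theorem Maintains.represents {n m : ℕ} {G : SimpleGraph (Fin n)} {E : EdgeList G m} {lam : ℝ}
    {U : Finset (Fin n)} {M : Set (Sym2 (Sym2 (Fin n)))} {s : RAM.State}
    (h : Maintains E lam U M s) : Represents E lam U M s where
  count := h.count
  vertices := h.vertices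
  edges := h.edges
  matching := h.matching.partner
  wedges := h.lists.restrict_adj h.edges
  priorities v _ := by rw [h.priority, weightedDegree_eq h.input h.edges h.matching]

/-! ### One pass of the main loop. -/

namespace Program

open RAM

/-- Stores the current labels in array 11. -/
def copyLabels : Cmd :=
  forLoop 17 mVar (.ite (.ieq (.get 6 (var 17)) (.const 0)) (.setI 11 (var 17) (.const 0))
    (.setI 11 (var 17) (.const 1)))

/-- Compares the current score with the best score so far. -/
def record : Cmd :=
  .ite (.not (.rlt (.mul (.get 2 (.const 0)) (.ofInt (var 22)))
      (.mul (.get 3 (.const 0)) (.ofInt (var 3)))))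
    (.seq copyLabels (.seq (assign 22 (var 3)) (.setR 3 (.const 0) (.get 2 (.const 0))))) .skip

/-- Replaces the vertex in variable 19 by `v` if that is an improvement. -/
def consider (v : IExp) : Cmd :=
  .ite (.and (.ieq (.get 4 v) (.const 1))
      (.not (.and (.not (.ieq (var 19) nVar)) (.not (.rlt (.get 1 v) (.get 1 (var 19)))))))
    (assign 19 v) .skip

/-- Puts a vertex of least priority into variable 19. -/
def selectVertex : Cmd :=
  .ite (.ilt (.const 0) (var 14))
    (.seq (assign 14 (.sub (var 14) (.const 1))) (assign 19 (.get 13 (var 14))))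
    (.seq (assign 19 nVar)
      (forLoop 17 mVar (.seq (consider (.get 1 (var 17))) (consider (.get 2 (var 17))))))

/-- Deletes the vertex in variable 19 and its edges. -/
def deleteVertex : Cmd :=
  .seq (.seq (.setI 4 (var 19) (.const 0)) (.seq (.setI 12 (var 19) (var 3))
      (assign 3 (.sub (var 3) (.const 1)))))
    (forLoop 17 mVar (.ite (isEnd (var 17) (var 19)) (.setI 5 (var 17) (.const 0)) .skip))

def body : Cmd :=
  .seq record (.seq selectVertex (.seq deleteVertex (.seq updateMatching computePriorities)))

theorem runs_copyLabels {W m : ℕ} {s : State} (hW : m < W) (hW1 : 1 < W) (hm : s.ints 0 1 = m) :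
    Runs W copyLabels s (m * 40 + 9) fun s' =>
      ∀ e < m, s'.ints 11 e = if s.ints 6 e = 0 then 0 else 1 := by
  refine (Runs.forLoop_wp (N := m) (fun i s' =>
    ∀ e < i, s'.ints 11 e = if s.ints 6 e = 0 then 0 else 1) hW rfl
    (fun s' hF => ?_) (by simp) ?_).mono
    (Nat.add_le_add (Nat.mul_le_mul_left _ (by decide)) (by decide)) fun _ h _ => h
  · simp [IExp.eval, hF.ints (a := 0) rfl, hm]
  · intro i s' hi hF hI ha
    simp only [Cmd.wp, IExp.eval, BExp.Holds, ha, hF.ints (a := 6) rfl, State.setI_ints_self,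
      State.setI_ints_of_ne _ _ _ (show (11 : ℕ) ≠ 17 by decide)]
    refine ⟨fun h => ⟨by omega, fun e he => ?_⟩, fun h => ⟨hW1, fun e he => ?_⟩⟩ <;>
    · rcases Nat.lt_succ_iff_lt_or_eq.1 he with he | rfl
      · rw [Function.update_of_ne (by omega), hI e he]
      · simp [h]

/-- The effect of `record`. -/
def Recorded (m : ℕ) (s s' : State) : Prop :=
  (s.reals 3 0 * s.ints 3 0 ≤ s.reals 2 0 * s.ints 22 0 ∧ s'.ints 22 0 = s.ints 3 0 ∧
    s'.reals 3 0 = s.reals 2 0 ∧ ∀ e < m, s'.ints 11 e = if s.ints 6 e = 0 then 0 else 1) ∨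
  (s.reals 2 0 * s.ints 22 0 < s.reals 3 0 * s.ints 3 0 ∧ s'.ints 22 0 = s.ints 22 0 ∧
    s'.reals 3 0 = s.reals 3 0 ∧ ∀ e < m, s'.ints 11 e = s.ints 11 e)

/-- Real expressions have no division, so the scores are compared by cross-multiplication. Only the
labels are copied, at cost `O(m)`; of the vertex set only the size is kept. -/
theorem runs_record {W m : ℕ} {s : State} (hW : m < W) (hW1 : 1 < W) (hm : s.ints 0 1 = m)
    (hc : s.ints 3 0 < W) : Runs W record s (m * 40 + 50) (Recorded m s) := by
  refine (Runs.ite (T := m * 40 + 20) (fun h => ?_) fun h => ?_).mono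
    (by simp only [BExp.cost, IExp.cost, RExp.cost]; omega) fun _ h _ => h
  · simp only [BExp.Holds, RExp.eval, IExp.eval, not_lt] at h
    refine (Runs.seq (T' := 10) (runs_copyLabels hW hW1 hm) fun s₁ h₁ F₁ =>
      (Runs.of_wp ?_).mono (by decide) fun _ h _ => h).mono (by omega) fun _ h _ => h
    simp only [Cmd.wp, IExp.eval, RExp.eval, F₁.ints (a := 3) rfl, F₁.reals (a := 2) rfl,
      State.setI_reals]
    exact ⟨hc, Or.inl ⟨h, by simp, by simp, by simpa [State.setI_ints_of_ne] using h₁⟩⟩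
  · simp only [BExp.Holds, RExp.eval, IExp.eval, not_lt, not_le] at h
    refine (Runs.of_wp (p := .skip) (Q := Recorded m s) ?_).mono
      (by simp [Cmd.flatCost]) fun _ h _ => h
    exact Or.inr ⟨h, rfl, rfl, fun _ _ => rfl⟩

/-- Variable 19 holds a vertex of least priority among the remaining vertices in `S`, or `n` if
there is none. -/
def Least (n : ℕ) (s : State) (S : Set ℕ) (x : ℕ) : Prop :=
  (x = n ∧ ∀ v ∈ S, s.ints 4 v ≠ 1) ∨
  (x < n ∧ s.ints 4 x = 1 ∧ ∀ v ∈ S, s.ints 4 v = 1 → s.reals 1 x ≤ s.reals 1 v)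

theorem Least.insert {n : ℕ} {s : State} {S : Set ℕ} {x : ℕ} (h : Least n s S x) {v : ℕ}
    (hv : v < n) : (s.ints 4 v = 1 ∧ ¬ (x ≠ n ∧ ¬ s.reals 1 v < s.reals 1 x) →
      Least n s (insert v S) v) ∧ (¬ (s.ints 4 v = 1 ∧ ¬ (x ≠ n ∧ ¬ s.reals 1 v < s.reals 1 x)) →
      Least n s (insert v S) x) := by
  constructor
  · rintro ⟨h4, hx⟩
    refine Or.inr ⟨hv, h4, ?_⟩
    rintro w (rfl | hw) hw4
    · exact le_rfl
    · rcases h with ⟨_, h⟩ | ⟨hxn, -, h⟩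
      · exact absurd hw4 (h w hw)
      · have : s.reals 1 v < s.reals 1 x := by
          by_contra hc
          exact hx ⟨hxn.ne, hc⟩
        exact this.le.trans (h w hw hw4)
  · intro hx
    rcases h with ⟨h0, h⟩ | ⟨hxn, h4, h⟩
    · refine Or.inl ⟨h0, ?_⟩
      rintro w (rfl | hw)
      · exact fun h4 => hx ⟨h4, fun h => h.1 h0⟩
      · exact h w hw
    · refine Or.inr ⟨hxn, h4, ?_⟩
      rintro w (rfl | hw) hw4
      · by_contra hc
        exact hx ⟨hw4, fun h => h.2 (not_le.1 hc)⟩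
      · exact h w hw hw4

theorem wp_consider {n W : ℕ} {s s' : State} (hnW : n < W) {S : Set ℕ}
    (hn : s'.ints 0 0 = n) (h4 : s'.ints 4 = s.ints 4) (hr : s'.reals 1 = s.reals 1)
    (h : Least n s S (s'.ints 19 0)) {v : IExp} (hv : v.eval s' < n) {Q : State → Prop}
    (hQ : ∀ x, Least n s (insert (v.eval s') S) x → Q (s'.setI 19 0 x)) (hQ' :
      Least n s (insert (v.eval s') S) (s'.ints 19 0) → Q s') :
    (consider v).wp W Q s' := by
  simp only [consider, Cmd.wp, IExp.eval, BExp.Holds, RExp.eval, hn, h4, hr]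
  exact ⟨fun hc => ⟨by omega, hQ _ ((h.insert hv).1 hc)⟩, fun hc => hQ' ((h.insert hv).2 hc)⟩

/-- As long as the stack is nonempty, its top has priority 0, which is least because no weight is
negative. Afterwards every remaining vertex is an endpoint of an input edge, possibly a deleted one,
and the scan runs over the endpoints of all input edges. -/
theorem runs_selectVertex {n m : ℕ} {G : SimpleGraph (Fin n)} {E : EdgeList G m} {lam : ℝ}
    (hlam : 0 ≤ lam) {W : ℕ} {s : State} (hmW : m < W) (hnW : n < W) {U : Finset (Fin n)}
    {M : Set (Sym2 (Sym2 (Fin n)))} (h : Maintains E lam U M s) (hne : U.Nonempty) :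
    Runs W selectVertex s (m * 100 + 40) fun s' => ∃ u ∈ U, s'.ints 19 0 = u ∧
      (∀ v ∈ U, s.reals 1 u ≤ s.reals 1 v) ∧
      IsolatedStack E (U.erase u) (s'.ints 14 0) (s.ints 13) := by
  have hwt : ∀ e, 0 ≤ weightAt s e := by
    intro e
    simp only [weightAt, h.input.lam_eq]
    split_ifs <;> simp [hlam]
  refine (Runs.ite (T := m * 100 + 30) (fun hb => ?_) fun hb => ?_).mono
    (by simp only [BExp.cost, IExp.cost]; omega) fun _ h _ => h
  · simp only [BExp.Holds, IExp.eval] at hb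
    set k := s.ints 14 0 with hk
    obtain ⟨u, huU, hu, hiso⟩ := h.isolated.mem (k - 1) (by omega)
    -- The stack has distinct entries below `n`, so its height fits into a word.
    have hkn : k < W := by
      have hcard : (Finset.range k).card ≤ (Finset.range n).card := by
        refine Finset.card_le_card_of_injOn (s.ints 13) (fun j hj => ?_) fun i hi j hj hij => ?_
        · obtain ⟨v, -, hv, -⟩ := h.isolated.mem j (by simpa using hj)
          simp [hv]
        · exact h.isolated.inj i (by simpa using hi) j (by simpa using hj) hij
      simp only [Finset.card_range] at hcard
      omega
    refine (Runs.of_wp ?_).mono (le_trans (show _ ≤ 30 by decide) (by omega)) fun _ h _ => h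
    simp only [Cmd.wp, IExp.eval, ← hk, State.setI_ints_self, Function.update_self,
      State.setI_ints_of_ne _ _ _ (show (13 : ℕ) ≠ 14 by decide), hu,
      State.setI_ints_of_ne _ _ _ (show (14 : ℕ) ≠ 19 by decide)]
    refine ⟨by omega, by have := u.2; omega, u, huU, rfl, fun v _ => ?_, ?_⟩
    · have : s.reals 1 u = 0 := by
        rw [h.priority]
        refine Finset.sum_eq_zero fun e he => if_neg fun hc => ?_
        exact hiso ⟨e, Finset.mem_range.1 he⟩ ((h.input.endAt_iff ⟨e, Finset.mem_range.1 he⟩ u).1 hc)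
      rw [this, h.priority]
      exact Finset.sum_nonneg fun e _ => by split_ifs <;> simp [hwt]
    · refine ⟨fun j hj => ?_, fun i hi j hj => h.isolated.inj i (by omega) j (by omega),
        fun v hv hviso => ?_⟩
      · obtain ⟨v, hvU, hv, hviso⟩ := h.isolated.mem j (by omega)
        refine ⟨v, Finset.mem_erase.2 ⟨?_, hvU⟩, hv, hviso⟩
        rintro rfl
        have := h.isolated.inj j (by omega) (k - 1) (by omega) (by rw [hv, hu])
        omega
      · obtain ⟨j, hj, hjv⟩ := h.isolated.complete v (Finset.mem_of_mem_erase hv) hviso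
        refine ⟨j, ?_, hjv⟩
        have : j ≠ k - 1 := by
          rintro rfl
          exact Finset.ne_of_mem_erase hv (Fin.ext (by rw [← hjv, hu]))
        omega
  · simp only [BExp.Holds, IExp.eval, not_lt, Nat.le_zero] at hb
    refine (Runs.seq (T := 4) (T' := m * 100 + 20) (.of_wp (Q := fun s' => s' = s.setI 19 0 n) ?_)
      ?_).mono (by omega) fun _ h _ => h
    · simp only [Cmd.wp, IExp.eval, h.input.n_eq, and_true]; exact hnW
    rintro _ rfl F₁
    refine (Runs.forLoop_wp (N := m) (fun i s' =>
      Least n s {v | ∃ e < i, EndAt s e v} (s'.ints 19 0)) hmW rfl (fun s' hF => ?_) ?_ ?_).mono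
      (Nat.add_le_add (Nat.mul_le_mul_left _ (by decide)) (by decide)) ?_
    · simp [IExp.eval, hF.ints (a := 0) rfl, State.setI_ints_of_ne, h.input.m_eq]
    · exact Or.inl ⟨by simp [State.setI_ints_of_ne], by simp⟩
    · intro i s' hi hF hI ha
      obtain ⟨e, rfl⟩ : ∃ e : Fin m, (e : ℕ) = i := ⟨⟨i, hi⟩, rfl⟩
      have e0 : s'.ints 0 0 = n := by rw [hF.ints rfl, F₁.ints rfl, h.input.n_eq]
      have e1 : s'.ints 1 = s.ints 1 := by rw [hF.ints rfl, F₁.ints rfl]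
      have e2 : s'.ints 2 = s.ints 2 := by rw [hF.ints rfl, F₁.ints rfl]
      have e4 : s'.ints 4 = s.ints 4 := by rw [hF.ints rfl, F₁.ints rfl]
      have r1 : s'.reals 1 = s.reals 1 := by rw [hF.reals rfl, F₁.reals rfl]
      have hsrc : s.ints 1 e < n := by rw [h.input.src]; exact (E.src e).2
      have hdst : s.ints 2 e < n := by rw [h.input.dst]; exact (E.dst e).2
      have hset : {v | ∃ e' < (e : ℕ) + 1, EndAt s e' v} =
          insert (s.ints 2 e) (insert (s.ints 1 e) {v | ∃ e' < (e : ℕ), EndAt s e' v}) := by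
        ext v
        simp only [Set.mem_ofPred_eq, Set.mem_insert_iff, Nat.lt_succ_iff_lt_or_eq, EndAt]
        constructor
        · rintro ⟨f, hf | rfl, h | h⟩
          · exact Or.inr (Or.inr ⟨f, hf, Or.inl h⟩)
          · exact Or.inr (Or.inr ⟨f, hf, Or.inr h⟩)
          · exact Or.inr (Or.inl h.symm)
          · exact Or.inl h.symm
        · rintro (h | h | ⟨f, hf, h⟩)
          · exact ⟨e, Or.inr rfl, Or.inr h.symm⟩
          · exact ⟨e, Or.inr rfl, Or.inl h.symm⟩
          · exact ⟨f, Or.inl hf, h⟩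
      have v1 : (IExp.get 1 (var 17)).eval s' = s.ints 1 e := by simp [IExp.eval, ha, e1]
      have v2 : ∀ x, (IExp.get 2 (var 17)).eval (s'.setI 19 0 x) = s.ints 2 e := by
        simp [IExp.eval, ha, e2, State.setI_ints_of_ne]
      have v2' : (IExp.get 2 (var 17)).eval s' = s.ints 2 e := by simp [IExp.eval, ha, e2]
      simp only [hset, State.setI_ints_of_ne _ _ _ (show (19 : ℕ) ≠ 17 by decide)]
      refine wp_consider hnW e0 e4 r1 hI (by rw [v1]; exact hsrc) (fun x hx => ?_) fun hx => ?_
      · rw [v1] at hx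
        refine wp_consider (s := s) hnW (S := insert (s.ints 1 e) {v | ∃ e' < (e : ℕ), EndAt s e' v})
          (by simp [State.setI_ints_of_ne, e0])
          (by simp [State.setI_ints_of_ne, e4]) (by simp [r1]) (by simpa using hx)
          (by rw [v2]; exact hdst) (fun y hy => ?_) fun hy => ?_
        · simpa [v2] using hy
        · simpa [v2] using hy
      · rw [v1] at hx
        refine wp_consider hnW e0 e4 r1 hx (by rw [v2']; exact hdst) (fun y hy => ?_) fun hy => ?_
        · simpa [v2'] using hy
        · simpa [v2'] using hy
    · intro s' hs' F₂
      have e14 : s'.ints 14 0 = 0 := by rw [F₂.ints rfl, F₁.ints rfl, hb]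
      -- The empty stack is complete, so the scan misses no vertex of `U`.
      have hmem : ∀ v ∈ U, s.ints 4 v = 1 ∧ ∃ e < m, EndAt s e v := by
        intro v hv
        refine ⟨by simp [h.vertices, hv], ?_⟩
        by_contra hc
        obtain ⟨j, hj, -⟩ := h.isolated.complete v hv fun e he =>
          hc ⟨e, e.2, (h.input.endAt_iff e v).2 he⟩
        omega
      rcases hs' with ⟨-, hs'⟩ | ⟨hlt, h4, hs'⟩
      · obtain ⟨v, hv⟩ := hne
        exact absurd (hmem v hv).1 (hs' v (hmem v hv).2)
      · refine ⟨⟨_, hlt⟩, ?_, rfl, fun v hv => hs' v (hmem v hv).2 (hmem v hv).1, ?_⟩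
        · by_contra hc
          have := h.vertices ⟨_, hlt⟩
          rw [if_neg hc] at this
          exact absurd (this.symm.trans h4) (by decide)
        · rw [e14]
          refine ⟨fun j hj => absurd hj (by omega), fun i hi => absurd hi (by omega),
            fun v hv hiso => ?_⟩
          obtain ⟨j, hj, -⟩ := h.isolated.complete v (Finset.mem_of_mem_erase hv) hiso
          omega

theorem runs_deleteVertex {n m : ℕ} {G : SimpleGraph (Fin n)} {E : EdgeList G m} {lam : ℝ}
    {W : ℕ} {s : State} (hmW : m < W) (hc : s.ints 3 0 < W) {U : Finset (Fin n)} {u : Fin n}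
    (hin : HasInput E lam s) (hU : StoresEdges E U s) (hu : s.ints 19 0 = u) :
    Runs W deleteVertex s (m * 40 + 40) fun s' =>
      s'.ints 4 = Function.update (s.ints 4) u 0 ∧
      s'.ints 12 = Function.update (s.ints 12) u (s.ints 3 0) ∧
      s'.ints 3 0 = s.ints 3 0 - 1 ∧ StoresEdges E (U.erase u) s' := by
  refine (Runs.seq (T := 20) (T' := m * 40 + 20) ((Runs.of_wp (Q := fun s' =>
      s'.ints 4 = Function.update (s.ints 4) u 0 ∧
      s'.ints 12 = Function.update (s.ints 12) u (s.ints 3 0) ∧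
      s'.ints 3 0 = s.ints 3 0 - 1) ?_).mono (by decide) fun _ h _ => h) ?_).mono (by omega)
      fun _ h _ => h
  · simp [Cmd.wp, IExp.eval, State.setI_ints_of_ne, hu, hc]
    omega
  rintro s₁ ⟨h4, h12, h3⟩ F₁
  refine (Runs.forLoop_wp (N := m) (fun i s' => ∀ e : Fin m, s'.ints 5 e =
    if (e : ℕ) < i ∧ u ∈ E.edge e then 0 else s.ints 5 e) hmW rfl (fun s' hF => ?_) ?_ ?_).mono
      (Nat.add_le_add (Nat.mul_le_mul_left _ (by decide)) (by decide)) ?_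
  · simp [IExp.eval, hF.ints (a := 0) rfl, F₁.ints (a := 0) rfl, hin.m_eq]
  · simp [State.setI_ints_of_ne, F₁.ints (a := 5) rfl]
  · intro i s' hi hF hI ha
    obtain ⟨e, rfl⟩ : ∃ e : Fin m, (e : ℕ) = i := ⟨⟨i, hi⟩, rfl⟩
    have hcond : (isEnd (var 17) (var 19)).Holds s' ↔ u ∈ E.edge e := by
      rw [← hin.endAt_iff]
      simp only [BExp.Holds, IExp.eval, ha, EndAt, hF.ints (a := 1) rfl, hF.ints (a := 2) rfl,
        hF.ints (a := 19) rfl, F₁.ints (a := 1) rfl, F₁.ints (a := 2) rfl,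
        F₁.ints (a := 19) rfl, hu]
      tauto
    simp only [Cmd.wp, hcond, IExp.eval, ha, State.setI_ints_self,
      State.setI_ints_of_ne _ _ _ (show (5 : ℕ) ≠ 17 by decide)]
    refine ⟨fun h => ⟨by omega, fun f => ?_⟩, fun h f => ?_⟩
    · by_cases hfe : f = e
      · subst hfe; simp [h]
      · have := Fin.val_ne_of_ne hfe
        rw [Function.update_of_ne this, hI f]
        congr 2
        simp only [Nat.lt_succ_iff_lt_or_eq, this, or_false]
    · rw [hI f]
      by_cases hfe : f = e
      · subst hfe; simp [h]
      · have := Fin.val_ne_of_ne hfe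
        congr 2
        simp only [Nat.lt_succ_iff_lt_or_eq, this, or_false]
  · intro s' h5 F₂
    refine ⟨by rw [F₂.ints rfl, h4], by rw [F₂.ints rfl, h12], by rw [F₂.ints rfl, h3], ?_⟩
    intro e
    rw [h5 e, hU e]
    simp only [e.2, true_and, EdgeList.edge, Sym2.mem_iff, Finset.mem_erase, ne_eq,
      eq_comm (b := u)]
    by_cases h1 : u = E.src e <;> by_cases h2 : u = E.dst e <;> simp [h1, h2]

theorem weightAt_congr {s s' : State} (h5 : s'.ints 5 = s.ints 5) (h6 : s'.ints 6 = s.ints 6)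
    (hr : s'.reals 0 = s.reals 0) : weightAt s' = weightAt s := by
  funext e; simp [weightAt, h5, h6, hr]

theorem maintains_of_eq {n m : ℕ} {G : SimpleGraph (Fin n)} {E : EdgeList G m} {lam : ℝ}
    {U : Finset (Fin n)} {M : Set (Sym2 (Sym2 (Fin n)))} {s s' : State}
    (h : Maintains E lam U M s) (hi : ∀ a < 10, s'.ints a = s.ints a)
    (h13 : s'.ints 13 = s.ints 13) (h14 : s'.ints 14 = s.ints 14)
    (hr : ∀ a < 3, s'.reals a = s.reals a) : Maintains E lam U M s' := by
  have hw := weightAt_congr (hi 5 (by omega)) (hi 6 (by omega)) (hr 0 (by omega))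
  constructor
  · exact h.input.of_eq (hi 0 (by omega)) (hi 1 (by omega)) (hi 2 (by omega)) (hr 0 (by omega))
  · exact h.lists.of_eq (hi 7 (by omega)) (hi 8 (by omega)) (hi 9 (by omega))
  · rw [hi 3 (by omega)]; exact h.count
  · rw [hi 4 (by omega)]; exact h.vertices
  · unfold StoresEdges; rw [hi 5 (by omega)]; exact h.edges
  · rw [hi 6 (by omega)]; exact h.matching
  · simp only [EndAt, hw, hi 1 (by omega), hi 2 (by omega), hr 1 (by omega)]; exact h.priority
  · rw [hw, hr 2 (by omega)]; exact h.total
  · rw [h13, h14]; exact h.isolated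

/-- The coefficient 370 of `m` is the sum 40 + 100 + 40 + 60 + 130 of those of the five subprograms;
the search for replacements gives the degree term. -/
theorem exec_body {n m : ℕ} {G : SimpleGraph (Fin n)} {E : EdgeList G m} {lam : ℝ}
    (hlam : 0 ≤ lam) {W : ℕ} {s : State} (hmW : m < W) (hnW : n < W) (hW1 : 1 < W)
    {U : Finset (Fin n)} {M : Set (Sym2 (Sym2 (Fin n)))} (h : Maintains E lam U M s)
    (hM : M ⊆ (wedgeGraph (restrict G U)).edgeSet) (hne : U.Nonempty) :
    ∃ u s' t M', Exec W body s s' t ∧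
      t ≤ m * 370 + (Finset.univ.filter fun e => u ∈ E.edge e).card * (n * 60 + 100) + 200 ∧
      u ∈ U ∧ (∀ v ∈ U, weightedDegree G lam U (weakEdges M) u ≤
        weightedDegree G lam U (weakEdges M) v) ∧
      DynamicVertexCover (wedgeGraph (restrict G (U.erase u)))
        ((restrict G U).incidenceSet u) M M' ∧
      Maintains E lam (U.erase u) M' s' ∧ Recorded m s s' ∧
      s'.ints 12 = Function.update (s.ints 12) u U.card := by
  have hcW : U.card < W := (card_finset_fin_le U).trans_lt hnW
  obtain ⟨s₁, t₁, X₁, ht₁, h₁⟩ := runs_record hmW hW1 h.input.m_eq (h.count ▸ hcW)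
  have hm₁ : Maintains E lam U M s₁ := maintains_of_eq h
    (fun a ha => X₁.ints_eq (by interval_cases a <;> rfl)) (X₁.ints_eq rfl) (X₁.ints_eq rfl)
    (fun a ha => X₁.reals_eq (by interval_cases a <;> rfl))
  obtain ⟨s₂, t₂, X₂, ht₂, u, huU, hu, hmin, hstack⟩ :=
    runs_selectVertex hlam hmW hnW hm₁ hne
  have hin₂ : HasInput E lam s₂ := hm₁.input.of_eq (X₂.ints_eq rfl) (X₂.ints_eq rfl)
    (X₂.ints_eq rfl) (X₂.reals_eq rfl)
  have c₂ : s₂.ints 3 0 = U.card := by rw [X₂.ints_eq rfl, hm₁.count]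
  obtain ⟨s₃, t₃, X₃, ht₃, h4, h12, h3, h5⟩ := runs_deleteVertex hmW (c₂ ▸ hcW) hin₂ (U := U)
    (by unfold StoresEdges; rw [X₂.ints_eq rfl]; exact hm₁.edges) hu
  have hin₃ : HasInput E lam s₃ := hin₂.of_eq (X₃.ints_eq rfl) (X₃.ints_eq rfl)
    (X₃.ints_eq rfl) (X₃.reals_eq rfl)
  have hL₃ : WedgeLists E s₃ := hm₁.lists.of_eq (by rw [X₃.ints_eq rfl, X₂.ints_eq rfl])
    (by rw [X₃.ints_eq rfl, X₂.ints_eq rfl]) (by rw [X₃.ints_eq rfl, X₂.ints_eq rfl])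
  obtain ⟨s₄, t₄, X₄, ht₄, M', hdyn, h6⟩ := runs_updateMatching hmW hnW hin₃ hL₃ h5
    (by rw [X₃.ints_eq rfl, hu])
    (by rw [X₃.ints_eq rfl, X₂.ints_eq rfl]; exact hm₁.matching) hM
  have hin₄ : HasInput E lam s₄ := hin₃.of_eq (X₄.ints_eq rfl) (X₄.ints_eq rfl)
    (X₄.ints_eq rfl) (X₄.reals_eq rfl)
  obtain ⟨s₅, t₅, X₅, ht₅, h7, h8⟩ := runs_computePriorities hmW hin₄.m_eq
    (fun e he => by
      have := (E.adj ⟨e, he⟩).ne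
      rw [hin₄.src ⟨e, he⟩, hin₄.dst ⟨e, he⟩]
      exact Fin.val_ne_of_ne this)
    -- The old priorities are sums over incident edges, so a nonzero cell belongs to an endpoint.
    (fun v hv => by
      rw [X₄.reals_eq rfl, X₃.reals_eq rfl, X₂.reals_eq rfl, hm₁.priority] at hv
      obtain ⟨e, he, hev⟩ := Finset.exists_ne_zero_of_sum_ne_zero hv
      refine ⟨e, Finset.mem_range.1 he, ?_⟩
      have : EndAt s₁ e v := by
        by_contra hc
        simp [hc] at hev
      simpa only [EndAt, X₄.ints_eq (a := 1) rfl, X₃.ints_eq (a := 1) rfl,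
        X₂.ints_eq (a := 1) rfl, X₄.ints_eq (a := 2) rfl, X₃.ints_eq (a := 2) rfl,
        X₂.ints_eq (a := 2) rfl] using this)
  have hw := weightAt_congr (s' := s₅) (s := s₄) (X₅.ints_eq rfl) (X₅.ints_eq rfl)
    (X₅.reals_eq rfl)
  refine ⟨u, s₅, _, M', .seq _ _ _ _ _ _ _ X₁ (.seq _ _ _ _ _ _ _ X₂ (.seq _ _ _ _ _ _ _ X₃
    (.seq _ _ _ _ _ _ _ X₄ X₅))), by omega, huU, fun v hv => ?_, hdyn, ?_, ?_, ?_⟩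
  · rw [weightedDegree_eq hm₁.input hm₁.edges hm₁.matching,
      weightedDegree_eq hm₁.input hm₁.edges hm₁.matching, ← hm₁.priority, ← hm₁.priority]
    exact hmin v hv
  · constructor
    · exact hin₄.of_eq (X₅.ints_eq rfl) (X₅.ints_eq rfl) (X₅.ints_eq rfl) (X₅.reals_eq rfl)
    · exact hL₃.of_eq (by rw [X₅.ints_eq rfl, X₄.ints_eq rfl])
        (by rw [X₅.ints_eq rfl, X₄.ints_eq rfl]) (by rw [X₅.ints_eq rfl, X₄.ints_eq rfl])
    · rw [X₅.ints_eq rfl, X₄.ints_eq rfl, h3, c₂, Finset.card_erase_of_mem huU]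
    · intro v
      rw [X₅.ints_eq rfl, X₄.ints_eq rfl, h4, X₂.ints_eq rfl]
      simp only [Function.update_apply, hm₁.vertices, Fin.val_inj, Finset.mem_erase]
      by_cases hvu : v = u <;> simp [hvu]
    · unfold StoresEdges
      rw [X₅.ints_eq rfl, X₄.ints_eq rfl]
      exact h5
    · rw [X₅.ints_eq rfl]; exact h6
    · simpa only [hw, EndAt, X₅.ints_eq (a := 1) rfl, X₅.ints_eq (a := 2) rfl] using h7
    · rw [hw]; exact h8
    · rw [X₅.ints_eq (a := 13) rfl, X₄.ints_eq (a := 13) rfl, X₃.ints_eq (a := 13) rfl,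
        X₂.ints_eq (a := 13) rfl, X₅.ints_eq (a := 14) rfl, X₄.ints_eq (a := 14) rfl,
        X₃.ints_eq (a := 14) rfl]
      exact hstack
  · have e22 : s₅.ints 22 = s₁.ints 22 := by
      rw [X₅.ints_eq rfl, X₄.ints_eq rfl, X₃.ints_eq rfl, X₂.ints_eq rfl]
    have e11 : s₅.ints 11 = s₁.ints 11 := by
      rw [X₅.ints_eq rfl, X₄.ints_eq rfl, X₃.ints_eq rfl, X₂.ints_eq rfl]
    have r3 : s₅.reals 3 = s₁.reals 3 := by
      rw [X₅.reals_eq rfl, X₄.reals_eq rfl, X₃.reals_eq rfl, X₂.reals_eq rfl]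
    unfold Recorded
    rw [e22, e11, r3]
    exact h₁
  · rw [X₅.ints_eq rfl, X₄.ints_eq rfl, h12, X₂.ints_eq rfl, X₁.ints_eq rfl, c₂]

end Program


/-! ### Adjacency matrix and wedges seen from an edge. -/

theorem EdgeList.le_sq {n m : ℕ} {G : SimpleGraph (Fin n)} (E : EdgeList G m) : m ≤ n * n := by
  have hinj : Function.Injective fun e : Fin m => (E.src e, E.dst e) := by
    intro e f hef
    simp only [Prod.mk.injEq] at hef
    exact E.injective (by simp only [hef.1, hef.2])
  simpa using Fintype.card_le_of_injective _ hinj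

theorem cell_injective {n : ℕ} {x y x' y' : Fin n}
    (h : (x : ℕ) * n + y = x' * n + y') : x = x' ∧ y = y' := by
  have hn : 0 < n := x.pos
  constructor
  · have := congrArg (· / n) h
    simpa [Nat.mul_comm _ n, Nat.mul_add_div hn, Nat.div_eq_of_lt, Fin.ext_iff] using this
  · have := congrArg (· % n) h
    simpa [Nat.mul_add_mod', Nat.mod_eq_of_lt, Fin.ext_iff] using this

/-- `A` holds the adjacency matrix, with the index of the edge plus one as the entry. -/
def StoresMatrix {n m : ℕ} {G : SimpleGraph (Fin n)} (E : EdgeList G m) (A : ℕ → ℕ) : Prop :=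
  ∀ x y : Fin n, (A (x * n + y) = 0 ∧ ¬ G.Adj x y) ∨
    ∃ e : Fin m, A (x * n + y) = e + 1 ∧ E.edge e = s(x, y)

theorem StoresMatrix.eq_zero {n m : ℕ} {G : SimpleGraph (Fin n)} {E : EdgeList G m} {A : ℕ → ℕ}
    (h : StoresMatrix E A) (x y : Fin n) : A (x * n + y) = 0 ↔ ¬ G.Adj x y := by
  rcases h x y with h | ⟨e, h, he⟩
  · simp [h]
  · have : G.Adj x y := by
      have := E.edge_mem e
      rwa [he] at this
    simp [h, this]

/-- The edge `f` forms a wedge with the edge `e`, and `v` is the endpoint of `f` that is not on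
`e`. -/
def WedgeAt {n m : ℕ} {G : SimpleGraph (Fin n)} (E : EdgeList G m) (e : Fin m) (v : Fin n)
    (f : Fin m) : Prop :=
  (G.Adj (E.src e) v ∧ ¬ G.Adj (E.dst e) v ∧ v ≠ E.dst e ∧ E.edge f = s(E.src e, v)) ∨
  (G.Adj (E.dst e) v ∧ ¬ G.Adj (E.src e) v ∧ v ≠ E.src e ∧ E.edge f = s(E.dst e, v))

/-- The third vertex of the wedge is adjacent to exactly one end of `e`, so it determines `f`. Hence
each vertex adds at most one entry to the list of `e`. -/
theorem wedgeGraph_adj_iff_wedgeAt {n m : ℕ} {G : SimpleGraph (Fin n)} (E : EdgeList G m)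
    (e f : Fin m) : (wedgeGraph G).Adj (E.edge e) (E.edge f) ↔ ∃ v, WedgeAt E e v f := by
  constructor
  · rintro ⟨x, y, z, ⟨h1, h2, h3, h4⟩, he, hf⟩
    refine ⟨z, ?_⟩
    rcases Sym2.eq_iff.1 he with ⟨hx, hy⟩ | ⟨hx, hy⟩
    · right
      rw [hx, hy]
      exact ⟨h2, h4, h3.symm, hf⟩
    · left
      rw [hx, hy]
      exact ⟨h2, h4, h3.symm, hf⟩
  · rintro ⟨v, ⟨h1, h2, h3, h4⟩ | ⟨h1, h2, h3, h4⟩⟩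
    · exact ⟨_, _, v, ⟨(E.adj e).symm, h1, h3.symm, h2⟩, Sym2.eq_swap, h4⟩
    · exact ⟨_, _, v, ⟨E.adj e, h1, h3.symm, h2⟩, rfl, h4⟩

namespace Program

open RAM

/-- Computes the adjacency matrix, marks the vertices that are on an edge and all edges. -/
def markEdges : Cmd :=
  forLoop 17 mVar
    (.seq (.setI 16 (.add (.mul (.get 1 (var 17)) nVar) (.get 2 (var 17)))
        (.add (var 17) (.const 1)))
      (.seq (.setI 16 (.add (.mul (.get 2 (var 17)) nVar) (.get 1 (var 17)))
        (.add (var 17) (.const 1)))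
      (.seq (.setI 15 (.get 1 (var 17)) (.const 1)) (.seq (.setI 15 (.get 2 (var 17)) (.const 1))
        (.setI 5 (var 17) (.const 1))))))

/-- Marks all vertices and collects those that are on no edge. -/
def markVertices : Cmd :=
  forLoop 17 nVar (.seq (.setI 4 (var 17) (.const 1))
    (.ite (.ieq (.get 15 (var 17)) (.const 0))
      (.seq (.setI 13 (var 14) (var 17)) (assign 14 (.add (var 14) (.const 1)))) .skip))

/-- Appends the edge with index `f - 1` to the list of the edge in variable 17. -/
def append (f : IExp) : Cmd :=
  .seq (.setI 9 (.add (.get 7 (var 17)) (.get 8 (var 17))) (.sub f (.const 1)))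
    (.setI 8 (var 17) (.add (.get 8 (var 17)) (.const 1)))

/-- The entry of the adjacency matrix for `x` and the vertex in variable 18. -/
abbrev entry (x : IExp) : IExp := .get 16 (.add (.mul x nVar) (var 18))

/-- The edge `xy` forms a wedge with the edge from `x` to the vertex in variable 18. -/
abbrev formsWedge (x y : IExp) : BExp :=
  .and (.not (.ieq (entry x) (.const 0)))
    (.and (.ieq (entry y) (.const 0)) (.not (.ieq (var 18) y)))

/-- Computes the adjacency list of the edge in variable 17. -/
def buildList : Cmd :=
  forLoop 18 nVar
    (.ite (formsWedge (.get 1 (var 17)) (.get 2 (var 17))) (append (entry (.get 1 (var 17))))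
      (.ite (formsWedge (.get 2 (var 17)) (.get 1 (var 17))) (append (entry (.get 2 (var 17))))
        .skip))

/-- Computes the adjacency lists of the wedge graph. -/
def buildLists : Cmd :=
  forLoop 17 mVar (.seq (.setI 7 (var 17) (.mul (var 17) nVar)) buildList)

def init : Cmd :=
  .seq markEdges (.seq markVertices (.seq buildLists (.seq initMatching
    (.seq (assign 3 nVar) computePriorities))))

/-- Computes the indicator of the best vertex set from the times of deletion. -/
def fin : Cmd :=
  forLoop 17 nVar (.ite (.ilt (var 22) (.get 12 (var 17))) (.setI 10 (var 17) (.const 0))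
    (.setI 10 (var 17) (.const 1)))

theorem runs_fin {W n : ℕ} {s : State} (hW : n < W) (hW1 : 1 < W) (hn : s.ints 0 0 = n) :
    Runs W fin s (n * 40 + 9) fun s' =>
      ∀ v < n, s'.ints 10 v = if s.ints 12 v ≤ s.ints 22 0 then 1 else 0 := by
  refine (Runs.forLoop_wp (N := n) (fun i s' =>
    ∀ v < i, s'.ints 10 v = if s.ints 12 v ≤ s.ints 22 0 then 1 else 0) hW rfl
    (fun s' hF => ?_) (by simp) ?_).mono
    (Nat.add_le_add (Nat.mul_le_mul_left _ (by decide)) (by decide)) fun _ h _ => h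
  · simp [IExp.eval, hF.ints (a := 0) rfl, hn]
  · intro i s' hi hF hI ha
    simp only [Cmd.wp, IExp.eval, BExp.Holds, ha, hF.ints (a := 12) rfl, hF.ints (a := 22) rfl,
      State.setI_ints_self, State.setI_ints_of_ne _ _ _ (show (10 : ℕ) ≠ 17 by decide)]
    refine ⟨fun h => ⟨by omega, fun e he => ?_⟩, fun h => ⟨hW1, fun e he => ?_⟩⟩
    all_goals
      rcases Nat.lt_succ_iff_lt_or_eq.1 he with he | rfl
      · rw [Function.update_of_ne (by omega), hI e he]
      · simp
        omega

/-! ### Correctness and cost of the initialization. -/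

section Init

variable {n m : ℕ} {G : SimpleGraph (Fin n)} {E : EdgeList G m} {lam : ℝ} {W : ℕ} {s : State}

/-- The matrix has `n * n` cells, but memory starts at zero, so only the two cells of each edge need
to be written. -/
theorem runs_markEdges (hmW : m < W) (hW1 : 1 < W) (hin : HasInput E lam s)
    (h16 : ∀ j, s.ints 16 j = 0) (h15 : ∀ j, s.ints 15 j = 0) :
    Runs W markEdges s (m * 100 + 9) fun s' => StoresMatrix E (s'.ints 16) ∧
      (∀ v : Fin n, s'.ints 15 v = 0 ↔ ∀ e, v ∉ E.edge e) ∧ StoresEdges E Finset.univ s' := by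
  refine (Runs.forLoop_wp (N := m) (fun i s' =>
    (∀ x y : Fin n, (s'.ints 16 (x * n + y) = 0 ∧ ∀ e : Fin m, (e : ℕ) < i → E.edge e ≠ s(x, y)) ∨
      ∃ e : Fin m, s'.ints 16 (x * n + y) = e + 1 ∧ E.edge e = s(x, y)) ∧
    (∀ v : Fin n, s'.ints 15 v = 0 ↔ ∀ e : Fin m, (e : ℕ) < i → v ∉ E.edge e) ∧
    ∀ e : Fin m, (e : ℕ) < i → s'.ints 5 e = 1) hmW rfl (fun s' hF => ?_) ?_ ?_).mono
    (Nat.add_le_add (Nat.mul_le_mul_left _ (by decide)) (by decide)) ?_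
  · simp [IExp.eval, hF.ints (a := 0) rfl, hin.m_eq]
  · simp [State.setI_ints_of_ne, h16, h15]
  · rintro i s' hi hF ⟨I1, I2, I3⟩ ha
    obtain ⟨e, rfl⟩ : ∃ e : Fin m, (e : ℕ) = i := ⟨⟨i, hi⟩, rfl⟩
    have hsrc : s'.ints 1 e = E.src e := by rw [hF.ints rfl, hin.src]
    have hdst : s'.ints 2 e = E.dst e := by rw [hF.ints rfl, hin.dst]
    have hn : s'.ints 0 0 = n := by rw [hF.ints rfl, hin.n_eq]
    simp only [Cmd.wp, IExp.eval, ha, hsrc, hdst, hn, State.setI_ints_self, State.setI_ints_of_ne,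
      ne_eq, OfNat.one_ne_ofNat, OfNat.zero_ne_ofNat,
      Nat.reduceEqDiff, not_false_eq_true, hW1, true_and]
    refine ⟨by omega, by omega, fun x y => ?_, fun v => ?_, fun f hf => ?_⟩
    · by_cases h1 : E.edge e = s(x, y)
      · refine Or.inr ⟨e, ?_, h1⟩
        rcases Sym2.eq_iff.1 h1 with ⟨rfl, rfl⟩ | ⟨rfl, rfl⟩
        · simp [Function.update_apply]
        · simp
      · rw [Function.update_of_ne, Function.update_of_ne]
        · rcases I1 x y with ⟨h0, h⟩ | h
          · refine Or.inl ⟨h0, fun f hf => ?_⟩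
            rcases Nat.lt_succ_iff_lt_or_eq.1 hf with hf | hf
            · exact h f hf
            · rwa [Fin.ext hf]
          · exact Or.inr h
        · intro hc
          obtain ⟨rfl, rfl⟩ := cell_injective hc
          exact h1 rfl
        · intro hc
          obtain ⟨rfl, rfl⟩ := cell_injective hc
          exact h1 Sym2.eq_swap
    · have : (∀ f : Fin m, (f : ℕ) < e + 1 → v ∉ E.edge f) ↔
          (∀ f : Fin m, (f : ℕ) < e → v ∉ E.edge f) ∧ v ∉ E.edge e := by
        constructor
        · exact fun h => ⟨fun f hf => h f (by omega), h e (by omega)⟩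
        · rintro ⟨h, h'⟩ f hf
          rcases Nat.lt_succ_iff_lt_or_eq.1 hf with hf | hf
          · exact h f hf
          · rwa [Fin.ext hf]
      rw [this, ← I2]
      simp only [Function.update_apply, Fin.val_inj, EdgeList.edge, Sym2.mem_iff]
      by_cases h1 : v = E.dst e <;> by_cases h2 : v = E.src e <;> simp [h1, h2]
    · rcases Nat.lt_succ_iff_lt_or_eq.1 hf with hf | hf
      · rw [Function.update_of_ne (by omega)]; exact I3 f hf
      · simp [hf]
  · rintro s' ⟨I1, I2, I3⟩ -
    refine ⟨fun x y => (I1 x y).imp_left fun h => ⟨h.1, fun hxy => ?_⟩, fun v => ?_, fun e => ?_⟩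
    · obtain ⟨e, he⟩ := E.exists_edge (e := s(x, y)) hxy
      exact h.2 e e.2 he
    · simpa using I2 v
    · simpa using I3 e e.2

theorem runs_markVertices (hnW : n < W) (hW1 : 1 < W) (hin : HasInput E lam s)
    (h14 : s.ints 14 0 = 0) (h15 : ∀ v : Fin n, s.ints 15 v = 0 ↔ ∀ e, v ∉ E.edge e) :
    Runs W markVertices s (n * 60 + 9) fun s' => (∀ v : Fin n, s'.ints 4 v = 1) ∧
      IsolatedStack E Finset.univ (s'.ints 14 0) (s'.ints 13) := by
  refine (Runs.forLoop_wp (N := n) (fun i s' => (∀ v < i, s'.ints 4 v = 1) ∧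
      s'.ints 14 0 ≤ i ∧
      IsolatedStack E (Finset.univ.filter fun v => (v : ℕ) < i) (s'.ints 14 0) (s'.ints 13))
      hnW rfl (fun s' hF => ?_) ?_ ?_).mono
    (Nat.add_le_add (Nat.mul_le_mul_left _ (by decide)) (by decide)) ?_
  · simp [IExp.eval, hF.ints (a := 0) rfl, hin.n_eq]
  · simp only [State.setI_ints_of_ne _ _ _ (show (14 : ℕ) ≠ 17 by decide), h14]
    exact ⟨by simp, le_rfl, by simp, by simp, by simp⟩
  · rintro i s' hi hF ⟨I1, I2, I3⟩ ha
    obtain ⟨v, rfl⟩ : ∃ v : Fin n, (v : ℕ) = i := ⟨⟨i, hi⟩, rfl⟩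
    have e15 : s'.ints 15 = s.ints 15 := hF.ints rfl
    simp only [Cmd.wp, IExp.eval, BExp.Holds, ha, e15, State.setI_ints_self,
      State.setI_ints_of_ne, ne_eq, Nat.reduceEqDiff, not_false_eq_true, hW1, true_and,
      Function.update_self]
    have h4 : ∀ w < (v : ℕ) + 1, Function.update (s'.ints 4) v 1 w = 1 := by
      intro w hw
      rcases Nat.lt_succ_iff_lt_or_eq.1 hw with hw | rfl
      · rw [Function.update_of_ne (by omega)]; exact I1 w hw
      · simp
    set k := s'.ints 14 0 with hk
    refine ⟨fun h => ⟨by omega, by omega, h4, by omega, ?_⟩, fun h => ⟨h4, by omega, ?_⟩⟩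
    · have hlt : ∀ j < k, s'.ints 13 j < v := by
        intro j hj
        obtain ⟨w, hw, hjw, -⟩ := I3.mem j hj
        rw [hjw]
        simpa using hw
      refine ⟨fun j hj => ?_, fun i hi j hj hij => ?_, fun w hw hiso => ?_⟩
      · rcases Nat.lt_succ_iff_lt_or_eq.1 hj with hj | rfl
        · obtain ⟨w, hw, hjw, hiso⟩ := I3.mem j hj
          refine ⟨w, ?_, by rw [Function.update_of_ne (by omega), hjw], hiso⟩
          simp only [Finset.mem_filter, Finset.mem_univ, true_and] at hw ⊢
          omega
        · exact ⟨v, by simp, by simp, (h15 v).1 h⟩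
      · rcases Nat.lt_succ_iff_lt_or_eq.1 hi with hi | rfl <;>
          rcases Nat.lt_succ_iff_lt_or_eq.1 hj with hj | rfl
        · rw [Function.update_of_ne (by omega), Function.update_of_ne (by omega)] at hij
          exact I3.inj i hi j hj hij
        · rw [Function.update_of_ne (by omega), Function.update_self] at hij
          have := hlt i hi
          omega
        · rw [Function.update_self, Function.update_of_ne (by omega)] at hij
          have := hlt j hj
          omega
        · rfl
      · simp only [Finset.mem_filter, Finset.mem_univ, true_and] at hw
        rcases Nat.lt_succ_iff_lt_or_eq.1 hw with hw | hw
        · obtain ⟨j, hj, hjw⟩ := I3.complete w (by simpa using hw) hiso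
          exact ⟨j, by omega, by rw [Function.update_of_ne (by omega), hjw]⟩
        · exact ⟨k, by omega, by simp [hw]⟩
    · refine ⟨fun j hj => ?_, I3.inj, fun w hw hiso => ?_⟩
      · obtain ⟨w, hw, hjw, hiso⟩ := I3.mem j hj
        refine ⟨w, ?_, hjw, hiso⟩
        simp only [Finset.mem_filter, Finset.mem_univ, true_and] at hw ⊢
        omega
      · refine I3.complete w ?_ hiso
        simp only [Finset.mem_filter, Finset.mem_univ, true_and] at hw ⊢
        rcases Nat.lt_succ_iff_lt_or_eq.1 hw with hw | hw
        · exact hw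
        · rw [Fin.ext hw] at hiso
          exact absurd ((h15 v).2 hiso) h
  · rintro s' ⟨I1, -, I3⟩ -
    exact ⟨fun v => I1 v v.2, by simpa using I3⟩

/-- The list of the edge `e` holds the edges that form a wedge with `e` through a vertex below
`k`. -/
structure ListAt (E : EdgeList G m) (s : State) (e : Fin m) (k : ℕ) : Prop where
  start : s.ints 7 e = e * n
  length : s.ints 8 e ≤ k
  entry : ∀ j < s.ints 8 e, s.ints 9 (e * n + j) < m
  mem : ∀ f : Fin m, (∃ v : Fin n, (v : ℕ) < k ∧ WedgeAt E e v f) ↔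
    ∃ j < s.ints 8 e, s.ints 9 (e * n + j) = f

theorem ListAt.of_eq {e : Fin m} {k : ℕ} {s s' : State} (h : ListAt E s e k)
    (h7 : s'.ints 7 e = s.ints 7 e) (h8 : s'.ints 8 e = s.ints 8 e)
    (h9 : ∀ j < s.ints 8 e, s'.ints 9 (e * n + j) = s.ints 9 (e * n + j)) : ListAt E s' e k where
  start := by rw [h7, h.start]
  length := by rw [h8]; exact h.length
  entry j hj := by rw [h8] at hj; rw [h9 j hj]; exact h.entry j hj
  mem f := by
    rw [h.mem, h8]
    exact exists_congr fun j => and_congr_right fun hj => by rw [h9 j hj]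

theorem ListAt.append {e : Fin m} {v : Fin n} {s s' : State} (h : ListAt E s e v) {f : Fin m}
    (hf : ∀ g, WedgeAt E e v g ↔ g = f) (h7 : s'.ints 7 = s.ints 7)
    (h8 : s'.ints 8 = Function.update (s.ints 8) e (s.ints 8 e + 1))
    (h9 : s'.ints 9 = Function.update (s.ints 9) (e * n + s.ints 8 e) f) :
    ListAt E s' e (v + 1) where
  start := by rw [h7, h.start]
  length := by have := h.length; rw [h8]; simpa using this
  entry j hj := by
    rw [h8, Function.update_self] at hj
    rw [h9]
    rcases Nat.lt_succ_iff_lt_or_eq.1 hj with hj | rfl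
    · rw [Function.update_of_ne (by omega)]; exact h.entry j hj
    · simp
  mem g := by
    rw [h8, h9, Function.update_self]
    have h1 : (∃ w : Fin n, (w : ℕ) < v + 1 ∧ WedgeAt E e w g) ↔
        (∃ w : Fin n, (w : ℕ) < v ∧ WedgeAt E e w g) ∨ g = f := by
      rw [← hf]
      constructor
      · rintro ⟨w, hw, hg⟩
        rcases Nat.lt_succ_iff_lt_or_eq.1 hw with hw | hw
        · exact Or.inl ⟨w, hw, hg⟩
        · obtain rfl := Fin.ext hw
          exact Or.inr hg
      · rintro (⟨w, hw, hg⟩ | hg)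
        · exact ⟨w, by omega, hg⟩
        · exact ⟨v, by omega, hg⟩
    rw [h1, h.mem]
    constructor
    · rintro (⟨j, hj, hjg⟩ | rfl)
      · exact ⟨j, by omega, by rw [Function.update_of_ne (by omega), hjg]⟩
      · exact ⟨s.ints 8 e, by omega, by simp⟩
    · rintro ⟨j, hj, hjg⟩
      rcases Nat.lt_succ_iff_lt_or_eq.1 hj with hj | rfl
      · rw [Function.update_of_ne (by omega)] at hjg
        exact Or.inl ⟨j, hj, hjg⟩
      · simp only [Function.update_self] at hjg
        exact Or.inr (Fin.ext hjg.symm)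

theorem ListAt.skip {e : Fin m} {v : Fin n} {s s' : State} (h : ListAt E s e v)
    (hf : ∀ g, ¬ WedgeAt E e v g) (h7 : s'.ints 7 = s.ints 7)
    (h8 : s'.ints 8 = s.ints 8) (h9 : s'.ints 9 = s.ints 9) : ListAt E s' e (v + 1) where
  start := by rw [h7, h.start]
  length := by have := h.length; rw [h8]; omega
  entry := by rw [h8, h9]; exact h.entry
  mem g := by
    rw [h8, h9, ← h.mem]
    constructor
    · rintro ⟨w, hw, hg⟩
      rcases Nat.lt_succ_iff_lt_or_eq.1 hw with hw | hw
      · exact ⟨w, hw, hg⟩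
      · obtain rfl := Fin.ext hw
        exact absurd hg (hf g)
    · rintro ⟨w, hw, hg⟩
      exact ⟨w, by omega, hg⟩

/-- The list of `e` starts at `e * n` in array 9. The last conclusion, that cells before this block
are untouched, protects the lists built earlier. -/
theorem runs_buildList (hmW : m < W) (hnW : n < W) (hin : HasInput E lam s)
    (hA : StoresMatrix E (s.ints 16)) {e : Fin m} (he : s.ints 17 0 = e)
    (h7 : s.ints 7 e = e * n) (h8 : s.ints 8 e = 0) :
    Runs W buildList s (n * 150 + 9) fun s' => ListAt E s' e n ∧
      (∀ j ≠ (e : ℕ), s'.ints 8 j = s.ints 8 j) ∧ ∀ j < e * n, s'.ints 9 j = s.ints 9 j := by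
  refine (Runs.forLoop_wp (N := n) (fun i s' => ListAt E s' e i ∧
      (∀ j ≠ (e : ℕ), s'.ints 8 j = s.ints 8 j) ∧ ∀ j < e * n, s'.ints 9 j = s.ints 9 j)
      hnW rfl (fun s' hF => ?_) ?_ ?_).mono
    (Nat.add_le_add (Nat.mul_le_mul_left _ (by decide)) (by decide)) fun _ h _ => h
  · simp [IExp.eval, hF.ints (a := 0) rfl, hin.n_eq]
  · simp only [State.setI_ints_of_ne _ _ _ (show (8 : ℕ) ≠ 18 by decide),
      State.setI_ints_of_ne _ _ _ (show (9 : ℕ) ≠ 18 by decide), implies_true, and_true]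
    constructor <;> simp [State.setI_ints_of_ne, h7, h8]
  · rintro i s' hi hF ⟨hl, h8', h9'⟩ ha
    obtain ⟨v, rfl⟩ : ∃ v : Fin n, (v : ℕ) = i := ⟨⟨i, hi⟩, rfl⟩
    have hsrc : s'.ints 1 e = E.src e := by rw [hF.ints rfl, hin.src]
    have hdst : s'.ints 2 e = E.dst e := by rw [hF.ints rfl, hin.dst]
    have hn : s'.ints 0 0 = n := by rw [hF.ints rfl, hin.n_eq]
    have h17 : s'.ints 17 0 = e := by rw [hF.ints rfl, he]
    have h16 : s'.ints 16 = s.ints 16 := hF.ints rfl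
    have hlen := hl.length
    -- Both appending branches in one: `x` is the end of `e` that is shared with the new edge.
    have happ : ∀ x : Fin n, G.Adj x v → (∀ g : Fin m, WedgeAt E e v g ↔ E.edge g = s(x, v)) →
        s.ints 16 (x * n + v) - 1 < W ∧ s'.ints 8 e + 1 < W ∧ ∀ s'' : State,
          s''.ints 7 = s'.ints 7 →
          s''.ints 8 = Function.update (s'.ints 8) e (s'.ints 8 e + 1) →
          s''.ints 9 = Function.update (s'.ints 9) (s'.ints 7 e + s'.ints 8 e)
            (s.ints 16 (x * n + v) - 1) →
          ListAt E s'' e (v + 1) ∧ (∀ j ≠ (e : ℕ), s''.ints 8 j = s.ints 8 j) ∧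
            ∀ j < e * n, s''.ints 9 j = s.ints 9 j := by
      intro x hxv hg
      rcases hA x v with ⟨-, hc⟩ | ⟨f, hf, hfe⟩
      · exact absurd hxv hc
      have hfm := f.2
      refine ⟨by omega, by omega, fun s'' k7 k8 k9 => ⟨hl.append (f := f) (fun g => ?_) k7 k8 ?_,
        fun j hj => ?_, fun j hj => ?_⟩⟩
      · rw [hg, ← hfe, E.edge_injective.eq_iff]
      · rw [k9, hl.start, hf, Nat.add_sub_cancel]
      · rw [k8, Function.update_of_ne hj, h8' j hj]
      · rw [k9, hl.start, Function.update_of_ne (by omega), h9' j hj]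
    simp only [Cmd.wp, STC.Program.append, IExp.eval, BExp.Holds, ha, h17, hsrc, hdst, hn, h16,
      hA.eq_zero, Fin.val_inj, not_not, State.setI_ints_self, State.setI_ints_of_ne, ne_eq,
      Nat.reduceEqDiff, not_false_eq_true]
    refine ⟨fun h => ?_, fun h => ⟨fun h' => ?_, fun h' => ?_⟩⟩
    · obtain ⟨a1, a2, a3⟩ := happ (E.src e) h.1 fun g => by
        simp [WedgeAt, h.1, h.2.1, h.2.2]
      exact ⟨a1, a2, a3 _ (by simp [State.setI_ints_of_ne]) (by simp [State.setI_ints_of_ne])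
        (by simp [State.setI_ints_of_ne])⟩
    · obtain ⟨a1, a2, a3⟩ := happ (E.dst e) h'.1 fun g => by
        simp [WedgeAt, h'.1, h'.2.1, h'.2.2]
      exact ⟨a1, a2, a3 _ (by simp [State.setI_ints_of_ne]) (by simp [State.setI_ints_of_ne])
        (by simp [State.setI_ints_of_ne])⟩
    · refine ⟨hl.skip (fun g hg => ?_) (State.setI_ints_of_ne _ _ _ (by decide))
        (State.setI_ints_of_ne _ _ _ (by decide)) (State.setI_ints_of_ne _ _ _ (by decide)),
        h8', h9'⟩
      rcases hg with hg | hg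
      · exact h ⟨hg.1, hg.2.1, hg.2.2.1⟩
      · exact h' ⟨hg.1, hg.2.1, hg.2.2.1⟩

theorem runs_buildLists (hmW : m < W) (hnW : n < W) (hmnW : m * n < W) (hin : HasInput E lam s)
    (hA : StoresMatrix E (s.ints 16)) (h8 : ∀ j, s.ints 8 j = 0) :
    Runs W buildLists s (m * (n * 150 + 50) + 9) fun s' => WedgeLists E s' := by
  refine (Runs.forLoop_const (N := m) (fun i s' => (∀ e : Fin m, (e : ℕ) < i → ListAt E s' e n) ∧
      ∀ j, i ≤ j → s'.ints 8 j = 0) (n * 150 + 20) hmW rfl (fun s' hF => ?_) ?_ ?_).mono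
    (Nat.add_le_add (Nat.mul_le_mul_left _ (by simp only [IExp.cost]; omega)) (by decide)) ?_
  · simp [IExp.eval, hF.ints (a := 0) rfl, hin.m_eq]
  · simp [State.setI_ints_of_ne, h8]
  · rintro i s' hi hF ⟨hl, h0⟩ ha
    obtain ⟨e, rfl⟩ : ∃ e : Fin m, (e : ℕ) = i := ⟨⟨i, hi⟩, rfl⟩
    have hin' : HasInput E lam s' :=
      hin.of_eq (hF.ints rfl) (hF.ints rfl) (hF.ints rfl) (hF.reals rfl)
    refine (Runs.seq (T := 8) (T' := n * 150 + 9)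
      (.of_wp (Q := fun s'' => s'' = s'.setI 7 e (e * n)) ?_) ?_).mono (by omega) fun _ h _ => h
    · simp only [Cmd.wp, IExp.eval, ha, hin'.n_eq, and_true]
      exact (Nat.mul_le_mul_right n e.2.le).trans_lt hmnW
    rintro _ rfl F₁
    refine (runs_buildList (e := e) hmW hnW (hin'.of_eq (F₁.ints rfl) (F₁.ints rfl)
      (F₁.ints rfl) (F₁.reals rfl)) ?_ ?_ (by simp) ?_).mono le_rfl ?_
    · rw [F₁.ints rfl, hF.ints rfl]; exact hA
    · rw [F₁.ints rfl, ha]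
    · rw [F₁.ints rfl]; exact h0 e le_rfl
    · rintro s₂ ⟨hle, k8, k9⟩ F₂
      rw [F₁.ints (a := 8) rfl] at k8
      rw [F₁.ints (a := 9) rfl] at k9
      refine ⟨fun f hf => ListAt.of_eq (s := s₂) ?_
        (by rw [State.setI_ints_of_ne _ _ _ (by decide)])
        (by rw [State.setI_ints_of_ne _ _ _ (by decide)])
        (fun j _ => by rw [State.setI_ints_of_ne _ _ _ (by decide)]), fun j hj => ?_⟩
      · rcases Nat.lt_succ_iff_lt_or_eq.1 hf with hf | hf
        · have hlf := hl f hf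
          refine hlf.of_eq ?_ (k8 f (by omega)) fun j hj => k9 _ ?_
          · rw [F₂.ints rfl, State.setI_ints_self, Function.update_of_ne (by omega)]
          -- For `f < e`, the block of `f` ends no later than the block of `e` begins.
          · have h1 : ((f : ℕ) + 1) * n ≤ e * n := Nat.mul_le_mul_right n hf
            have h2 := hlf.length
            rw [Nat.add_mul] at h1
            omega
        · rwa [Fin.ext hf]
      · rw [State.setI_ints_of_ne _ _ _ (by decide), k8 j (by omega)]
        exact h0 j (by omega)
  · rintro s' ⟨hl, -⟩ -
    constructor
    · exact fun e => (hl e e.2).length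
    · intro e j hj
      rw [(hl e e.2).start]
      exact (hl e e.2).entry j hj
    · intro e f
      rw [wedgeGraph_adj_iff_wedgeAt, (hl e e.2).start, ← (hl e e.2).mem]
      simp

theorem exec_init (hmW : m < W) (hnW : n < W) (hmnW : m * n < W) (hW1 : 1 < W)
    (E : EdgeList G m) (lam : ℝ) :
    ∃ s' t M, Exec W init (inputState E lam) s' t ∧ t ≤ m * (n * 210 + 380) + n * 60 + 100 ∧
      AprMatching (wedgeGraph G) M ∧ Maintains E lam Finset.univ M s' ∧
      s'.ints 22 0 = 0 ∧ s'.reals 3 0 = 0 := by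
  have hin : HasInput E lam (inputState E lam) := by
    constructor <;> simp [inputState]
  obtain ⟨s₁, t₁, X₁, ht₁, hA, h15, h5⟩ := runs_markEdges hmW hW1 hin
    (by simp [inputState]) (by simp [inputState])
  have hin₁ : HasInput E lam s₁ := hin.of_eq (X₁.ints_eq rfl) (X₁.ints_eq rfl)
    (X₁.ints_eq rfl) (X₁.reals_eq rfl)
  obtain ⟨s₂, t₂, X₂, ht₂, h4, hstack⟩ := runs_markVertices hnW hW1 hin₁
    (by rw [X₁.ints_eq rfl]; simp [inputState]) h15
  have hin₂ : HasInput E lam s₂ := hin₁.of_eq (X₂.ints_eq rfl) (X₂.ints_eq rfl)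
    (X₂.ints_eq rfl) (X₂.reals_eq rfl)
  obtain ⟨s₃, t₃, X₃, ht₃, hL⟩ := runs_buildLists hmW hnW hmnW hin₂
    (by rw [X₂.ints_eq rfl]; exact hA)
    (by rw [X₂.ints_eq rfl, X₁.ints_eq rfl]; simp [inputState])
  have hin₃ : HasInput E lam s₃ := hin₂.of_eq (X₃.ints_eq rfl) (X₃.ints_eq rfl)
    (X₃.ints_eq rfl) (X₃.reals_eq rfl)
  have h5₃ : StoresEdges E Finset.univ s₃ := by
    unfold StoresEdges; rw [X₃.ints_eq rfl, X₂.ints_eq rfl]; exact h5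
  obtain ⟨s₄, t₄, X₄, ht₄, M, hM, h6⟩ := runs_initMatching hmW hnW hin₃ hL h5₃
    (by rw [X₃.ints_eq rfl, X₂.ints_eq rfl, X₁.ints_eq rfl]; simp [inputState])
  have hin₄ : HasInput E lam s₄ := hin₃.of_eq (X₄.ints_eq rfl) (X₄.ints_eq rfl)
    (X₄.ints_eq rfl) (X₄.reals_eq rfl)
  obtain ⟨s₅, t₅, X₅, ht₅, h3⟩ : Runs W (assign 3 nVar) s₄ 4 fun s' => s'.ints 3 0 = n :=
    .of_wp (by simpa [Cmd.wp, IExp.eval, hin₄.n_eq] using hnW)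
  have hin₅ : HasInput E lam s₅ := hin₄.of_eq (X₅.ints_eq rfl) (X₅.ints_eq rfl)
    (X₅.ints_eq rfl) (X₅.reals_eq rfl)
  obtain ⟨s₆, t₆, X₆, ht₆, h7, h8⟩ := runs_computePriorities hmW hin₅.m_eq
    (fun e he => by
      have := (E.adj ⟨e, he⟩).ne
      rw [hin₅.src ⟨e, he⟩, hin₅.dst ⟨e, he⟩]
      exact Fin.val_ne_of_ne this)
    (fun v hv => by
      rw [X₅.reals_eq rfl, X₄.reals_eq rfl, X₃.reals_eq rfl, X₂.reals_eq rfl,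
        X₁.reals_eq rfl] at hv
      simp [inputState] at hv)
  have hw := weightAt_congr (s' := s₆) (s := s₅) (X₆.ints_eq rfl) (X₆.ints_eq rfl)
    (X₆.reals_eq rfl)
  refine ⟨s₆, _, M, .seq _ _ _ _ _ _ _ X₁ (.seq _ _ _ _ _ _ _ X₂ (.seq _ _ _ _ _ _ _ X₃
    (.seq _ _ _ _ _ _ _ X₄ (.seq _ _ _ _ _ _ _ X₅ X₆)))), ?_, hM, ?_, ?_, ?_⟩
  -- The wedge lists, the initial matching, and 100 + 130 for marking edges and computing
  -- priorities.
  · have : m * (n * 210 + 380) = m * (n * 150 + 50) + m * (n * 60 + 100) + m * 230 := by ring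
    omega
  · constructor
    · exact hin₅.of_eq (X₆.ints_eq rfl) (X₆.ints_eq rfl) (X₆.ints_eq rfl) (X₆.reals_eq rfl)
    · exact hL.of_eq (by rw [X₆.ints_eq rfl, X₅.ints_eq rfl, X₄.ints_eq rfl])
        (by rw [X₆.ints_eq rfl, X₅.ints_eq rfl, X₄.ints_eq rfl])
        (by rw [X₆.ints_eq rfl, X₅.ints_eq rfl, X₄.ints_eq rfl])
    · rw [X₆.ints_eq rfl, h3]; simp
    · rw [X₆.ints_eq rfl, X₅.ints_eq rfl, X₄.ints_eq rfl, X₃.ints_eq rfl]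
      simpa using h4
    · unfold StoresEdges
      rw [X₆.ints_eq rfl, X₅.ints_eq rfl, X₄.ints_eq rfl]
      exact h5₃
    · rw [X₆.ints_eq rfl, X₅.ints_eq rfl]; exact h6
    · simpa only [hw, EndAt, X₆.ints_eq (a := 1) rfl, X₆.ints_eq (a := 2) rfl] using h7
    · rw [hw]; exact h8
    · rw [X₆.ints_eq (a := 13) rfl, X₅.ints_eq (a := 13) rfl, X₄.ints_eq (a := 13) rfl,
        X₃.ints_eq (a := 13) rfl, X₆.ints_eq (a := 14) rfl, X₅.ints_eq (a := 14) rfl,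
        X₄.ints_eq (a := 14) rfl, X₃.ints_eq (a := 14) rfl]
      exact hstack
  · rw [X₆.ints_eq rfl, X₅.ints_eq rfl, X₄.ints_eq rfl, X₃.ints_eq rfl, X₂.ints_eq rfl,
      X₁.ints_eq rfl]
    simp [inputState]
  · rw [X₆.reals_eq rfl, X₅.reals_eq rfl, X₄.reals_eq rfl, X₃.reals_eq rfl, X₂.reals_eq rfl,
      X₁.reals_eq rfl]
    simp [inputState]

end Init

end Program


/-! ## The run of the program -/

/-- Dependent choice for finitely many steps; where the hypotheses fail, the chosen step stays put.
-/
theorem exists_seq_of_step {X : Type*} {P : ℕ → X → Prop} {R : ℕ → X → X → Prop} {N : ℕ} {x₀ : X}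
    (h0 : P 0 x₀) (hs : ∀ i < N, ∀ x, P i x → ∃ y, P (i + 1) y ∧ R i x y) :
    ∃ f : ℕ → X, f 0 = x₀ ∧ (∀ i ≤ N, P i (f i)) ∧ ∀ i < N, R i (f i) (f (i + 1)) := by
  classical
  have hs' : ∀ i x, ∃ y, i < N → P i x → P (i + 1) y ∧ R i x y := by
    intro i x
    by_cases h : i < N ∧ P i x
    · obtain ⟨y, hy⟩ := hs i h.1 x h.2
      exact ⟨y, fun _ _ => hy⟩
    · exact ⟨x, fun h1 h2 => absurd ⟨h1, h2⟩ h⟩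
  choose g hg using hs'
  let f : ℕ → X := fun i => Nat.rec x₀ g i
  have hP : ∀ i ≤ N, P i (f i) := by
    intro i
    induction i with
    | zero => exact fun _ => h0
    | succ i ih => exact fun hi => (hg i (f i) hi (ih (by omega))).1
  exact ⟨f, rfl, hP, fun i hi => (hg i (f i) hi (hP i hi.le)).2⟩

theorem sum_degree_le {n m : ℕ} {G : SimpleGraph (Fin n)} (E : EdgeList G m) :
    ∑ v : Fin n, (Finset.univ.filter fun e => v ∈ E.edge e).card ≤ 2 * m := by
  simp only [Finset.card_filter]
  rw [Finset.sum_comm]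
  calc ∑ e : Fin m, ∑ v : Fin n, (if v ∈ E.edge e then 1 else 0)
      ≤ ∑ e : Fin m, ∑ v : Fin n,
        ((if v = E.src e then 1 else 0) + if v = E.dst e then 1 else 0) := by
        refine Finset.sum_le_sum fun e _ => Finset.sum_le_sum fun v _ => ?_
        simp only [EdgeList.edge, Sym2.mem_iff]
        split_ifs <;> simp_all
    _ = 2 * m := by simp [Finset.sum_add_distrib]; ring

/-- A pass of the main loop: the vertex set, the matching, the memory, the vertex deleted last and
the time of the pass. -/
structure Pass (n : ℕ) where
  U : Finset (Fin n)
  M : Set (Sym2 (Sym2 (Fin n)))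
  s : RAM.State
  u : Fin n
  t : ℕ

section Assembly

variable {n m : ℕ} {G : SimpleGraph (Fin n)} {E : EdgeList G m} {lam : ℝ} {W : ℕ}

/-- What holds after `i` passes. -/
structure Pass.Valid (E : EdgeList G m) (lam : ℝ) (i : ℕ) (x : Pass n) : Prop where
  maintains : Maintains E lam x.U x.M x.s
  maximal : IsMaximalMatching (wedgeGraph (restrict G x.U)) x.M
  card : x.U.card + i = n

/-- The pass from `x` to `y`. -/
structure Pass.Step (W : ℕ) (E : EdgeList G m) (lam : ℝ) (x y : Pass n) : Prop where
  mem : y.u ∈ x.U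
  argmin : ∀ v ∈ x.U, weightedDegree G lam x.U (weakEdges x.M) y.u ≤
    weightedDegree G lam x.U (weakEdges x.M) v
  delete : y.U = x.U.erase y.u
  relabel : DynamicVertexCover (wedgeGraph (restrict G y.U))
    ((restrict G x.U).incidenceSet y.u) x.M y.M
  exec : RAM.Exec W Program.body x.s y.s y.t
  time : y.t ≤ m * 370 + (Finset.univ.filter fun e => y.u ∈ E.edge e).card * (n * 60 + 100) + 200
  recorded : Program.Recorded m x.s y.s
  deletionTime : y.s.ints 12 = Function.update (x.s.ints 12) y.u x.U.card

theorem Pass.Valid.exists_step (hlam : 0 ≤ lam) (hmW : m < W) (hnW : n < W) (hW1 : 1 < W) {i : ℕ}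
    (hi : i < n) {x : Pass n} (h : x.Valid E lam i) :
    ∃ y : Pass n, y.Valid E lam (i + 1) ∧ x.Step W E lam y := by
  have hne : x.U.Nonempty := Finset.card_pos.1 (by have := h.card; omega)
  obtain ⟨u, s', t, M', hX, ht, hu, hmin, hdyn, hm, hrec, h12⟩ :=
    Program.exec_body hlam hmW hnW hW1 h.maintains h.maximal.1 hne
  refine ⟨⟨x.U.erase u, M', s', u, t⟩, ⟨hm, ?_, ?_⟩, ⟨hu, hmin, rfl, hdyn, hX, ht, hrec, h12⟩⟩
  · exact hdyn.isMaximalMatching (wedgeGraph_erase_adj G x.U u) h.maximal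
  · have := h.card
    have := Finset.card_erase_of_mem hu
    simp only
    omega

/-- Each test of the main loop costs 5, including the last one, which fails. The times are exact
because one exact halting time of the whole program is needed. -/
theorem exec_loop {σ : ℕ → RAM.State} {t : ℕ → ℕ} {p : RAM.Cmd}
    (hp : ∀ i < n, RAM.Exec W p (σ i) (σ (i + 1)) (t i)) (hc : ∀ i ≤ n, (σ i).ints 3 0 = n - i)
    (d : ℕ) : ∀ i, i + d = n → RAM.Exec W (.loop (.ilt (.const 0) (.get 3 (.const 0))) p) (σ i)
      (σ n) (∑ j ∈ Finset.Ico i n, (t j + 5) + 5) := by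
  induction d with
  | zero =>
    rintro i rfl
    rw [Nat.add_zero, Finset.Ico_self, Finset.sum_empty]
    refine RAM.Exec.loopFalse _ _ _ ?_
    simp [RAM.BExp.Holds, RAM.IExp.eval, hc]
  | succ d ih =>
    intro i hi
    have hin : i < n := by omega
    have := RAM.Exec.loopTrue (.ilt (.const 0) (.get 3 (.const 0))) p _ _ _ _ _
      (by simp only [RAM.BExp.Holds, RAM.IExp.eval, hc i hin.le]; omega) (hp i hin)
      (ih (i + 1) (by omega))
    rw [Finset.sum_eq_sum_Ico_succ_bot hin]
    convert this using 1
    simp only [RAM.BExp.cost, RAM.IExp.cost]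
    omega

variable {x : ℕ → Pass n}

theorem passes_subset (hs : ∀ i < n, (x i).Step W E lam (x (i + 1))) {i j : ℕ} (hij : j ≤ i)
    (hi : i ≤ n) : (x i).U ⊆ (x j).U := by
  induction i, hij using Nat.le_induction with
  | base => exact subset_rfl
  | succ i hij ih =>
    rw [(hs i hi).delete]
    exact (Finset.erase_subset _ _).trans (ih (by omega))

/-- Array 12 stores the size of the vertex set just before `v` is deleted. Sizes drop by one per
pass, so comparing this number with the size of an earlier set tells whether `v` belonged to it. -/
theorem passes_deletionTime (hv : ∀ i ≤ n, (x i).Valid E lam i)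
    (hs : ∀ i < n, (x i).Step W E lam (x (i + 1))) (i : ℕ) (hi : i ≤ n) :
    ∀ j ≤ i, ∀ v ∉ (x i).U, (v ∈ (x j).U ↔ (x i).s.ints 12 v ≤ (x j).U.card) := by
  induction i with
  | zero =>
    intro j _ v hv'
    have h1 : (x 0).U.card = n := (hv 0 (by omega)).card
    have : (x 0).U = Finset.univ := by
      rw [← Finset.card_eq_iff_eq_univ, h1, Fintype.card_fin]
    simp [this] at hv'
  | succ i ih =>
    intro j hj v hv'
    have hstep := hs i hi
    have hci := (hv i (by omega)).card
    have hci' := (hv (i + 1) hi).card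
    have hcj := (hv j (by omega)).card
    rw [hstep.deletionTime, Function.update_apply]
    by_cases hvu : v = (x (i + 1)).u
    · rw [if_pos (by rw [hvu])]
      rcases Nat.lt_succ_iff_lt_or_eq.1 (Nat.lt_succ_of_le hj) with hj | rfl
      · have : v ∈ (x j).U := passes_subset hs (by omega) (by omega) (hvu ▸ hstep.mem)
        simp only [this, true_iff]
        omega
      · simp only [hv', false_iff]
        omega
    · rw [if_neg fun h => hvu (Fin.ext h)]
      have hvi : v ∉ (x i).U := by
        rw [hstep.delete] at hv'
        simpa [hvu] using hv'
      rcases Nat.lt_succ_iff_lt_or_eq.1 (Nat.lt_succ_of_le hj) with hj | rfl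
      · exact ih (by omega) j (by omega) v hvi
      · have := ih (by omega) i le_rfl v hvi
        simp only [hvi, false_iff, not_le] at this
        simp only [hv', false_iff]
        omega

theorem Pass.Valid.score_eq {i : ℕ} {y : Pass n} (h : y.Valid E lam i) :
    score G lam y.U (weakEdges y.M) = y.s.reals 2 0 / (y.U.card : ℝ) := by
  rw [score, total_weight_eq h.maintains.input h.maintains.edges h.maintains.matching,
    h.maintains.total]

/-- The stored best total and size start at 0, and a tie counts as an improvement, so the first pass
always records. From then on both sizes are positive and cross-multiplication is the comparison of
scores. -/
theorem passes_best (hv : ∀ i ≤ n, (x i).Valid E lam i)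
    (hs : ∀ i < n, (x i).Step W E lam (x (i + 1))) (h22 : (x 0).s.ints 22 0 = 0)
    (h3 : (x 0).s.reals 3 0 = 0) (i : ℕ) (hi : i < n) :
    ∃ j ≤ i, (x (i + 1)).s.ints 22 0 = (x j).U.card ∧
      (x (i + 1)).s.reals 3 0 = (x j).s.reals 2 0 ∧
      (∀ e < m, (x (i + 1)).s.ints 11 e = if (x j).s.ints 6 e = 0 then 0 else 1) ∧
      ∀ k ≤ i, score G lam (x k).U (weakEdges (x k).M) ≤ score G lam (x j).U (weakEdges (x j).M) := by
  induction i with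
  | zero =>
    rcases (hs 0 hi).recorded with ⟨-, h1, h2, h3'⟩ | ⟨hlt, -⟩
    · refine ⟨0, le_rfl, by rw [h1, (hv 0 (by omega)).maintains.count], h2, h3', fun k hk => ?_⟩
      rw [Nat.le_zero.1 hk]
    · rw [h22, h3] at hlt
      simp at hlt
  | succ i ih =>
    obtain ⟨j, hj, h1, h2, h3', hbest⟩ := ih (by omega)
    have hvj := hv j (by omega)
    have hvi := hv (i + 1) (by omega)
    have hcj : (0 : ℝ) < (x j).U.card := by
      have := hvj.card
      exact_mod_cast (by omega : 0 < (x j).U.card)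
    have hci : (0 : ℝ) < (x (i + 1)).U.card := by
      have := hvi.card
      exact_mod_cast (by omega : 0 < (x (i + 1)).U.card)
    rcases (hs (i + 1) hi).recorded with ⟨hle, k1, k2, k3⟩ | ⟨hlt, k1, k2, k3⟩
    · rw [h1, h2, hvi.maintains.count] at hle
      refine ⟨i + 1, le_rfl, by rw [k1, hvi.maintains.count], k2, k3, fun k hk => ?_⟩
      rcases Nat.lt_succ_iff_lt_or_eq.1 (Nat.lt_succ_of_le hk) with hk | rfl
      · refine (hbest k (by omega)).trans ?_
        rw [hvj.score_eq, hvi.score_eq, div_le_div_iff₀ hcj hci]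
        exact hle
      · exact le_rfl
    · rw [h1, h2, hvi.maintains.count] at hlt
      refine ⟨j, by omega, by rw [k1, h1], by rw [k2, h2], fun e he => by rw [k3 e he, h3' e he],
        fun k hk => ?_⟩
      rcases Nat.lt_succ_iff_lt_or_eq.1 (Nat.lt_succ_of_le hk) with hk | rfl
      · exact hbest k (by omega)
      · rw [hvj.score_eq, hvi.score_eq, div_le_div_iff₀ hci hcj]
        exact hlt.le

/-- Telescoping: the degrees of the deleted vertices and of the remaining ones always add up to the
initial sum. -/
theorem passes_sum_degree (hs : ∀ i < n, (x i).Step W E lam (x (i + 1))) :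
    ∑ i ∈ Finset.range n, (Finset.univ.filter fun e => (x (i + 1)).u ∈ E.edge e).card ≤ 2 * m := by
  set d : Fin n → ℕ := fun v => (Finset.univ.filter fun e => v ∈ E.edge e).card with hd
  have key : ∀ k ≤ n, ∑ i ∈ Finset.range k, d (x (i + 1)).u + ∑ v ∈ (x k).U, d v =
      ∑ v ∈ (x 0).U, d v := by
    intro k
    induction k with
    | zero => simp
    | succ k ih =>
      intro hk
      rw [Finset.sum_range_succ, ← ih (by omega), (hs k hk).delete, add_assoc,
        Finset.add_sum_erase _ _ (hs k hk).mem]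
  calc ∑ i ∈ Finset.range n, d (x (i + 1)).u ≤ ∑ v ∈ (x 0).U, d v := by
        rw [← key n le_rfl]; omega
    _ ≤ ∑ v, d v := Finset.sum_le_sum_of_subset (Finset.subset_univ _)
    _ ≤ 2 * m := sum_degree_le E

end Assembly

theorem exists_carriesOutGreedy {n m : ℕ} (G : SimpleGraph (Fin n)) (E : EdgeList G m) (lam : ℝ)
    (hm : 1 ≤ m) (hlam : 0 ≤ lam) :
    ∃ T : ℕ, CarriesOutGreedy ((n + 2) ^ 3) Program.init Program.body Program.fin E lam T ∧
      T ≤ 2000 * (m * n) := by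
  set W := (n + 2) ^ 3 with hW
  have hsq := E.le_sq
  have hn : 0 < n := (E.src ⟨0, hm⟩).pos
  -- The largest numbers to be stored are list starts, below `m * n ≤ n ^ 3`; this dictates the
  -- exponent 3.
  have hcube : n * n * n < W := by rw [hW]; nlinarith
  have hmnW : m * n < W := (Nat.mul_le_mul_right n hsq).trans_lt hcube
  have hmW : m < W := (Nat.le_mul_of_pos_right m hn).trans_lt hmnW
  have hnW : n < W := (Nat.le_mul_of_pos_left n hm).trans_lt hmnW
  have hW1 : 1 < W := by omega
  obtain ⟨s₀, t₀, M₀, hX₀, ht₀, hM₀, hmain₀, h22, h3⟩ :=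
    Program.exec_init hmW hnW hmnW hW1 E lam
  obtain ⟨x, hx0, hv, hs⟩ := exists_seq_of_step (N := n) (P := fun i y => Pass.Valid E lam i y)
    (R := fun _ y z => Pass.Step W E lam y z)
    (x₀ := ⟨Finset.univ, M₀, s₀, ⟨0, hn⟩, 0⟩)
    ⟨hmain₀, by rw [restrict_univ]; exact hM₀.isMaximalMatching, by simp⟩
    (fun i hi y hy => hy.exists_step hlam hmW hnW hW1 hi)
  have hcount : ∀ i ≤ n, (x i).s.ints 3 0 = n - i := by
    intro i hi
    rw [(hv i hi).maintains.count]
    have := (hv i hi).card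
    omega
  obtain ⟨out, t₁, hX₁, ht₁, h10⟩ := Program.runs_fin hnW hW1 (hv n le_rfl).maintains.input.n_eq
  have hs0 : (x 0).s = s₀ := by rw [hx0]
  rw [← hs0] at hX₀
  have hloop := exec_loop (fun i hi => (hs i hi).exec) hcount n 0 (by omega)
  refine ⟨_, ⟨fun i => (x i).U, fun i => (x i).M, fun i => (x (i + 1)).u, fun i => (x i).s, out,
    ⟨?_, ?_, ?_, ?_, ?_, ?_⟩, ⟨t₀, hX₀⟩, fun i hi => ⟨_, (hs i hi).exec⟩,
    fun i hi => (hv i hi).maintains.represents,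
    .seq _ _ _ _ _ _ _ hX₀ (.seq _ _ _ _ _ _ _ hloop hX₁), ?_⟩, ?_⟩
  · rw [hx0]
  · rw [hx0]; exact hM₀
  · intro i hi; exact (hs i (by simpa using hi)).mem
  · intro i hi; exact (hs i (by simpa using hi)).argmin
  · intro i hi; exact (hs i (by simpa using hi)).delete
  · intro i hi; exact (hs i (by simpa using hi)).relabel
  -- The sets tested are those with index 0 to `n - 1`, that is, exactly the nonempty ones.
  · obtain ⟨j, hj, h1, -, h11, hbest⟩ := passes_best hv hs (by rw [hx0]; exact h22)
      (by rw [hx0]; exact h3) (n - 1) (by omega)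
    rw [Nat.sub_add_cancel hn] at h1 h11
    have hjn : j < n := by omega
    have hempty : (x n).U = ∅ := by
      rw [← Finset.card_eq_zero]
      have := (hv n le_rfl).card
      omega
    refine ⟨j, hjn, fun k hk => hbest k (by omega), fun v => ?_, fun e _ _ => ?_⟩
    · rw [h10 v v.2, h1]
      simp only [passes_deletionTime hv hs n le_rfl j hjn.le v (by simp [hempty])]
    · have hcov : E.edge e ∈ weakEdges (x j).M ↔ (x j).s.ints 6 e ≠ 0 :=
        (hv j hjn.le).maintains.matching.covered_iff e
      rw [hX₁.ints_eq rfl, h11 e e.2, hcov]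
      exact ⟨fun h => if_neg h, fun h => if_pos (not_not.1 h)⟩
  · have hsum : ∑ j ∈ Finset.Ico 0 n, ((x (j + 1)).t + 5) ≤
        n * (m * 370 + 205) + 2 * m * (n * 60 + 100) := by
      calc ∑ j ∈ Finset.Ico 0 n, ((x (j + 1)).t + 5)
          ≤ ∑ j ∈ Finset.range n, ((m * 370 + 205) +
            (Finset.univ.filter fun e => (x (j + 1)).u ∈ E.edge e).card * (n * 60 + 100)) := by
            rw [← Finset.range_eq_Ico]
            refine Finset.sum_le_sum fun j hj => ?_
            have := (hs j (Finset.mem_range.1 hj)).time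
            omega
        _ ≤ n * (m * 370 + 205) + 2 * m * (n * 60 + 100) := by
            rw [Finset.sum_add_distrib, ← Finset.sum_mul]
            refine Nat.add_le_add (by simp) (Nat.mul_le_mul_right _ (passes_sum_degree hs))
    -- The terms linear in `n` or `m` and the constants are absorbed because `m` and `n` are at
    -- least 1. For those in `n` this uses the assumption that there is an edge.
    have h1 : n ≤ m * n := Nat.le_mul_of_pos_left n hm
    have h2 : m ≤ m * n := Nat.le_mul_of_pos_right m hn
    have h3 : 1 ≤ m * n := Nat.mul_pos hm hn
    nlinarith

end STC

theorem mainTheorem9 :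
    -- some implementation of Greedy has a running time in O(mn + (n' + m') + m log n + nm)
    (∃ (init body fin : RAM.Cmd) (c : ℕ) (C : ℝ),
      ∀ (n m : ℕ) (G : SimpleGraph (Fin n)) (E : STC.EdgeList G m) (lam : ℝ),
        1 ≤ m → 0 ≤ lam → lam ≤ 1 →
        ∃ T : ℕ, STC.CarriesOutGreedy ((n + 2) ^ c) init body fin E lam T ∧
          (T : ℝ) ≤ C * STC.greedyBound G m) ∧
    -- and this class is contained in O(nm)
    (∃ C : ℝ, ∀ (n m : ℕ) (G : SimpleGraph (Fin n)), G.edgeSet.ncard = m →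
      STC.greedyBound G m ≤ C * ((n : ℝ) * m)) ∧
    -- every run of Greedy maintains a maximal matching of the wedge graph
    (∀ (n : ℕ) (G : SimpleGraph (Fin n)) (lam : ℝ) (U : ℕ → Finset (Fin n))
      (M : ℕ → Set (Sym2 (Sym2 (Fin n)))) (u : ℕ → Fin n), STC.GreedyRun G lam U M u →
        ∀ i ≤ n, STC.IsMaximalMatching (STC.wedgeGraph (STC.restrict G (U i))) (M i)) := by
  refine ⟨⟨STC.Program.init, STC.Program.body, STC.Program.fin, 3, 2000,
    fun n m G E lam hm h0 _ => ?_⟩, ⟨6, fun n m G hm => STC.greedyBound_le G hm⟩,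
    fun n G lam U M u h i hi => h.isMaximalMatching i (by simpa using hi)⟩
  obtain ⟨T, hT, hle⟩ := STC.exists_carriesOutGreedy G E lam hm h0
  refine ⟨T, hT, ?_⟩
  calc (T : ℝ) ≤ 2000 * ((m : ℝ) * n) := by exact_mod_cast hle
    _ ≤ 2000 * STC.greedyBound G m := by gcongr; exact STC.mul_le_greedyBound G m
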